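/- Let $n,m\ge 0$ and $n_1,\dots,n_m\ge 0$ be integers, let $B_j:\mathbb{R}^n\to\mathbb{R}^{n_j}$ ($1\le j\le m$) be linear surjections, let $\mathcal{Q}:\mathbb{R}^n\to\mathbb{R}^n$ be self-adjoint, let $G_j:\mathbb{R}^{n_j}\to\mathbb{R}^{n_j}$ be positive definite (self-adjoint), and let $c_1,\dots,c_m$ be non-zero real numbers, ordered so that $c_1,\dots,c_{m_+}>0>c_{m_++1},\dots,c_m$ with $0\le m_+\le m$. For positive definite $A$ on $\mathbb{R}^k$ put $g_A(x)=(\det A)^{1/2}e^{-\pi\langle x,Ax\rangle}$, and let $T(A)$ be the set of all convolutions $g_A*\mu$ with $\mu$ a positive finite Borel measure on $\mathbb{R}^k$ of non-zero mass. For measurable $f_j:\mathbb{R}^{n_j}\to[0,\infty]$ with $\int f_j\in(0,\infty)$ put $$\mathrm{BL}(\mathbf{B},\mathbf{c},\mathcal{Q};\mathbf{f})=\frac{\int_{\mathbb{R}^n}e^{-\pi\langle x,\mathcal{Q}x\rangle}\prod_{j=1}^m f_j(B_jx)^{c_j}\,dx}{\prod_{j=1}^m\big(\int_{\mathbb{R}^{n_j}}f_j\big)^{c_j}}\in[0,\infty],$$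 and write $\mathrm{BL}(\mathbf{B},\mathbf{c},\mathcal{Q};\mathbf{A})$ for its value at $f_j=g_{A_j}$, $1\le j\le m$. Assume that the datum is non-degenerate, that is, (i) $\langle x,\mathcal{Q}x\rangle>0$ for every non-zero $x\in\bigcap_{j=1}^{m_+}\ker B_j$ (this intersection being $\mathbb{R}^n$ if $m_+=0$); (ii) $n\ge s^+(\mathcal{Q})+\sum_{j=1}^{m_+}n_j$, where $s^+(\mathcal{Q})$ is the number of positive eigenvalues of $\mathcal{Q}$, counted with multiplicity; (iii) $\mathcal{Q}+\sum_{j=1}^{m_+}c_jB_j^*G_jB_j$ is positive definite. Then $$\inf\big\{\mathrm{BL}(\mathbf{B},\mathbf{c},\mathcal{Q};\mathbf{f}) : f_j\in T(G_j),\ 1\le j\le m\big\}=\inf\big\{\mathrm{BL}(\mathbf{B},\mathbf{c},\mathcal{Q};\mathbf{A}) : A_j \text{ positive definite},\ A_j\le G_j,\ 1\le j\le m\big\}.$$ -/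

import Mathlib

open MeasureTheory Matrix
open scoped ENNReal

namespace InverseBL

/-- The centred gaussian `g_A(x) = (det A)^{1/2} exp (-π ⟨x, A x⟩)` on `ℝⁿ`
(used for positive definite `A`). -/
noncomputable def gaussian {n : ℕ} (A : Matrix (Fin n) (Fin n) ℝ) (x : Fin n → ℝ) : ℝ :=
  Real.sqrt A.det * Real.exp (-Real.pi * (x ⬝ᵥ A *ᵥ x))

/-- The convolution `g_G * μ`, as a function with values in `[0, ∞]`. -/
noncomputable def gaussianConv {n : ℕ} (G : Matrix (Fin n) (Fin n) ℝ)
    (μ : Measure (Fin n → ℝ)) (x : Fin n → ℝ) : ℝ≥0∞ :=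
  ∫⁻ y, ENNReal.ofReal (gaussian G (x - y)) ∂μ

/-- The class `T(G)` of type `G` functions: all `g_G * μ` with `μ` a positive finite Borel measure
of non-zero mass. -/
def typeG {n : ℕ} (G : Matrix (Fin n) (Fin n) ℝ) : Set ((Fin n → ℝ) → ℝ≥0∞) :=
  {f | ∃ μ : Measure (Fin n → ℝ), IsFiniteMeasure μ ∧ μ ≠ 0 ∧ f = gaussianConv G μ}

/-- The Brascamp--Lieb functional
`BL(B, c, Q; f) = (∫ exp (-π ⟨x, Q x⟩) ∏ j, f_j (B_j x) ^ c_j dx) / ∏ j, (∫ f_j) ^ c_j`,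
with values in `[0, ∞]`. -/
noncomputable def BL {n m : ℕ} {d : Fin m → ℕ} (B : ∀ j, Matrix (Fin (d j)) (Fin n) ℝ)
    (c : Fin m → ℝ) (Q : Matrix (Fin n) (Fin n) ℝ)
    (f : ∀ j, (Fin (d j) → ℝ) → ℝ≥0∞) : ℝ≥0∞ :=
  (∫⁻ x : Fin n → ℝ, ENNReal.ofReal (Real.exp (-Real.pi * (x ⬝ᵥ Q *ᵥ x))) *
      ∏ j, f j (B j *ᵥ x) ^ c j) /
    ∏ j, (∫⁻ y, f j y) ^ c j

/-- `BL(B, c, Q; A)`: the Brascamp--Lieb functional at the gaussian inputs `f_j = g_{A_j}`. -/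
noncomputable def BLGaussian {n m : ℕ} {d : Fin m → ℕ}
    (B : ∀ j, Matrix (Fin (d j)) (Fin n) ℝ) (c : Fin m → ℝ) (Q : Matrix (Fin n) (Fin n) ℝ)
    (A : ∀ j, Matrix (Fin (d j)) (Fin (d j)) ℝ) : ℝ≥0∞ :=
  BL B c Q (fun j x => ENNReal.ofReal (gaussian (A j) x))

/-- `I(B, c, Q, G)`: the infimum (best constant) of the functional over inputs `f_j ∈ T(G_j)`. -/
noncomputable def inverseConst {n m : ℕ} {d : Fin m → ℕ}
    (B : ∀ j, Matrix (Fin (d j)) (Fin n) ℝ) (c : Fin m → ℝ) (Q : Matrix (Fin n) (Fin n) ℝ)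
    (G : ∀ j, Matrix (Fin (d j)) (Fin (d j)) ℝ) : ℝ≥0∞ :=
  ⨅ f ∈ {f : ∀ j, (Fin (d j) → ℝ) → ℝ≥0∞ | ∀ j, f j ∈ typeG (G j)}, BL B c Q f

/-- The infimum of `BL(B, c, Q; A)` over positive definite `A_j` with `A_j ≤ G_j`. -/
noncomputable def gaussianInverseConst {n m : ℕ} {d : Fin m → ℕ}
    (B : ∀ j, Matrix (Fin (d j)) (Fin n) ℝ) (c : Fin m → ℝ) (Q : Matrix (Fin n) (Fin n) ℝ)
    (G : ∀ j, Matrix (Fin (d j)) (Fin (d j)) ℝ) : ℝ≥0∞ :=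
  ⨅ A ∈ {A : ∀ j, Matrix (Fin (d j)) (Fin (d j)) ℝ |
      ∀ j, (A j).PosDef ∧ (G j - A j).PosSemidef}, BLGaussian B c Q A

/-- The number `s⁺(Q)` of positive eigenvalues of a symmetric matrix, with multiplicity. -/
noncomputable def numPosEigenvalues {n : ℕ} {Q : Matrix (Fin n) (Fin n) ℝ}
    (hQ : Q.IsHermitian) : ℕ :=
  Nat.card {i : Fin n // 0 < hQ.eigenvalues i}

/-- A generalized Brascamp--Lieb datum `(B, c, Q, G)`: surjective `B_j : ℝⁿ → ℝ^{d j}`, non-zero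
real exponents `c_j`, a self-adjoint `Q`, and positive definite `G_j`. -/
structure IsGeneralizedDatum {n m : ℕ} {d : Fin m → ℕ}
    (B : ∀ j, Matrix (Fin (d j)) (Fin n) ℝ) (c : Fin m → ℝ) (Q : Matrix (Fin n) (Fin n) ℝ)
    (G : ∀ j, Matrix (Fin (d j)) (Fin (d j)) ℝ) : Prop where
  surjective : ∀ j, Function.Surjective (fun x : Fin n → ℝ => B j *ᵥ x)
  exponent_ne_zero : ∀ j, c j ≠ 0
  selfAdjoint : Q.IsHermitian
  posDef : ∀ j, (G j).PosDef

/-- The joint kernel of those `B_j` with `c_j > 0`, that is, the kernel of `𝐁₊`. -/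
def kerPlus {n m : ℕ} {d : Fin m → ℕ}
    (B : ∀ j, Matrix (Fin (d j)) (Fin n) ℝ) (c : Fin m → ℝ) : Submodule ℝ (Fin n → ℝ) :=
  ⨅ (j : Fin m) (_ : 0 < c j), LinearMap.ker (B j).mulVecLin

/-- A non-degenerate generalized Brascamp--Lieb datum. -/
structure IsNondegenerate {n m : ℕ} {d : Fin m → ℕ}
    (B : ∀ j, Matrix (Fin (d j)) (Fin n) ℝ) (c : Fin m → ℝ) (Q : Matrix (Fin n) (Fin n) ℝ)
    (G : ∀ j, Matrix (Fin (d j)) (Fin (d j)) ℝ) : Prop extends IsGeneralizedDatum B c Q G where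
  pos_on_ker : ∀ x ∈ kerPlus B c, x ≠ 0 → 0 < x ⬝ᵥ Q *ᵥ x
  dim_le : numPosEigenvalues selfAdjoint + ∑ j with 0 < c j, d j ≤ n
  pos_at_G : (Q + ∑ j with 0 < c j, c j • ((B j)ᵀ * G j * B j)).PosDef

end InverseBL

/-! One inequality is soft. If `A ≤ G`, completing a square writes `g_A` as a multiple of `g_G * μ`
with `μ` a finite, possibly degenerate gaussian measure (`exists_gaussian_eq_smul_gaussianConv`),
and the functional does not see multiples.

For the other, suppose first that a minimizer `f` exists. Rotate `f ⊗ f` by 45 degrees. The square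
of the numerator becomes an integral over `x` of numerators whose inputs are slices of the rotated
tensor squares. The slices are again of type `G`, and so are their marginals. Applying the
definition of the infimum to the slices and then to the marginals returns the square one started
from, so almost every slice is a minimizer, and by semicontinuity so is the slice at `0`, namely `w
↦ f_j(w/√2) f_j(-w/√2)` (`BL_doubling_eq`). It is even. Iterating gives minimizers `e_j(2^{-i/2}
w)^{2^i}`, which after normalization at `0` tend to a gaussian `e^{-π⟨w, A_j w⟩}` with `A_j ≤ G_j`,
as in the central limit theorem (`exists_gaussian_limit`). Compactness of minimizing sequences makes
the limit a minimizer, and a limit of type `G` decays, so `A_j` is positive definite.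

Compactness (`IsCoercive.exists_subseq_tendsto`) is obtained after replacing `Q` by `Q - δ ∑ B_jᵀ
B_j`, summed over `c_j > 0`. Hypotheses (i) and (ii) split `ℝⁿ` into the joint kernel of these `B_j`
and a complement on which `Q ≤ 0` and the `B_j` are independent coordinates (`exists_splitting`). On
the complement the perturbed kernel grows like a gaussian weight, so the numerator controls weighted
integrals of the `f_j ^ c_j` with `c_j > 0`. This prevents loss of mass for positive exponents;
minimality prevents it for negative ones.

It remains to let `δ → 0`. The perturbation raises the kernel, so the gaussian constant for `Q` is
at most the one for the perturbed form, hence a lower bound for perturbed functionals. Dominated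
convergence removes `δ` whenever some perturbed numerator is finite. Hypothesis (iii) ensures this
for inputs whose measure is compactly supported (`c_j > 0`) or has a small wide gaussian added (`c_j
< 0`). Both modifications decrease `f_j ^ c_j` and barely change the masses, so the bound passes to
all inputs. -/

namespace InverseBL

open Filter Topology

/-! ### Quadratic forms and the sup norm -/

section QuadraticForms

variable {n : ℕ}

lemma mulVec_dotProduct_comm {A : Matrix (Fin n) (Fin n) ℝ} (hA : A.IsHermitian)
    (x y : Fin n → ℝ) : x ⬝ᵥ A *ᵥ y = y ⬝ᵥ A *ᵥ x := by
  rw [dotProduct_mulVec, ← mulVec_transpose, dotProduct_comm]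
  rw [show Aᵀ = A from (conjTranspose_eq_transpose_of_trivial A).symm.trans hA.eq]

lemma quadForm_add {A : Matrix (Fin n) (Fin n) ℝ} (hA : A.IsHermitian) (x y : Fin n → ℝ) :
    (x + y) ⬝ᵥ A *ᵥ (x + y) = x ⬝ᵥ A *ᵥ x + 2 * (x ⬝ᵥ A *ᵥ y) + y ⬝ᵥ A *ᵥ y := by
  rw [mulVec_add, add_dotProduct, dotProduct_add, dotProduct_add, mulVec_dotProduct_comm hA y x]
  ring

lemma quadForm_sub {A : Matrix (Fin n) (Fin n) ℝ} (hA : A.IsHermitian) (x y : Fin n → ℝ) :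
    (x - y) ⬝ᵥ A *ᵥ (x - y) = x ⬝ᵥ A *ᵥ x - 2 * (x ⬝ᵥ A *ᵥ y) + y ⬝ᵥ A *ᵥ y := by
  rw [mulVec_sub, sub_dotProduct, dotProduct_sub, dotProduct_sub, mulVec_dotProduct_comm hA y x]
  ring

lemma quadForm_smul (A : Matrix (Fin n) (Fin n) ℝ) (t : ℝ) (x : Fin n → ℝ) :
    (t • x) ⬝ᵥ A *ᵥ (t • x) = t ^ 2 * (x ⬝ᵥ A *ᵥ x) := by
  rw [mulVec_smul, smul_dotProduct, dotProduct_smul, smul_eq_mul, smul_eq_mul]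
  ring

/-- The spectral decomposition of a quadratic form. -/
lemma quadForm_eigenvectorUnitary {A : Matrix (Fin n) (Fin n) ℝ} (hA : A.IsHermitian)
    (w : Fin n → ℝ) :
    ((hA.eigenvectorUnitary : Matrix (Fin n) (Fin n) ℝ) *ᵥ w) ⬝ᵥ
      A *ᵥ ((hA.eigenvectorUnitary : Matrix (Fin n) (Fin n) ℝ) *ᵥ w) =
      ∑ i, hA.eigenvalues i * w i ^ 2 := by
  have h := hA.conjStarAlgAut_star_eigenvectorUnitary
  rw [Unitary.conjStarAlgAut_star_apply] at h
  set U := (hA.eigenvectorUnitary : Matrix (Fin n) (Fin n) ℝ) with hU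
  have h2 : Uᵀ * A * U = diagonal hA.eigenvalues := by
    simpa [star_eq_conjTranspose, conjTranspose_eq_transpose_of_trivial, Function.comp_def] using h
  have : (U *ᵥ w) ⬝ᵥ A *ᵥ (U *ᵥ w) = w ⬝ᵥ (Uᵀ * A * U) *ᵥ w := by
    rw [← mulVec_mulVec, ← mulVec_mulVec, dotProduct_mulVec w, vecMul_transpose]
  rw [this, h2]
  simp only [dotProduct, mulVec_diagonal]
  exact Finset.sum_congr rfl fun i _ => by ring

lemma eigenvectorUnitary_mulVec_injective {A : Matrix (Fin n) (Fin n) ℝ} (hA : A.IsHermitian) :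
    Function.Injective fun w => (hA.eigenvectorUnitary : Matrix (Fin n) (Fin n) ℝ) *ᵥ w := by
  intro v w hvw
  have := congrArg (fun z => star (hA.eigenvectorUnitary : Matrix (Fin n) (Fin n) ℝ) *ᵥ z) hvw
  simpa [mulVec_mulVec] using this

lemma abs_dotProduct_mulVec_le {k : ℕ} (A : Matrix (Fin k) (Fin n) ℝ) :
    ∃ C, 0 ≤ C ∧ ∀ x y, |x ⬝ᵥ A *ᵥ y| ≤ C * ‖x‖ * ‖y‖ := by
  refine ⟨∑ i, ∑ j, |A i j|, by positivity, fun x y => ?_⟩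
  simp only [dotProduct, mulVec, Finset.mul_sum, Finset.sum_mul]
  refine (Finset.abs_sum_le_sum_abs _ _).trans (Finset.sum_le_sum fun i _ => ?_)
  refine (Finset.abs_sum_le_sum_abs _ _).trans (Finset.sum_le_sum fun j _ => ?_)
  rw [abs_mul, abs_mul]
  have h1 := norm_le_pi_norm x i
  have h2 := norm_le_pi_norm y j
  rw [Real.norm_eq_abs] at h1 h2
  calc |x i| * (|A i j| * |y j|) ≤ ‖x‖ * (|A i j| * ‖y‖) := by gcongr
    _ = _ := by ring

/-- The norm on `Fin n → ℝ` is the sup norm, so passing to and from `x ⬝ᵥ x` costs the factors `1`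
and `n`. -/
lemma norm_sq_le_dotProduct (x : Fin n → ℝ) : ‖x‖ ^ 2 ≤ x ⬝ᵥ x := by
  have h0 : 0 ≤ x ⬝ᵥ x := by simpa using dotProduct_star_self_nonneg x
  suffices ‖x‖ ≤ Real.sqrt (x ⬝ᵥ x) by
    calc ‖x‖ ^ 2 ≤ Real.sqrt (x ⬝ᵥ x) ^ 2 := by gcongr
      _ = _ := Real.sq_sqrt h0
  refine (pi_norm_le_iff_of_nonneg (Real.sqrt_nonneg _)).2 fun i => ?_
  refine Real.le_sqrt_of_sq_le ?_
  rw [Real.norm_eq_abs, sq_abs, dotProduct]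
  refine le_trans (by rw [sq]) (Finset.single_le_sum (f := fun i => x i * x i)
    (fun i _ => mul_self_nonneg _) (Finset.mem_univ i))

lemma dotProduct_self_le (x : Fin n → ℝ) : x ⬝ᵥ x ≤ n * ‖x‖ ^ 2 := by
  rw [dotProduct]
  refine (Finset.sum_le_card_nsmul _ _ (‖x‖ ^ 2) fun i _ => ?_).trans (by simp)
  rw [← sq, ← sq_abs]
  have := norm_le_pi_norm x i
  rw [Real.norm_eq_abs] at this
  gcongr

lemma quadForm_pos {A : Matrix (Fin n) (Fin n) ℝ} (hA : A.PosDef) {x : Fin n → ℝ} (hx : x ≠ 0) :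
    0 < x ⬝ᵥ A *ᵥ x := by
  simpa using hA.dotProduct_mulVec_pos hx

lemma quadForm_nonneg {A : Matrix (Fin n) (Fin n) ℝ} (hA : A.PosDef) (x : Fin n → ℝ) :
    0 ≤ x ⬝ᵥ A *ᵥ x := by
  simpa using hA.posSemidef.dotProduct_mulVec_nonneg x

lemma continuous_quadForm (A : Matrix (Fin n) (Fin n) ℝ) :
    Continuous fun x : Fin n → ℝ => x ⬝ᵥ A *ᵥ x :=
  continuous_id.dotProduct (continuous_const.matrix_mulVec continuous_id)

/-- A positive definite form is bounded below by a multiple of the squared norm. -/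
lemma exists_pos_mul_le_quadForm {A : Matrix (Fin n) (Fin n) ℝ} (hA : A.PosDef) :
    ∃ p, 0 < p ∧ ∀ x : Fin n → ℝ, p * ‖x‖ ^ 2 ≤ x ⬝ᵥ A *ᵥ x := by
  have hc := isCompact_sphere (0 : Fin n → ℝ) 1
  -- The unit sphere is empty precisely when `n = 0`; otherwise the minimum of the form on it is the
  -- constant.
  rcases (Metric.sphere (0 : Fin n → ℝ) 1).eq_empty_or_nonempty with he | hne
  · refine ⟨1, one_pos, fun x => ?_⟩
    by_cases hx : x = 0
    · simp [hx]
    · have : ‖x‖⁻¹ • x ∈ Metric.sphere (0 : Fin n → ℝ) 1 := by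
        simp [norm_smul, hx]
      simp [he] at this
  · obtain ⟨z, hz, hmin⟩ := hc.exists_isMinOn hne (continuous_quadForm A).continuousOn
    have hz0 : z ≠ 0 := by
      rintro rfl
      simp at hz
    refine ⟨_, quadForm_pos hA hz0, fun x => ?_⟩
    by_cases hx : x = 0
    · simp [hx]
    · have hm : ‖x‖⁻¹ • x ∈ Metric.sphere (0 : Fin n → ℝ) 1 := by
        simp [norm_smul, hx]
      have h := hmin hm
      simp only [Set.mem_ofPred_eq, quadForm_smul] at h
      have hpos : 0 < ‖x‖ := norm_pos_iff.2 hx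
      calc _ ≤ (‖x‖⁻¹ ^ 2 * (x ⬝ᵥ A *ᵥ x)) * ‖x‖ ^ 2 := by gcongr
        _ = _ := by field_simp

end QuadraticForms

/-! ### Gaussians and their mass -/

section Gaussians

variable {n : ℕ}

/-- Since `x ⬝ᵥ x ≤ n ‖x‖²`, a product of one-dimensional gaussians of rate `p / n` dominates. The
division by `n` forces a separate case `n = 0`. -/
lemma integrable_exp_neg_norm_sq {p : ℝ} (hp : 0 < p) :
    Integrable fun x : Fin n → ℝ => Real.exp (-p * ‖x‖ ^ 2) := by
  rcases Nat.eq_zero_or_pos n with rfl | hn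
  · have : (fun x : Fin 0 → ℝ => Real.exp (-p * ‖x‖ ^ 2)) = fun _ => 1 := by
      ext x
      simp [Subsingleton.elim x 0]
    rw [this]
    have : IsFiniteMeasure (volume : Measure (Fin 0 → ℝ)) := by
      rw [volume_pi, Measure.pi_of_empty _ 0]
      infer_instance
    exact integrable_const _
  have h : Integrable fun x : Fin n → ℝ => ∏ i, Real.exp (-(p / n) * (x i) ^ 2) :=
    Integrable.fintype_prod (f := fun _ t => Real.exp (-(p / n) * t ^ 2))
      fun i => integrable_exp_neg_mul_sq (by positivity)
  refine h.mono' (by fun_prop) (Eventually.of_forall fun x => ?_)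
  rw [Real.norm_eq_abs, abs_of_pos (Real.exp_pos _), ← Real.exp_sum, Real.exp_le_exp,
    ← Finset.mul_sum]
  have h1 := dotProduct_self_le x
  have h2 : ∑ i, x i ^ 2 = x ⬝ᵥ x := by simp [dotProduct, sq]
  rw [h2, neg_mul, neg_mul, neg_le_neg_iff]
  calc p / n * (x ⬝ᵥ x) ≤ p / n * (n * ‖x‖ ^ 2) := by gcongr
    _ = _ := by field_simp

lemma lintegral_exp_neg_norm_sq_lt_top {p : ℝ} (hp : 0 < p) :
    ∫⁻ x : Fin n → ℝ, ENNReal.ofReal (Real.exp (-p * ‖x‖ ^ 2)) < ∞ :=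
  (integrable_exp_neg_norm_sq hp).lintegral_lt_top

lemma gaussian_pos {A : Matrix (Fin n) (Fin n) ℝ} (hA : A.PosDef) (x : Fin n → ℝ) :
    0 < gaussian A x :=
  mul_pos (Real.sqrt_pos.2 hA.det_pos) (Real.exp_pos _)

lemma gaussian_le {A : Matrix (Fin n) (Fin n) ℝ} (hA : A.PosDef) (x : Fin n → ℝ) :
    gaussian A x ≤ Real.sqrt A.det := by
  refine mul_le_of_le_one_right (Real.sqrt_nonneg _) (Real.exp_le_one_iff.2 ?_)
  have := mul_nonneg Real.pi_pos.le (quadForm_nonneg hA x)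
  linarith

lemma continuous_gaussian (A : Matrix (Fin n) (Fin n) ℝ) : Continuous (gaussian A) :=
  continuous_const.mul (Real.continuous_exp.comp (continuous_const.mul (continuous_quadForm A)))

/-- The total mass of a gaussian. -/
noncomputable def gaussianMass (A : Matrix (Fin n) (Fin n) ℝ) : ℝ≥0∞ :=
  ∫⁻ x, ENNReal.ofReal (gaussian A x)

/-- The value `1` of the mass is never needed: being neither `0` nor `∞` is enough throughout. -/
lemma gaussianMass_ne_zero {A : Matrix (Fin n) (Fin n) ℝ} (hA : A.PosDef) :
    gaussianMass A ≠ 0 := by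
  intro h
  have h := (lintegral_eq_zero_iff
    (ENNReal.continuous_ofReal.comp (continuous_gaussian A)).measurable).1 h
  obtain ⟨x, hx⟩ := h.exists
  have := gaussian_pos hA x
  simp only [Function.comp_apply, Pi.zero_apply, ENNReal.ofReal_eq_zero] at hx
  linarith

lemma gaussianMass_ne_top {A : Matrix (Fin n) (Fin n) ℝ} (hA : A.PosDef) :
    gaussianMass A ≠ ∞ := by
  obtain ⟨p, hp, h⟩ := exists_pos_mul_le_quadForm hA
  have hp' := mul_pos Real.pi_pos hp
  have hle : gaussianMass A ≤ ∫⁻ x : Fin n → ℝ, ENNReal.ofReal (Real.sqrt A.det) *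
      ENNReal.ofReal (Real.exp (-(Real.pi * p) * ‖x‖ ^ 2)) := by
    refine lintegral_mono fun x => ?_
    rw [← ENNReal.ofReal_mul (Real.sqrt_nonneg _)]
    refine ENNReal.ofReal_le_ofReal (mul_le_mul_of_nonneg_left (Real.exp_le_exp.2 ?_)
      (Real.sqrt_nonneg _))
    nlinarith [h x, Real.pi_pos]
  rw [lintegral_const_mul _ (by fun_prop)] at hle
  exact ne_of_lt (hle.trans_lt (ENNReal.mul_lt_top ENNReal.ofReal_lt_top
    (lintegral_exp_neg_norm_sq_lt_top hp')))

end Gaussians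

/-! ### Functions of type `G` -/

section GaussianConv

variable {n : ℕ} {G : Matrix (Fin n) (Fin n) ℝ}

lemma measurable_gaussian_sub (G : Matrix (Fin n) (Fin n) ℝ) :
    Measurable fun p : (Fin n → ℝ) × (Fin n → ℝ) => ENNReal.ofReal (gaussian G (p.1 - p.2)) :=
  ENNReal.measurable_ofReal.comp
    ((continuous_gaussian G).comp (continuous_fst.sub continuous_snd)).measurable

lemma measurable_gaussian_const_sub (G : Matrix (Fin n) (Fin n) ℝ) (x : Fin n → ℝ) :
    Measurable fun y => ENNReal.ofReal (gaussian G (x - y)) :=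
  (ENNReal.continuous_ofReal.comp
    ((continuous_gaussian G).comp (continuous_const.sub continuous_id))).measurable

lemma measurable_gaussianConv (μ : Measure (Fin n → ℝ)) [SFinite μ] :
    Measurable (gaussianConv G μ) :=
  (measurable_gaussian_sub G).lintegral_prod_right'

lemma gaussianConv_le (hG : G.PosDef) (μ : Measure (Fin n → ℝ)) (x : Fin n → ℝ) :
    gaussianConv G μ x ≤ ENNReal.ofReal (Real.sqrt G.det) * μ Set.univ := by
  rw [← lintegral_const]
  exact lintegral_mono fun y => ENNReal.ofReal_le_ofReal (gaussian_le hG _)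

lemma gaussianConv_ne_top (hG : G.PosDef) (μ : Measure (Fin n → ℝ)) [IsFiniteMeasure μ]
    (x : Fin n → ℝ) : gaussianConv G μ x ≠ ∞ :=
  ne_of_lt ((gaussianConv_le hG μ x).trans_lt
    (ENNReal.mul_lt_top ENNReal.ofReal_lt_top (measure_lt_top _ _)))

lemma gaussianConv_ne_zero (hG : G.PosDef) {μ : Measure (Fin n → ℝ)} (hμ : μ ≠ 0)
    (x : Fin n → ℝ) : gaussianConv G μ x ≠ 0 := by
  intro h
  have h := (lintegral_eq_zero_iff (measurable_gaussian_const_sub G x)).1 h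
  have : NeZero μ := ⟨hμ⟩
  obtain ⟨y, hy⟩ := h.exists
  have := gaussian_pos hG (x - y)
  simp only [Pi.zero_apply, ENNReal.ofReal_eq_zero] at hy
  linarith

lemma continuous_gaussianConv (hG : G.PosDef) (μ : Measure (Fin n → ℝ)) [IsFiniteMeasure μ] :
    Continuous (gaussianConv G μ) := by
  refine continuous_iff_continuousAt.2 fun x => ?_
  refine tendsto_lintegral_filter_of_dominated_convergence
    (fun _ => ENNReal.ofReal (Real.sqrt G.det)) ?_ ?_ ?_ ?_
  · exact Eventually.of_forall fun z => measurable_gaussian_const_sub G z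
  · exact Eventually.of_forall fun z => Eventually.of_forall fun y =>
      ENNReal.ofReal_le_ofReal (gaussian_le hG _)
  · rw [lintegral_const]
    exact ENNReal.mul_ne_top ENNReal.ofReal_ne_top (measure_ne_top _ _)
  · refine Eventually.of_forall fun y => ?_
    have hc : Continuous fun z => ENNReal.ofReal (gaussian G (z - y)) :=
      ENNReal.continuous_ofReal.comp
        ((continuous_gaussian G).comp (continuous_id.sub continuous_const))
    exact hc.tendsto x

lemma lintegral_gaussian_sub (G : Matrix (Fin n) (Fin n) ℝ) (y : Fin n → ℝ) :
    ∫⁻ x, ENNReal.ofReal (gaussian G (x - y)) = gaussianMass G :=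
  lintegral_sub_right_eq_self (fun x => ENNReal.ofReal (gaussian G x)) y

lemma lintegral_gaussianConv (μ : Measure (Fin n → ℝ)) [SFinite μ] :
    ∫⁻ x, gaussianConv G μ x = gaussianMass G * μ Set.univ := by
  simp only [gaussianConv]
  rw [lintegral_lintegral_swap (measurable_gaussian_sub G).aemeasurable]
  simp only [lintegral_gaussian_sub, lintegral_const]

lemma gaussianConv_smul (c : ℝ≥0∞) (μ : Measure (Fin n → ℝ)) (x : Fin n → ℝ) :
    gaussianConv G (c • μ) x = c * gaussianConv G μ x := by
  simp [gaussianConv, lintegral_smul_measure]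

lemma gaussianConv_mem_typeG (μ : Measure (Fin n → ℝ)) [IsFiniteMeasure μ] (hμ : μ ≠ 0) :
    gaussianConv G μ ∈ typeG G :=
  ⟨μ, inferInstance, hμ, rfl⟩

lemma lintegral_gaussianConv_ne_zero (hG : G.PosDef) (μ : Measure (Fin n → ℝ)) [SFinite μ]
    (hμ : μ ≠ 0) : ∫⁻ x, gaussianConv G μ x ≠ 0 := by
  rw [lintegral_gaussianConv]
  exact mul_ne_zero (gaussianMass_ne_zero hG) (by simpa using hμ)

lemma lintegral_gaussianConv_ne_top (hG : G.PosDef) (μ : Measure (Fin n → ℝ)) [IsFiniteMeasure μ] :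
    ∫⁻ x, gaussianConv G μ x ≠ ∞ := by
  rw [lintegral_gaussianConv]
  exact ENNReal.mul_ne_top (gaussianMass_ne_top hG) (measure_ne_top _ _)

end GaussianConv

/-! ### Compactness on the one-point compactification -/

section VagueCompactness

variable {n : ℕ}

/-- An embedding of the one-point compactification into a finite-dimensional space. -/
noncomputable def onePointEmbedding : OnePoint (Fin n → ℝ) → (Fin n → ℝ) × ℝ
  | none => 0
  | some a => (((1 + ‖a‖)⁻¹ ^ 2) • a, (1 + ‖a‖)⁻¹)

lemma continuous_onePointEmbedding :
    Continuous (onePointEmbedding : OnePoint (Fin n → ℝ) → _) := by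
  have h1 : ∀ a : Fin n → ℝ, 1 + ‖a‖ ≠ 0 := fun a => by positivity
  refine (OnePoint.continuous_iff _).2 ⟨?_, ?_⟩
  · have hs : Tendsto (fun a : Fin n → ℝ => (1 + ‖a‖)⁻¹) (coclosedCompact (Fin n → ℝ)) (𝓝 0) := by
      rw [coclosedCompact_eq_cocompact]
      exact tendsto_inv_atTop_zero.comp
        (tendsto_atTop_add_const_left _ _ tendsto_norm_cocompact_atTop)
    refine Tendsto.prodMk_nhds (squeeze_zero_norm (fun a => ?_) hs) hs
    have : 0 < 1 + ‖a‖ := by positivity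
    rw [norm_smul, norm_pow, norm_inv, Real.norm_of_nonneg this.le, sq, mul_assoc]
    refine mul_le_of_le_one_right (by positivity) ?_
    rw [inv_mul_le_iff₀ this]
    linarith
  · change Continuous fun a : Fin n → ℝ => (((1 + ‖a‖)⁻¹ ^ 2) • a, (1 + ‖a‖)⁻¹)
    fun_prop (disch := exact h1 _)

/-- The second coordinate recovers the nonzero weight `(1 + ‖a‖)⁻¹`, which can then be cancelled
from the first; the point at infinity is the only one where it vanishes. -/
lemma injective_onePointEmbedding :
    Function.Injective (onePointEmbedding : OnePoint (Fin n → ℝ) → _) := by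
  have h1 : ∀ a : Fin n → ℝ, (1 + ‖a‖)⁻¹ ≠ 0 := fun a => by positivity
  rintro (_ | a) (_ | b) hab
  · rfl
  · exact absurd (congrArg Prod.snd hab).symm (h1 b)
  · exact absurd (congrArg Prod.snd hab) (h1 a)
  · have h2 : (1 + ‖a‖)⁻¹ = (1 + ‖b‖)⁻¹ := congrArg Prod.snd hab
    have h3 : ((1 + ‖a‖)⁻¹ ^ 2) • a = ((1 + ‖b‖)⁻¹ ^ 2) • b := congrArg Prod.fst hab
    rw [h2] at h3
    rw [smul_right_injective _ (pow_ne_zero 2 (h1 b)) h3]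

/-- Metrizability is what turns compactness of the space of probability measures on the
compactification into sequential compactness. -/
instance : TopologicalSpace.MetrizableSpace (OnePoint (Fin n → ℝ)) :=
  (continuous_onePointEmbedding.isClosedEmbedding injective_onePointEmbedding).metrizableSpace

instance : MeasurableSpace (OnePoint (Fin n → ℝ)) := borel _

instance : BorelSpace (OnePoint (Fin n → ℝ)) := ⟨rfl⟩

/-- The gaussian `a ↦ g_G (x - a)`, extended by zero to the one-point compactification. -/
noncomputable def gaussianOnePoint (G : Matrix (Fin n) (Fin n) ℝ) (x : Fin n → ℝ) :
    OnePoint (Fin n → ℝ) → NNReal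
  | none => 0
  | some a => (gaussian G (x - a)).toNNReal

lemma tendsto_gaussian_cocompact {G : Matrix (Fin n) (Fin n) ℝ} (hG : G.PosDef) :
    Tendsto (gaussian G) (cocompact (Fin n → ℝ)) (𝓝 0) := by
  obtain ⟨p, hp, h⟩ := exists_pos_mul_le_quadForm hG
  have h1 : Tendsto (fun x : Fin n → ℝ => x ⬝ᵥ G *ᵥ x) (cocompact (Fin n → ℝ)) atTop :=
    tendsto_atTop_mono h (((tendsto_pow_atTop two_ne_zero).comp
      tendsto_norm_cocompact_atTop).const_mul_atTop hp)
  have h2 := (Real.tendsto_exp_atBot.comp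
    (h1.const_mul_atTop_of_neg (neg_neg_of_pos Real.pi_pos))).const_mul (Real.sqrt G.det)
  rw [mul_zero] at h2
  exact h2

/-- A positive definite gaussian vanishes at infinity, so its extension by zero is an admissible
test function for weak convergence. -/
lemma continuous_gaussianOnePoint {G : Matrix (Fin n) (Fin n) ℝ} (hG : G.PosDef)
    (x : Fin n → ℝ) : Continuous (gaussianOnePoint G x) := by
  refine (OnePoint.continuous_iff _).2 ⟨?_, ?_⟩
  · rw [coclosedCompact_eq_cocompact]
    have h1 : Tendsto (fun a : Fin n → ℝ => x - a) (cocompact _) (cocompact _) :=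
      (Homeomorph.subLeft x).isClosedEmbedding.tendsto_cocompact
    have h2 := (continuous_real_toNNReal.tendsto 0).comp
      ((tendsto_gaussian_cocompact hG).comp h1)
    rw [Real.toNNReal_zero] at h2
    exact h2
  · exact continuous_real_toNNReal.comp
      ((continuous_gaussian G).comp (continuous_const.sub continuous_id))

lemma lintegral_gaussianOnePoint_map (G : Matrix (Fin n) (Fin n) ℝ) (x : Fin n → ℝ)
    (μ : Measure (Fin n → ℝ)) :
    ∫⁻ a, gaussianOnePoint G x a ∂(μ.map OnePoint.some) = gaussianConv G μ x :=
  OnePoint.isOpenEmbedding_coe.measurableEmbedding.lintegral_map _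

/-- The test function is zero at infinity, so mass that has escaped there is invisible and only the
restriction of `P` to the finite points counts. -/
lemma lintegral_gaussianOnePoint (G : Matrix (Fin n) (Fin n) ℝ) (x : Fin n → ℝ)
    (P : Measure (OnePoint (Fin n → ℝ))) :
    ∫⁻ a, gaussianOnePoint G x a ∂P = gaussianConv G (P.comap OnePoint.some) x := by
  have he : MeasurableEmbedding (OnePoint.some : (Fin n → ℝ) → OnePoint (Fin n → ℝ)) :=
    OnePoint.isOpenEmbedding_coe.measurableEmbedding
  rw [← lintegral_gaussianOnePoint_map, he.map_comap, ← lintegral_indicator he.measurableSet_range]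
  have hs : (Set.range OnePoint.some).indicator
      (fun a : OnePoint (Fin n → ℝ) => (gaussianOnePoint G x a : ℝ≥0∞)) =
      fun a => (gaussianOnePoint G x a : ℝ≥0∞) := by
    refine Set.indicator_eq_self.2 fun a ha => ?_
    rcases a with _ | a
    · exact absurd ENNReal.coe_zero ha
    · exact Set.mem_range_self a
  rw [hs]

/-- Vague compactness: a sequence of tuples of probability measures has a subsequence along which
the gaussian convolutions converge pointwise to those of a tuple of subprobability measures. -/
lemma exists_subseq_tendsto_gaussianConv {m : ℕ} {d : Fin m → ℕ}
    {G : ∀ j, Matrix (Fin (d j)) (Fin (d j)) ℝ} (hG : ∀ j, (G j).PosDef)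
    (μ : ℕ → ∀ j, Measure (Fin (d j) → ℝ)) (hμ : ∀ k j, IsProbabilityMeasure (μ k j)) :
    ∃ φ : ℕ → ℕ, StrictMono φ ∧ ∃ ν : ∀ j, Measure (Fin (d j) → ℝ), ∀ j, ν j Set.univ ≤ 1 ∧
      ∀ x, Tendsto (fun k => gaussianConv (G j) (μ (φ k) j) x) atTop
        (𝓝 (gaussianConv (G j) (ν j) x)) := by
  have he : ∀ j, Measurable (OnePoint.some : (Fin (d j) → ℝ) → OnePoint (Fin (d j) → ℝ)) :=
    fun j => OnePoint.continuous_coe.measurable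
  let P : ℕ → ∀ j, ProbabilityMeasure (OnePoint (Fin (d j) → ℝ)) := fun k j =>
    ⟨(μ k j).map OnePoint.some, Measure.isProbabilityMeasure_map (he j).aemeasurable⟩
  let _ := fun j => TopologicalSpace.metrizableSpaceMetric (OnePoint (Fin (d j) → ℝ))
  obtain ⟨P', φ, hφ, hP⟩ := CompactSpace.tendsto_subseq P
  -- The weak limit `P'` may charge infinity. Restricting it to the finite points drops that mass,
  -- which is why only total mass at most `1` is asserted.
  refine ⟨φ, hφ, fun j => (P' j : Measure _).comap OnePoint.some, fun j => ⟨?_, fun x => ?_⟩⟩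
  · rw [OnePoint.isOpenEmbedding_coe.measurableEmbedding.comap_apply]
    exact prob_le_one
  · have h1 := (tendsto_pi_nhds.1 hP) j
    have h2 := ProbabilityMeasure.tendsto_iff_forall_lintegral_tendsto.1 h1
      (BoundedContinuousFunction.mkOfCompact ⟨_, continuous_gaussianOnePoint (hG j) x⟩)
    simp only [BoundedContinuousFunction.mkOfCompact_apply, ContinuousMap.coe_mk] at h2
    rw [lintegral_gaussianOnePoint] at h2
    refine h2.congr fun k => ?_
    exact lintegral_gaussianOnePoint_map _ _ _

end VagueCompactness

/-! ### Splitting `ℝⁿ` along the kernel of the positive part -/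

section Splitting

variable {n m : ℕ} {d : Fin m → ℕ} {B : ∀ j, Matrix (Fin (d j)) (Fin n) ℝ} {c : Fin m → ℝ}
  {Q : Matrix (Fin n) (Fin n) ℝ} {G : ∀ j, Matrix (Fin (d j)) (Fin (d j)) ℝ}

/-- The map `x ↦ (B_j x)_j`, with `j` running over the indices with `c_j > 0`. -/
def mulVecPlus (B : ∀ j, Matrix (Fin (d j)) (Fin n) ℝ) (c : Fin m → ℝ) :
    (Fin n → ℝ) →ₗ[ℝ] (∀ j : {j // 0 < c j}, Fin (d j) → ℝ) :=
  LinearMap.pi fun j => (B j).mulVecLin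

lemma mulVecPlus_apply (x : Fin n → ℝ) (j : {j // 0 < c j}) :
    mulVecPlus B c x j = B j *ᵥ x := rfl

lemma mem_kerPlus {x : Fin n → ℝ} : x ∈ kerPlus B c ↔ mulVecPlus B c x = 0 := by
  simp only [kerPlus, Submodule.mem_iInf, LinearMap.mem_ker, funext_iff, Subtype.forall,
    mulVecPlus_apply, mulVecLin_apply, Pi.zero_apply]

/-- The inclusion of the span of the eigenvectors with nonpositive eigenvalues. -/
noncomputable def nonposInclusion (hQ : Q.IsHermitian) :
    ({i // ¬ 0 < hQ.eigenvalues i} → ℝ) →ₗ[ℝ] (Fin n → ℝ) :=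
  (hQ.eigenvectorUnitary : Matrix (Fin n) (Fin n) ℝ).mulVecLin ∘ₗ
    Function.ExtendByZero.linearMap ℝ Subtype.val

lemma injective_nonposInclusion (hQ : Q.IsHermitian) :
    Function.Injective (nonposInclusion hQ) := by
  intro v w hvw
  have h := eigenvectorUnitary_mulVec_injective hQ hvw
  funext i
  have := congrFun h i.1
  simpa [Function.ExtendByZero.linearMap_apply, Subtype.val_injective.extend_apply] using this

lemma quadForm_nonposInclusion (hQ : Q.IsHermitian) (v : {i // ¬ 0 < hQ.eigenvalues i} → ℝ) :
    nonposInclusion hQ v ⬝ᵥ Q *ᵥ nonposInclusion hQ v ≤ 0 := by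
  rw [nonposInclusion, LinearMap.comp_apply, mulVecLin_apply, quadForm_eigenvectorUnitary]
  refine Finset.sum_nonpos fun i _ => ?_
  by_cases hi : 0 < hQ.eigenvalues i
  · rw [Function.ExtendByZero.linearMap_apply, Function.extend_apply']
    · simp
    · rintro ⟨⟨j, hj⟩, rfl⟩
      exact hj hi
  · exact mul_nonpos_of_nonpos_of_nonneg (not_lt.1 hi) (sq_nonneg _)

/-- Nondegeneracy splits `ℝⁿ` into `kerPlus` and a complement on which `Q ≤ 0` and on which the
maps `B_j` with `c_j > 0` are independent coordinates. -/
lemma exists_splitting (h : IsNondegenerate B c Q G) :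
    ∃ (k : ℕ) (e : ((Fin k → ℝ) × (∀ j : {j // 0 < c j}, Fin (d j) → ℝ)) ≃ₗ[ℝ] (Fin n → ℝ)),
      (∀ z j, mulVecPlus B c (e z) j = z.2 j) ∧ ∀ y, e (0, y) ⬝ᵥ Q *ᵥ e (0, y) ≤ 0 := by
  have hQ := h.selfAdjoint
  set ψ := nonposInclusion hQ
  -- A nonzero vector killed here would lie in `kerPlus`, where `Q > 0`, and in the nonpositive
  -- spectral subspace, where `Q ≤ 0`.
  have hinj : Function.Injective (mulVecPlus B c ∘ₗ ψ) := by
    refine (injective_iff_map_eq_zero _).2 fun v hv => ?_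
    by_contra hne
    have h0 : ψ v ≠ 0 := fun h0 => hne (injective_nonposInclusion hQ (h0.trans (map_zero _).symm))
    exact absurd (h.pos_on_ker _ (mem_kerPlus.2 hv) h0) (not_lt.2 (quadForm_nonposInclusion hQ v))
  have hdim : Module.finrank ℝ (∀ j : {j // 0 < c j}, Fin (d j) → ℝ) =
      ∑ j with 0 < c j, d j := by
    rw [Module.finrank_pi_fintype]
    simp only [Module.finrank_fintype_fun_eq_card, Fintype.card_fin]
    exact (Finset.sum_subtype _ (by simp) (fun j => d j)).symm
  have hcard : Module.finrank ℝ ({i // ¬ 0 < hQ.eigenvalues i} → ℝ) = n - numPosEigenvalues hQ := by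
    rw [Module.finrank_fintype_fun_eq_card, Fintype.card_subtype_compl, Fintype.card_fin,
      numPosEigenvalues, Nat.card_eq_fintype_card]
  have hle := LinearMap.finrank_le_finrank_of_injective hinj
  have hdl := h.dim_le
  -- Injectivity gives `n - s⁺(Q) ≤ ∑ d j` and hypothesis (ii) the reverse, so the nonpositive
  -- spectral subspace is exactly a complement of the kernel.
  let E := LinearEquiv.ofInjectiveOfFinrankEq (mulVecPlus B c ∘ₗ ψ) hinj (by omega)
  have hE : ∀ y, mulVecPlus B c (ψ (E.symm y)) = y := fun y => E.apply_symm_apply y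
  let K := LinearMap.ker (mulVecPlus B c)
  let b := (Module.finBasis ℝ K).equivFun
  let f : ((Fin _ → ℝ) × (∀ j : {j // 0 < c j}, Fin (d j) → ℝ)) →ₗ[ℝ] (Fin n → ℝ) :=
    (K.subtype ∘ₗ b.symm.toLinearMap).coprod (ψ ∘ₗ E.symm.toLinearMap)
  have hf : ∀ z, f z = (b.symm z.1 : Fin n → ℝ) + ψ (E.symm z.2) := fun z => rfl
  have hk : ∀ w : K, mulVecPlus B c w = 0 := fun w => w.2
  have hBf : ∀ z, mulVecPlus B c (f z) = z.2 := fun z => by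
    rw [hf, map_add, hk, zero_add, hE]
  have hbij : Function.Bijective f := by
    refine ⟨(injective_iff_map_eq_zero _).2 fun z hz => ?_, fun x => ?_⟩
    · have h2 : z.2 = 0 := by rw [← hBf, hz, map_zero]
      have h1 := hf z
      rw [hz, h2, map_zero, map_zero, add_zero] at h1
      have h3 : b.symm z.1 = 0 := Subtype.ext h1.symm
      exact Prod.ext (by simpa using h3) h2
    · have hx : x - ψ (E.symm (mulVecPlus B c x)) ∈ K := by
        rw [LinearMap.mem_ker, map_sub, hE, sub_self]
      refine ⟨(b ⟨_, hx⟩, mulVecPlus B c x), ?_⟩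
      rw [hf, LinearEquiv.symm_apply_apply]
      simp
  refine ⟨_, LinearEquiv.ofBijective f hbij, fun z j => congrFun (hBf z) j, fun y => ?_⟩
  have : LinearEquiv.ofBijective f hbij (0, y) = ψ (E.symm y) := by
    rw [LinearEquiv.ofBijective_apply, hf]
    simp
  rw [this]
  exact quadForm_nonposInclusion hQ _

end Splitting

/-! ### Tonelli for finite products -/

section ProductIntegral

lemma lintegral_pi_prod_eq {ι : Type*} [Fintype ι] {X : ι → Type*} [∀ i, MeasurableSpace (X i)]
    (μ : ∀ i, Measure (X i)) [∀ i, SigmaFinite (μ i)] {φ : ∀ i, X i → ℝ≥0∞}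
    (hφ : ∀ i, Measurable (φ i)) :
    ∫⁻ y, ∏ i, φ i (y i) ∂(Measure.pi μ) = ∏ i, ∫⁻ t, φ i t ∂(μ i) := by
  classical
  -- The constant `C` must be general: it absorbs the factor just integrated out before the
  -- induction hypothesis is applied.
  have key : ∀ (s : Finset ι) (C : ℝ≥0∞),
      (∫⋯∫⁻_s, (fun y => C * ∏ i ∈ s, φ i (y i)) ∂μ) = fun _ => C * ∏ i ∈ s, ∫⁻ t, φ i t ∂(μ i) := by
    intro s
    induction s using Finset.induction_on with
    | empty => intro C; simp
    | insert a s ha ih =>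
      intro C
      rw [lmarginal_insert' _ (by fun_prop) ha]
      have : (fun y : ∀ i, X i => ∫⁻ t, C * ∏ i ∈ insert a s, φ i (Function.update y a t i) ∂(μ a)) =
          fun y => (C * ∫⁻ t, φ a t ∂(μ a)) * ∏ i ∈ s, φ i (y i) := by
        funext y
        have h1 : ∀ t, C * ∏ i ∈ insert a s, φ i (Function.update y a t i) =
            (C * ∏ i ∈ s, φ i (y i)) * φ a t := fun t => by
          rw [Finset.prod_insert ha, Function.update_self, Finset.prod_congr rfl fun i hi => by
            rw [Function.update_of_ne (ne_of_mem_of_not_mem hi ha)]]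
          ring
        simp only [h1]
        rw [lintegral_const_mul _ (hφ a)]
        ring
      rw [this, ih, Finset.prod_insert ha, mul_assoc]
  -- A marginal over all variables is evaluated at a base point, so an empty product space is
  -- treated apart.
  rcases isEmpty_or_nonempty (∀ i, X i) with he | ⟨⟨y0⟩⟩
  · have : ∃ i, IsEmpty (X i) := by
      by_contra! hne
      exact he.elim fun i => (hne i).some
    obtain ⟨i, hi⟩ := this
    rw [Finset.prod_eq_zero (Finset.mem_univ i) (by simp [Measure.eq_zero_of_isEmpty])]
    simp [Measure.eq_zero_of_isEmpty]
  · rw [lintegral_eq_lmarginal_univ y0]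
    have := congrFun (key Finset.univ 1) y0
    simpa using this

end ProductIntegral

/-! ### Weighted integrals and tightness -/

section WeightedIntegrals

variable {n : ℕ}

/-- The weight `exp (η ‖y‖²)`. -/
noncomputable def expWeight (η : ℝ) (y : Fin n → ℝ) : ℝ≥0∞ :=
  ENNReal.ofReal (Real.exp (η * ‖y‖ ^ 2))

lemma measurable_expWeight (η : ℝ) : Measurable (expWeight η : (Fin n → ℝ) → ℝ≥0∞) := by
  unfold expWeight
  fun_prop

lemma rpow_le_rpow_of_nonpos {a b : ℝ≥0∞} (hab : a ≤ b) {c : ℝ} (hc : c ≤ 0) :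
    b ^ c ≤ a ^ c := by
  have h := ENNReal.inv_le_inv.2 (ENNReal.rpow_le_rpow hab (neg_nonneg.2 hc))
  rwa [ENNReal.rpow_neg, ENNReal.rpow_neg, inv_inv, inv_inv] at h

/-- A Young type inequality: a bounded `t` is controlled by `t ^ c` times a growing weight, up to
a function of small integral. -/
lemma exists_le_add_expWeight_mul_rpow (c : ℝ) {η : ℝ} (hη : 0 < η) {D : ℝ≥0∞} (hD : D ≠ ∞)
    {ε : ℝ≥0∞} (hε : ε ≠ 0) :
    ∃ C : ℝ≥0∞, C ≠ ∞ ∧ ∃ v : (Fin n → ℝ) → ℝ≥0∞, Measurable v ∧ ∫⁻ y, v y ≤ ε ∧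
      ∀ y, ∀ t ≤ D, t ≤ v y + C * (expWeight η y * t ^ c) := by
  have hw : ∀ y : Fin n → ℝ, 1 ≤ expWeight η y := fun y => by
    rw [expWeight, ENNReal.one_le_ofReal, Real.one_le_exp_iff]
    positivity
  have hsplit : ∀ t : ℝ≥0∞, t ≠ 0 → t ≠ ∞ → t = t ^ c * t ^ (1 - c) := fun t h0 h1 => by
    rw [← ENNReal.rpow_add _ _ h0 h1]
    simp
  -- Write `t = t ^ c * t ^ (1 - c)`. For `c ≤ 1` the second factor is at most `D ^ (1 - c)` and `v
  -- = 0` works. For `c > 1` take `v = r exp (-(η / (c - 1)) ‖y‖²)`, chosen so that `v ^ (1 - c)` is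
  -- `r ^ (1 - c)` times the weight; either `t ≤ v`, or `t ^ (1 - c) ≤ v ^ (1 - c)`. The factor `r`
  -- makes the integral of `v` small.
  rcases le_or_gt c 1 with h1 | h1
  · refine ⟨D ^ (1 - c), ENNReal.rpow_ne_top_of_nonneg (by linarith) hD, 0, measurable_const,
      by simp, fun y t ht => ?_⟩
    rcases eq_or_ne t 0 with rfl | h0
    · exact zero_le
    calc t = t ^ c * t ^ (1 - c) := hsplit t h0 (ne_top_of_le_ne_top hD ht)
      _ ≤ (expWeight η y * t ^ c) * D ^ (1 - c) := by
        gcongr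
        exact le_mul_of_one_le_left' (hw y)
      _ = _ := by simp [mul_comm]
  · have hs : 0 < η / (c - 1) := div_pos hη (by linarith)
    set J := ∫⁻ y : Fin n → ℝ, ENNReal.ofReal (Real.exp (-(η / (c - 1)) * ‖y‖ ^ 2)) with hJ
    have hJt : J ≠ ∞ := (lintegral_exp_neg_norm_sq_lt_top hs).ne
    obtain ⟨r, hr, hrε⟩ : ∃ r : ℝ, 0 < r ∧ ENNReal.ofReal r * J ≤ ε := by
      obtain ⟨δ, hδ, h⟩ := ENNReal.exists_nnreal_pos_mul_lt hJt hε
      exact ⟨δ, hδ, by simpa using h.le⟩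
    refine ⟨ENNReal.ofReal (r ^ (1 - c)), ENNReal.ofReal_ne_top,
      fun y => ENNReal.ofReal r * ENNReal.ofReal (Real.exp (-(η / (c - 1)) * ‖y‖ ^ 2)),
      by fun_prop, ?_, fun y t ht => ?_⟩
    · rwa [lintegral_const_mul _ (by fun_prop)]
    set v := ENNReal.ofReal r * ENNReal.ofReal (Real.exp (-(η / (c - 1)) * ‖y‖ ^ 2)) with hv
    rcases le_or_gt t v with htv | htv
    · exact htv.trans le_self_add
    have ht0 : t ≠ 0 := (zero_le.trans_lt htv).ne'
    refine le_trans ?_ le_add_self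
    have hv1 : v ^ (1 - c) = ENNReal.ofReal (r ^ (1 - c)) * expWeight η y := by
      have : c - 1 ≠ 0 := by linarith
      rw [hv, ← ENNReal.ofReal_mul hr.le, ENNReal.ofReal_rpow_of_pos (by positivity),
        Real.mul_rpow hr.le (Real.exp_pos _).le, ← Real.exp_mul, expWeight,
        ← ENNReal.ofReal_mul (by positivity)]
      congr 3
      field_simp
      ring
    calc t = t ^ c * t ^ (1 - c) := hsplit t ht0 (ne_top_of_le_ne_top hD ht)
      _ ≤ t ^ c * v ^ (1 - c) := by
        exact mul_le_mul_right (rpow_le_rpow_of_nonpos htv.le (by linarith)) _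
      _ = _ := by rw [hv1]; ring

variable {G : Matrix (Fin n) (Fin n) ℝ}

lemma gaussianConv_le_of_isProbabilityMeasure (hG : G.PosDef) (μ : Measure (Fin n → ℝ))
    [IsProbabilityMeasure μ] (x : Fin n → ℝ) :
    gaussianConv G μ x ≤ ENNReal.ofReal (Real.sqrt G.det) := by
  simpa using gaussianConv_le hG μ x

lemma lintegral_gaussianConv_of_isProbabilityMeasure (μ : Measure (Fin n → ℝ))
    [IsProbabilityMeasure μ] : ∫⁻ x, gaussianConv G μ x = gaussianMass G := by
  simp [lintegral_gaussianConv]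

/-- Weighted integrals of powers of gaussian convolutions are bounded below. -/
lemma exists_le_lintegral_expWeight_mul_rpow (hG : G.PosDef) (c : ℝ) {η : ℝ} (hη : 0 < η) :
    ∃ κ : ℝ≥0∞, κ ≠ 0 ∧ κ ≠ ∞ ∧ ∀ μ : Measure (Fin n → ℝ), IsProbabilityMeasure μ →
      κ ≤ ∫⁻ y, expWeight η y * gaussianConv G μ y ^ c := by
  have h0 := gaussianMass_ne_zero hG
  have ht := gaussianMass_ne_top hG
  have h2 : gaussianMass G / 2 ≠ 0 := by simpa using h0
  -- The error `v` may account for half the mass only, so the weighted integral must carry the other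
  -- half. Dividing by `C + 1` avoids the case `C = 0`.
  obtain ⟨C, hC, v, hv, hvε, h⟩ := exists_le_add_expWeight_mul_rpow (n := n) c hη
    (ENNReal.ofReal_ne_top (r := Real.sqrt G.det)) h2
  refine ⟨gaussianMass G / 2 / (C + 1), ?_, ?_, fun μ hμ => ?_⟩
  · exact ENNReal.div_ne_zero.2 ⟨h2, by simp [hC]⟩
  · exact ENNReal.div_ne_top (ENNReal.div_ne_top ht (by simp)) (by simp)
  · refine ENNReal.div_le_of_le_mul' ?_
    have h3 : gaussianMass G ≤ gaussianMass G / 2 +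
        (C + 1) * ∫⁻ y, expWeight η y * gaussianConv G μ y ^ c := by
      calc gaussianMass G = ∫⁻ y, gaussianConv G μ y :=
            (lintegral_gaussianConv_of_isProbabilityMeasure μ).symm
        _ ≤ ∫⁻ y, (v y + C * (expWeight η y * gaussianConv G μ y ^ c)) :=
            lintegral_mono fun y => h y _ (gaussianConv_le_of_isProbabilityMeasure hG μ y)
        _ = (∫⁻ y, v y) + C * ∫⁻ y, expWeight η y * gaussianConv G μ y ^ c := by
            rw [lintegral_add_left hv, lintegral_const_mul' _ _ hC]
        _ ≤ _ := by
            gcongr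
            exact le_self_add
    have h4 : gaussianMass G / 2 ≠ ∞ := ENNReal.div_ne_top ht (by simp)
    refine (ENNReal.add_le_add_iff_left h4).1 ?_
    rwa [ENNReal.add_halves]

/-- Bounded weighted integrals give uniformly small tails. -/
lemma exists_tail_le (hG : G.PosDef) (c : ℝ) {η : ℝ} (hη : 0 < η)
    {M : ℝ≥0∞} (hM : M ≠ ∞) {ε : ℝ≥0∞} (hε : ε ≠ 0) :
    ∃ R : ℝ, ∀ μ : Measure (Fin n → ℝ), IsProbabilityMeasure μ →
      ∫⁻ y, expWeight η y * gaussianConv G μ y ^ c ≤ M →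
      gaussianMass G ≤ (∫⁻ y in Metric.closedBall 0 R, gaussianConv G μ y) + ε := by
  have hε2 : ε / 2 ≠ 0 := by simpa using hε
  -- Only the weight with rate `η / 2` is spent; the other half yields the factor `exp (-(η / 2)
  -- R²)` outside the ball, which makes the tail small.
  obtain ⟨C, hC, v, hv, hvε, h⟩ := exists_le_add_expWeight_mul_rpow (n := n) c (half_pos hη)
    (ENNReal.ofReal_ne_top (r := Real.sqrt G.det)) hε2
  obtain ⟨R, hR0, hR⟩ : ∃ R : ℝ, 0 ≤ R ∧
      C * M * ENNReal.ofReal (Real.exp (-(η / 2) * R ^ 2)) ≤ ε / 2 := by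
    have ht : Tendsto (fun R : ℝ => C * M * ENNReal.ofReal (Real.exp (-(η / 2) * R ^ 2))) atTop
        (𝓝 (C * M * ENNReal.ofReal 0)) := by
      refine ENNReal.Tendsto.const_mul ((ENNReal.continuous_ofReal.tendsto 0).comp
        (Real.tendsto_exp_atBot.comp ((tendsto_pow_atTop two_ne_zero).const_mul_atTop_of_neg
          (by linarith)))) (Or.inr (ENNReal.mul_ne_top hC hM))
    rw [ENNReal.ofReal_zero, mul_zero] at ht
    have := (ht.eventually (ge_mem_nhds (pos_iff_ne_zero.2 hε2))).and (eventually_ge_atTop 0)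
    obtain ⟨R, h1, h2⟩ := this.exists
    exact ⟨R, h2, h1⟩
  refine ⟨R, fun μ hμ hK => ?_⟩
  set f := gaussianConv G μ with hf
  have htail : ∫⁻ y in (Metric.closedBall 0 R)ᶜ, f y ≤ ε := by
    have hw : ∀ y ∈ (Metric.closedBall (0 : Fin n → ℝ) R)ᶜ, expWeight (η / 2) y * f y ^ c ≤
        ENNReal.ofReal (Real.exp (-(η / 2) * R ^ 2)) * (expWeight η y * f y ^ c) := by
      intro y hy
      rw [← mul_assoc]
      gcongr
      rw [expWeight, expWeight, ← ENNReal.ofReal_mul (Real.exp_pos _).le, ← Real.exp_add]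
      refine ENNReal.ofReal_le_ofReal (Real.exp_le_exp.2 ?_)
      have hy' : R < ‖y‖ := by simpa using hy
      nlinarith [mul_self_le_mul_self hR0 hy'.le]
    calc ∫⁻ y in (Metric.closedBall 0 R)ᶜ, f y
        ≤ ∫⁻ y in (Metric.closedBall 0 R)ᶜ, (v y + C * (expWeight (η / 2) y * f y ^ c)) :=
          lintegral_mono fun y => h y _ (gaussianConv_le_of_isProbabilityMeasure hG μ y)
      _ = (∫⁻ y in (Metric.closedBall 0 R)ᶜ, v y) +
          C * ∫⁻ y in (Metric.closedBall 0 R)ᶜ, expWeight (η / 2) y * f y ^ c := by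
          rw [lintegral_add_left hv, lintegral_const_mul' _ _ hC]
      _ ≤ ε / 2 + C * ∫⁻ y in (Metric.closedBall 0 R)ᶜ,
          ENNReal.ofReal (Real.exp (-(η / 2) * R ^ 2)) * (expWeight η y * f y ^ c) := by
          refine add_le_add ((setLIntegral_le_lintegral _ _).trans hvε) ?_
          exact mul_le_mul_right
            (setLIntegral_mono' Metric.isClosed_closedBall.measurableSet.compl hw) _
      _ ≤ ε / 2 + C * (ENNReal.ofReal (Real.exp (-(η / 2) * R ^ 2)) * M) := by
          rw [lintegral_const_mul' _ _ ENNReal.ofReal_ne_top]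
          gcongr
          exact (setLIntegral_le_lintegral _ _).trans hK
      _ ≤ ε / 2 + ε / 2 := by
          gcongr
          refine le_trans (le_of_eq ?_) hR
          ring
      _ = ε := ENNReal.add_halves ε
  calc gaussianMass G = ∫⁻ y, f y := (lintegral_gaussianConv_of_isProbabilityMeasure μ).symm
    _ = (∫⁻ y in Metric.closedBall 0 R, f y) + ∫⁻ y in (Metric.closedBall 0 R)ᶜ, f y :=
      (lintegral_add_compl _ Metric.isClosed_closedBall.measurableSet).symm
    _ ≤ _ := by gcongr

/-- No mass is lost in a pointwise limit under a bound on weighted integrals. -/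
lemma gaussianMass_le_lintegral_of_tendsto (hG : G.PosDef) (c : ℝ) {η : ℝ} (hη : 0 < η)
    {M : ℝ≥0∞} (hM : M ≠ ∞) (μ : ℕ → Measure (Fin n → ℝ)) (hμ : ∀ k, IsProbabilityMeasure (μ k))
    (hK : ∀ k, ∫⁻ y, expWeight η y * gaussianConv G (μ k) y ^ c ≤ M)
    {f : (Fin n → ℝ) → ℝ≥0∞} (hf : ∀ x, Tendsto (fun k => gaussianConv G (μ k) x) atTop (𝓝 (f x))) :
    gaussianMass G ≤ ∫⁻ x, f x := by
  refine ENNReal.le_of_forall_pos_le_add fun ε hε _ => ?_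
  obtain ⟨R, hR⟩ := exists_tail_le hG c hη hM (ENNReal.coe_ne_zero.2 hε.ne')
  have ht : Tendsto (fun k => ∫⁻ y in Metric.closedBall 0 R, gaussianConv G (μ k) y) atTop
      (𝓝 (∫⁻ y in Metric.closedBall 0 R, f y)) := by
    refine tendsto_lintegral_of_dominated_convergence
      (fun _ => ENNReal.ofReal (Real.sqrt G.det)) (fun k => measurable_gaussianConv _)
      (fun k => Eventually.of_forall fun y => gaussianConv_le_of_isProbabilityMeasure hG _ y) ?_
      (Eventually.of_forall hf)
    rw [setLIntegral_const]
    exact ENNReal.mul_ne_top ENNReal.ofReal_ne_top measure_closedBall_lt_top.ne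
  refine (ge_of_tendsto' (ht.add_const (ε : ℝ≥0∞)) fun k => hR (μ k) (hμ k) (hK k)).trans ?_
  exact add_le_add_left (setLIntegral_le_lintegral _ _) _

end WeightedIntegrals

/-! ### Coercivity of the perturbed datum -/

section Coercivity

variable {n m : ℕ} {d : Fin m → ℕ} {B : ∀ j, Matrix (Fin (d j)) (Fin n) ℝ} {c : Fin m → ℝ}
  {Q : Matrix (Fin n) (Fin n) ℝ} {G : ∀ j, Matrix (Fin (d j)) (Fin (d j)) ℝ}

/-- The factor `exp (-π ⟨x, Q x⟩)`. -/
noncomputable def gaussianKernel (Q : Matrix (Fin n) (Fin n) ℝ) (x : Fin n → ℝ) : ℝ≥0∞ :=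
  ENNReal.ofReal (Real.exp (-Real.pi * (x ⬝ᵥ Q *ᵥ x)))

lemma continuous_gaussianKernel (Q : Matrix (Fin n) (Fin n) ℝ) : Continuous (gaussianKernel Q) :=
  ENNReal.continuous_ofReal.comp
    (Real.continuous_exp.comp (continuous_const.mul (continuous_quadForm Q)))

lemma gaussianKernel_ne_zero (Q : Matrix (Fin n) (Fin n) ℝ) (x : Fin n → ℝ) :
    gaussianKernel Q x ≠ 0 := by
  rw [gaussianKernel, Ne, ENNReal.ofReal_eq_zero, not_le]
  exact Real.exp_pos _

lemma gaussianKernel_ne_top (Q : Matrix (Fin n) (Fin n) ℝ) (x : Fin n → ℝ) :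
    gaussianKernel Q x ≠ ∞ := ENNReal.ofReal_ne_top

/-- The numerator of the Brascamp--Lieb functional. -/
noncomputable def numerator (B : ∀ j, Matrix (Fin (d j)) (Fin n) ℝ) (c : Fin m → ℝ)
    (Q : Matrix (Fin n) (Fin n) ℝ) (f : ∀ j, (Fin (d j) → ℝ) → ℝ≥0∞) : ℝ≥0∞ :=
  ∫⁻ x : Fin n → ℝ, gaussianKernel Q x * ∏ j, f j (B j *ᵥ x) ^ c j

/-- The weighted integrals attached to positive exponents are controlled by the numerator. -/
def IsCoercive (B : ∀ j, Matrix (Fin (d j)) (Fin n) ℝ) (c : Fin m → ℝ)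
    (Q : Matrix (Fin n) (Fin n) ℝ) (G : ∀ j, Matrix (Fin (d j)) (Fin (d j)) ℝ) : Prop :=
  ∃ η : ℝ, 0 < η ∧ ∃ C : ℝ≥0∞, C ≠ ∞ ∧ ∀ μ : ∀ j, Measure (Fin (d j) → ℝ),
    (∀ j, IsProbabilityMeasure (μ j)) →
    ∏ j : {j // 0 < c j}, ∫⁻ y, expWeight η y * gaussianConv (G j) (μ j) y ^ c j ≤
      C * numerator B c Q fun j => gaussianConv (G j) (μ j)

/-- The matrix `Q - δ ∑_{c_j > 0} B_jᵀ B_j`. -/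
noncomputable def perturb (B : ∀ j, Matrix (Fin (d j)) (Fin n) ℝ) (c : Fin m → ℝ)
    (Q : Matrix (Fin n) (Fin n) ℝ) (δ : ℝ) : Matrix (Fin n) (Fin n) ℝ :=
  Q - δ • ∑ j with 0 < c j, (B j)ᵀ * B j

lemma dotProduct_sum_mulVec {ι : Type*} (s : Finset ι) (M : ι → Matrix (Fin n) (Fin n) ℝ)
    (x : Fin n → ℝ) : x ⬝ᵥ (∑ i ∈ s, M i) *ᵥ x = ∑ i ∈ s, x ⬝ᵥ M i *ᵥ x := by
  rw [sum_mulVec, dotProduct_sum]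

lemma quadForm_perturb (δ : ℝ) (x : Fin n → ℝ) :
    x ⬝ᵥ perturb B c Q δ *ᵥ x =
      x ⬝ᵥ Q *ᵥ x - δ * ∑ j with 0 < c j, (B j *ᵥ x) ⬝ᵥ (B j *ᵥ x) := by
  rw [perturb, sub_mulVec, dotProduct_sub, smul_mulVec, dotProduct_smul, dotProduct_sum_mulVec,
    smul_eq_mul]
  congr 2
  refine Finset.sum_congr rfl fun j _ => ?_
  rw [← mulVec_mulVec, dotProduct_mulVec, vecMul_transpose]

lemma gaussianKernel_le_perturb {δ : ℝ} (hδ : 0 ≤ δ) (x : Fin n → ℝ) :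
    gaussianKernel Q x ≤ gaussianKernel (perturb B c Q δ) x := by
  refine ENNReal.ofReal_le_ofReal (Real.exp_le_exp.2 ?_)
  rw [quadForm_perturb]
  have : 0 ≤ δ * ∑ j with 0 < c j, (B j *ᵥ x) ⬝ᵥ (B j *ᵥ x) :=
    mul_nonneg hδ (Finset.sum_nonneg fun j _ => (sq_nonneg _).trans (norm_sq_le_dotProduct _))
  nlinarith [Real.pi_pos]

/-- Convolutions with probability measures are bounded above by `√det G`, so their negative powers
are bounded below, uniformly in the measures. -/
lemma exists_prod_neg_le (hG : ∀ j, (G j).PosDef) :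
    ∃ E : ℝ≥0∞, E ≠ 0 ∧ E ≠ ∞ ∧ ∀ μ : ∀ j, Measure (Fin (d j) → ℝ), (∀ j, IsProbabilityMeasure (μ j)) →
      ∀ z : ∀ j, Fin (d j) → ℝ,
      E ≤ ∏ j : {j // ¬ 0 < c j}, gaussianConv (G j) (μ j) (z j) ^ c j := by
  have hpos : ∀ j, 0 < ENNReal.ofReal (Real.sqrt (G j).det) := fun j =>
    ENNReal.ofReal_pos.2 (Real.sqrt_pos.2 (hG j).det_pos)
  refine ⟨∏ j : {j // ¬ 0 < c j}, ENNReal.ofReal (Real.sqrt (G j).det) ^ c j, ?_, ?_,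
    fun μ hμ z => Finset.prod_le_prod' fun j _ => ?_⟩
  · exact Finset.prod_ne_zero_iff.2 fun j _ => (ENNReal.rpow_pos (hpos j)
      ENNReal.ofReal_ne_top).ne'
  · exact ENNReal.prod_ne_top fun j _ => ENNReal.rpow_ne_top_of_ne_zero (hpos j).ne'
      ENNReal.ofReal_ne_top
  · exact rpow_le_rpow_of_nonpos (gaussianConv_le_of_isProbabilityMeasure (hG _) _ _) (not_lt.1 j.2)

/-- The perturbed quadratic form in split coordinates. -/
lemma exists_quadForm_perturb_le (hQ : Q.IsHermitian) {δ : ℝ} (hδ : 0 < δ) {k : ℕ}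
    (e : ((Fin k → ℝ) × (∀ j : {j // 0 < c j}, Fin (d j) → ℝ)) ≃ₗ[ℝ] (Fin n → ℝ))
    (he : ∀ z j, mulVecPlus B c (e z) j = z.2 j)
    (hneg : ∀ y, e (0, y) ⬝ᵥ Q *ᵥ e (0, y) ≤ 0) :
    ∃ K : ℝ, ∀ u : Fin k → ℝ, ‖u‖ ≤ 1 → ∀ y : ∀ j : {j // 0 < c j}, Fin (d j) → ℝ,
      e (u, y) ⬝ᵥ perturb B c Q δ *ᵥ e (u, y) ≤ K - δ / 2 * ∑ j, ‖y j‖ ^ 2 := by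
  obtain ⟨C, hC, hCle⟩ := abs_dotProduct_mulVec_le Q
  let L : ((Fin k → ℝ) × (∀ j : {j // 0 < c j}, Fin (d j) → ℝ)) →L[ℝ] (Fin n → ℝ) :=
    LinearMap.toContinuousLinearMap e.toLinearMap
  have hL : ∀ z, ‖e z‖ ≤ ‖L‖ * ‖z‖ := fun z => L.le_opNorm z
  -- The first term bounds `Q` at `e (u, 0)`. The second is left by Young's inequality for the cross
  -- term, which uses up `δ / 2` of the available `-δ ∑ ‖y j‖²`. The form at `e (0, y)` is
  -- nonpositive and is dropped.
  refine ⟨C * ‖L‖ ^ 2 + (2 * C * ‖L‖ ^ 2) ^ 2 / (2 * δ), fun u hu y => ?_⟩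
  have h1 : e (u, y) = e (u, 0) + e (0, y) := by rw [← map_add]; simp
  have ha : ‖e (u, 0)‖ ≤ ‖L‖ := (hL _).trans
    (mul_le_of_le_one_right (norm_nonneg _) (by simpa [Prod.norm_def] using hu))
  have hb : ‖e (0, y)‖ ≤ ‖L‖ * ‖y‖ := (hL _).trans (by simp [Prod.norm_def])
  have hsum : ‖y‖ ^ 2 ≤ ∑ j, ‖y j‖ ^ 2 := by
    have h0 : 0 ≤ ∑ j, ‖y j‖ ^ 2 := by positivity
    rw [← Real.sqrt_le_sqrt_iff h0, Real.sqrt_sq (norm_nonneg _)]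
    refine (pi_norm_le_iff_of_nonneg (Real.sqrt_nonneg _)).2 fun j => Real.le_sqrt_of_sq_le ?_
    exact Finset.single_le_sum (f := fun j => ‖y j‖ ^ 2) (fun _ _ => by positivity)
      (Finset.mem_univ j)
  have h2 : ∑ j, ‖y j‖ ^ 2 ≤ ∑ j with 0 < c j, (B j *ᵥ e (u, y)) ⬝ᵥ (B j *ᵥ e (u, y)) := by
    rw [Finset.sum_subtype (p := fun j => 0 < c j) _ (by simp)]
    refine Finset.sum_le_sum fun j _ => ?_
    have h3 := he (u, y) j
    rw [mulVecPlus_apply] at h3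
    rw [h3]
    exact norm_sq_le_dotProduct _
  have hqa : e (u, 0) ⬝ᵥ Q *ᵥ e (u, 0) ≤ C * ‖L‖ ^ 2 := by
    refine (le_abs_self _).trans ((hCle _ _).trans ?_)
    rw [mul_assoc, ← sq]
    gcongr
  have hqab : e (u, 0) ⬝ᵥ Q *ᵥ e (0, y) ≤ C * ‖L‖ ^ 2 * ‖y‖ := by
    refine (le_abs_self _).trans ((hCle _ _).trans ?_)
    calc C * ‖e (u, 0)‖ * ‖e (0, y)‖ ≤ C * ‖L‖ * (‖L‖ * ‖y‖) := by gcongr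
      _ = _ := by ring
  have hyoung : 2 * (C * ‖L‖ ^ 2 * ‖y‖) ≤ (2 * C * ‖L‖ ^ 2) ^ 2 / (2 * δ) + δ / 2 * ‖y‖ ^ 2 := by
    set T := 2 * C * ‖L‖ ^ 2
    have : 0 ≤ (T - δ * ‖y‖) ^ 2 / (2 * δ) := by positivity
    have h4 : (T - δ * ‖y‖) ^ 2 / (2 * δ) = T ^ 2 / (2 * δ) + δ / 2 * ‖y‖ ^ 2 - T * ‖y‖ := by
      field_simp
      ring
    have h5 : 2 * (C * ‖L‖ ^ 2 * ‖y‖) = T * ‖y‖ := by ring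
    linarith
  rw [quadForm_perturb, h1, quadForm_add hQ, ← h1]
  have h3 := hneg y
  have h6 := mul_le_mul_of_nonneg_left h2 hδ.le
  have h7 := mul_le_mul_of_nonneg_left hsum (half_pos hδ).le
  nlinarith

/-- After perturbation, a nondegenerate datum is coercive. -/
lemma isCoercive_perturb (h : IsNondegenerate B c Q G) {δ : ℝ} (hδ : 0 < δ) :
    IsCoercive B c (perturb B c Q δ) G := by
  obtain ⟨k, e, he, hneg⟩ := exists_splitting h
  obtain ⟨E, hE0, hEt, hE⟩ := exists_prod_neg_le (c := c) h.posDef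
  obtain ⟨K, hK⟩ := exists_quadForm_perturb_le h.selfAdjoint hδ e he hneg
  let V : Measure ((Fin k → ℝ) × (∀ j : {j // 0 < c j}, Fin (d j) → ℝ)) := volume.prod (Measure.pi fun j => volume)
  let e' := e.toContinuousLinearEquiv
  have hV0 : V.IsAddHaarMeasure :=
    by
    have : (Measure.pi fun j : {j // 0 < c j} => (volume : Measure (Fin (d j) → ℝ))).IsAddHaarMeasure :=
      inferInstance
    exact Measure.prod.instIsAddHaarMeasure _ _
  have hV : (V.map e').IsAddHaarMeasure := e'.isAddHaarMeasure_map V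
  -- The Jacobian of the split coordinates; its value is irrelevant.
  set a := Measure.addHaarScalarFactor (V.map e') volume with ha
  have hVa : V.map e' = a • volume := Measure.isAddLeftInvariant_eq_smul _ _
  set b := volume (Metric.closedBall (0 : Fin k → ℝ) 1) with hb
  have hb0 : b ≠ 0 := (Metric.measure_closedBall_pos _ _ one_pos).ne'
  set κ := ENNReal.ofReal (Real.exp (-Real.pi * K)) with hκ
  have hκ0 : κ ≠ 0 := by simpa [hκ] using Real.exp_pos _
  have hx0 : b * (κ * E) ≠ 0 := mul_ne_zero hb0 (mul_ne_zero hκ0 hE0)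
  have hxt : b * (κ * E) ≠ ∞ := ENNReal.mul_ne_top measure_closedBall_lt_top.ne
    (ENNReal.mul_ne_top ENNReal.ofReal_ne_top hEt)
  refine ⟨Real.pi * (δ / 2), mul_pos Real.pi_pos (half_pos hδ), (b * (κ * E))⁻¹ * a, ?_,
    fun μ hμ => ?_⟩
  · exact ENNReal.mul_ne_top (ENNReal.inv_ne_top.2 hx0) ENNReal.coe_ne_top
  set f : ∀ j, (Fin (d j) → ℝ) → ℝ≥0∞ := fun j => gaussianConv (G j) (μ j) with hf
  have hfm : ∀ j, Measurable (f j) := fun j => measurable_gaussianConv _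
  set φ : ∀ j : {j // 0 < c j}, (Fin (d j) → ℝ) → ℝ≥0∞ := fun j y =>
    expWeight (Real.pi * (δ / 2)) y * f j y ^ c j with hφ
  have hφm : ∀ j, Measurable (φ j) := fun j =>
    (measurable_expWeight _).mul ((hfm j).pow_const _)
  have hnum : (a : ℝ≥0∞) * numerator B c (perturb B c Q δ) f =
      ∫⁻ z, gaussianKernel (perturb B c Q δ) (e z) * ∏ j, f j (B j *ᵥ e z) ^ c j ∂V := by
    have h1 : Measurable fun x : Fin n → ℝ =>
        gaussianKernel (perturb B c Q δ) x * ∏ j, f j (B j *ᵥ x) ^ c j := by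
      refine (continuous_gaussianKernel _).measurable.mul
        (Finset.measurable_prod _ fun j _ => ((hfm j).comp ?_).pow_const _)
      exact (Continuous.matrix_mulVec continuous_const continuous_id).measurable
    have h2 := lintegral_map (μ := V) h1 e'.continuous.measurable
    rw [hVa, lintegral_smul_measure] at h2
    exact h2
  -- Discard `u` outside the unit ball. Inside, `κ` and the weights bound the kernel from below and
  -- `E` bounds the negative powers, so the integrand dominates a tensor product in the variables
  -- `u` and `y j`, whose integral factorizes.
  have hpt : ∀ z : (Fin k → ℝ) × (∀ j : {j // 0 < c j}, Fin (d j) → ℝ),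
      (Metric.closedBall (0 : Fin k → ℝ) 1).indicator 1 z.1 * (κ * E * ∏ j, φ j (z.2 j)) ≤
      gaussianKernel (perturb B c Q δ) (e z) * ∏ j, f j (B j *ᵥ e z) ^ c j := by
    rintro ⟨u, y⟩
    by_cases hu : u ∈ Metric.closedBall (0 : Fin k → ℝ) 1
    swap
    · rw [Set.indicator_of_notMem hu, zero_mul]
      exact zero_le
    rw [Set.indicator_of_mem hu, Pi.one_apply, one_mul,
      ← Fintype.prod_subtype_mul_prod_subtype (fun j => 0 < c j)]
    have hB : ∀ j : {j // 0 < c j}, B j *ᵥ e (u, y) = y j := fun j => he (u, y) j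
    have h1 : ∏ j : {j // 0 < c j}, f j (B j *ᵥ e (u, y)) ^ c j =
        ∏ j : {j // 0 < c j}, f j (y j) ^ c j :=
      Finset.prod_congr rfl fun j _ => by rw [hB]
    have h2 : κ * ∏ j : {j // 0 < c j}, expWeight (Real.pi * (δ / 2)) (y j) ≤
        gaussianKernel (perturb B c Q δ) (e (u, y)) := by
      simp only [expWeight, gaussianKernel, hκ]
      rw [← ENNReal.ofReal_prod_of_nonneg fun j _ => (Real.exp_pos _).le,
        ← ENNReal.ofReal_mul (Real.exp_pos _).le, ← Real.exp_sum, ← Real.exp_add]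
      refine ENNReal.ofReal_le_ofReal (Real.exp_le_exp.2 ?_)
      have h3 := hK u (by simpa using hu) y
      rw [← Finset.mul_sum]
      nlinarith [Real.pi_pos]
    rw [h1]
    calc κ * E * ∏ j, φ j (y j)
        = (κ * ∏ j : {j // 0 < c j}, expWeight (Real.pi * (δ / 2)) (y j)) *
          ((∏ j : {j // 0 < c j}, f j (y j) ^ c j) * E) := by
          rw [hφ, Finset.prod_mul_distrib]
          ring
      _ ≤ _ := mul_le_mul' h2 (mul_le_mul' le_rfl (hE μ hμ fun j => B j *ᵥ e (u, y)))
  have hφq : Measurable fun y : ∀ j : {j // 0 < c j}, Fin (d j) → ℝ => ∏ j, φ j (y j) :=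
    Finset.measurable_prod _ fun j _ => (hφm j).comp (measurable_pi_apply j)
  have hφp := hφq.const_mul (κ * E)
  have hlow : b * (κ * E) * ∏ j : {j // 0 < c j}, ∫⁻ y, φ j y ≤
      a * numerator B c (perturb B c Q δ) f := by
    rw [hnum]
    refine le_trans (le_of_eq ?_) (lintegral_mono hpt)
    rw [lintegral_prod_mul (g := fun y : ∀ j : {j // 0 < c j}, Fin (d j) → ℝ => κ * E * ∏ j, φ j (y j))
      ((measurable_one.indicator Metric.isClosed_closedBall.measurableSet).aemeasurable)
      hφp.aemeasurable, lintegral_indicator_one Metric.isClosed_closedBall.measurableSet,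
      lintegral_const_mul _ hφq, lintegral_pi_prod_eq _ hφm]
    simp only [hb, mul_assoc]
  rw [mul_assoc, ← ENNReal.div_eq_inv_mul, ENNReal.le_div_iff_mul_le (Or.inl hx0) (Or.inl hxt),
    mul_comm]
  exact hlow

end Coercivity

/-! ### Existence of minimizers -/

section Minimizers

variable {n m : ℕ} {d : Fin m → ℕ} {B : ∀ j, Matrix (Fin (d j)) (Fin n) ℝ} {c : Fin m → ℝ}
  {Q : Matrix (Fin n) (Fin n) ℝ} {G : ∀ j, Matrix (Fin (d j)) (Fin (d j)) ℝ}

lemma prod_rpow_ne_zero {ι : Type*} (s : Finset ι) {a : ι → ℝ≥0∞} (c : ι → ℝ)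
    (h0 : ∀ i, a i ≠ 0) (ht : ∀ i, a i ≠ ∞) : ∏ i ∈ s, a i ^ c i ≠ 0 :=
  Finset.prod_ne_zero_iff.2 fun i _ => (ENNReal.rpow_pos (pos_iff_ne_zero.2 (h0 i)) (ht i)).ne'

lemma prod_rpow_ne_top {ι : Type*} (s : Finset ι) {a : ι → ℝ≥0∞} (c : ι → ℝ)
    (h0 : ∀ i, a i ≠ 0) (ht : ∀ i, a i ≠ ∞) : ∏ i ∈ s, a i ^ c i ≠ ∞ :=
  ENNReal.prod_ne_top fun i _ => ENNReal.rpow_ne_top_of_ne_zero (h0 i) (ht i)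

lemma prod_mul_rpow {ι : Type*} (s : Finset ι) {a b : ι → ℝ≥0∞} (c : ι → ℝ)
    (ha : ∀ i, a i ≠ ∞) (hb : ∀ i, b i ≠ ∞) :
    ∏ i ∈ s, (a i * b i) ^ c i = (∏ i ∈ s, a i ^ c i) * ∏ i ∈ s, b i ^ c i := by
  rw [← Finset.prod_mul_distrib]
  exact Finset.prod_congr rfl fun i _ => ENNReal.mul_rpow_of_ne_top (ha i) (hb i) _

lemma numerator_smul {f : ∀ j, (Fin (d j) → ℝ) → ℝ≥0∞} (hf : ∀ j x, f j x ≠ ∞)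
    {r : Fin m → ℝ≥0∞} (h0 : ∀ j, r j ≠ 0) (ht : ∀ j, r j ≠ ∞) :
    numerator B c Q (fun j x => r j * f j x) = (∏ j, r j ^ c j) * numerator B c Q f := by
  rw [numerator, numerator, ← lintegral_const_mul' _ _ (prod_rpow_ne_top _ _ h0 ht)]
  refine lintegral_congr fun x => ?_
  rw [prod_mul_rpow _ _ ht fun j => hf j _]
  ring

/-- The functional is invariant under scaling of the inputs. -/
lemma BL_smul {f : ∀ j, (Fin (d j) → ℝ) → ℝ≥0∞} (hf : ∀ j x, f j x ≠ ∞)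
    (hfi : ∀ j, ∫⁻ x, f j x ≠ ∞) {r : Fin m → ℝ≥0∞} (h0 : ∀ j, r j ≠ 0) (ht : ∀ j, r j ≠ ∞) :
    BL B c Q (fun j x => r j * f j x) = BL B c Q f := by
  change numerator B c Q (fun j x => r j * f j x) / _ = numerator B c Q f / _
  rw [numerator_smul hf h0 ht]
  have hd : ∀ j, ∫⁻ x, r j * f j x = r j * ∫⁻ x, f j x := fun j =>
    lintegral_const_mul' (r j) (f j) (ht j)
  simp only [hd]
  rw [prod_mul_rpow _ _ ht hfi]
  exact ENNReal.mul_div_mul_left _ _ (prod_rpow_ne_zero _ _ h0 ht) (prod_rpow_ne_top _ _ h0 ht)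

lemma inverseConst_le {f : ∀ j, (Fin (d j) → ℝ) → ℝ≥0∞} (hf : ∀ j, f j ∈ typeG (G j)) :
    inverseConst B c Q G ≤ BL B c Q f :=
  iInf₂_le f hf

lemma ne_top_of_mem_typeG {k : ℕ} {A : Matrix (Fin k) (Fin k) ℝ} (hA : A.PosDef)
    {f : (Fin k → ℝ) → ℝ≥0∞} (hf : f ∈ typeG A) (x : Fin k → ℝ) : f x ≠ ∞ := by
  obtain ⟨μ, hμ, -, rfl⟩ := hf
  exact gaussianConv_ne_top hA μ x

lemma ne_zero_of_mem_typeG {k : ℕ} {A : Matrix (Fin k) (Fin k) ℝ} (hA : A.PosDef)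
    {f : (Fin k → ℝ) → ℝ≥0∞} (hf : f ∈ typeG A) (x : Fin k → ℝ) : f x ≠ 0 := by
  obtain ⟨μ, hμ, h0, rfl⟩ := hf
  exact gaussianConv_ne_zero hA h0 x

lemma lintegral_ne_top_of_mem_typeG {k : ℕ} {A : Matrix (Fin k) (Fin k) ℝ} (hA : A.PosDef)
    {f : (Fin k → ℝ) → ℝ≥0∞} (hf : f ∈ typeG A) : ∫⁻ x, f x ≠ ∞ := by
  obtain ⟨μ, hμ, -, rfl⟩ := hf
  exact lintegral_gaussianConv_ne_top hA μ

lemma lintegral_ne_zero_of_mem_typeG {k : ℕ} {A : Matrix (Fin k) (Fin k) ℝ} (hA : A.PosDef)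
    {f : (Fin k → ℝ) → ℝ≥0∞} (hf : f ∈ typeG A) : ∫⁻ x, f x ≠ 0 := by
  obtain ⟨μ, hμ, h0, rfl⟩ := hf
  exact lintegral_gaussianConv_ne_zero hA μ h0

lemma continuous_of_mem_typeG {k : ℕ} {A : Matrix (Fin k) (Fin k) ℝ} (hA : A.PosDef)
    {f : (Fin k → ℝ) → ℝ≥0∞} (hf : f ∈ typeG A) : Continuous f := by
  obtain ⟨μ, hμ, h0, rfl⟩ := hf
  exact continuous_gaussianConv hA μ

lemma denominator_ne_zero (hG : ∀ j, (G j).PosDef) {f : ∀ j, (Fin (d j) → ℝ) → ℝ≥0∞}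
    (hf : ∀ j, f j ∈ typeG (G j)) : ∏ j, (∫⁻ y, f j y) ^ c j ≠ 0 :=
  prod_rpow_ne_zero _ _ (fun j => lintegral_ne_zero_of_mem_typeG (hG j) (hf j))
    fun j => lintegral_ne_top_of_mem_typeG (hG j) (hf j)

lemma denominator_ne_top (hG : ∀ j, (G j).PosDef) {f : ∀ j, (Fin (d j) → ℝ) → ℝ≥0∞}
    (hf : ∀ j, f j ∈ typeG (G j)) : ∏ j, (∫⁻ y, f j y) ^ c j ≠ ∞ :=
  prod_rpow_ne_top _ _ (fun j => lintegral_ne_zero_of_mem_typeG (hG j) (hf j))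
    fun j => lintegral_ne_top_of_mem_typeG (hG j) (hf j)

lemma le_BL_iff (hG : ∀ j, (G j).PosDef) {f : ∀ j, (Fin (d j) → ℝ) → ℝ≥0∞}
    (hf : ∀ j, f j ∈ typeG (G j)) {a : ℝ≥0∞} :
    a ≤ BL B c Q f ↔ a * ∏ j, (∫⁻ y, f j y) ^ c j ≤ numerator B c Q f :=
  ENNReal.le_div_iff_mul_le (Or.inl (denominator_ne_zero hG hf))
    (Or.inl (denominator_ne_top hG hf))

lemma BL_le_iff (hG : ∀ j, (G j).PosDef) {f : ∀ j, (Fin (d j) → ℝ) → ℝ≥0∞}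
    (hf : ∀ j, f j ∈ typeG (G j)) {a : ℝ≥0∞} :
    BL B c Q f ≤ a ↔ numerator B c Q f ≤ a * ∏ j, (∫⁻ y, f j y) ^ c j :=
  ENNReal.div_le_iff_le_mul (Or.inl (denominator_ne_zero hG hf))
    (Or.inl (denominator_ne_top hG hf))

lemma inverseConst_mul_le (hG : ∀ j, (G j).PosDef) {f : ∀ j, (Fin (d j) → ℝ) → ℝ≥0∞}
    (hf : ∀ j, f j ∈ typeG (G j)) :
    inverseConst B c Q G * ∏ j, (∫⁻ y, f j y) ^ c j ≤ numerator B c Q f :=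
  (le_BL_iff hG hf).1 (inverseConst_le hf)

/-- Every function of type `G` is a multiple of a gaussian convolution of a probability measure. -/
lemma exists_isProbabilityMeasure_of_mem_typeG {k : ℕ} {A : Matrix (Fin k) (Fin k) ℝ}
    {f : (Fin k → ℝ) → ℝ≥0∞} (hf : f ∈ typeG A) :
    ∃ μ : Measure (Fin k → ℝ), IsProbabilityMeasure μ ∧ ∃ r : ℝ≥0∞, r ≠ 0 ∧ r ≠ ∞ ∧
      f = fun x => r * gaussianConv A μ x := by
  obtain ⟨μ, hμ, h0, rfl⟩ := hf
  have h1 : μ Set.univ ≠ 0 := by simpa using h0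
  refine ⟨(μ Set.univ)⁻¹ • μ, ⟨?_⟩, μ Set.univ, h1, measure_ne_top _ _, ?_⟩
  · rw [Measure.smul_apply, smul_eq_mul, ENNReal.inv_mul_cancel h1 (measure_ne_top _ _)]
  · funext x
    rw [gaussianConv_smul, ← mul_assoc, ENNReal.mul_inv_cancel h1 (measure_ne_top _ _), one_mul]

lemma gaussianConv_mem_typeG_of_isProbabilityMeasure {k : ℕ} (A : Matrix (Fin k) (Fin k) ℝ)
    (μ : Measure (Fin k → ℝ)) [IsProbabilityMeasure μ] : gaussianConv A μ ∈ typeG A :=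
  gaussianConv_mem_typeG μ (IsProbabilityMeasure.ne_zero μ)

lemma exists_isProbabilityMeasure_BL_eq (hG : ∀ j, (G j).PosDef)
    {f : ∀ j, (Fin (d j) → ℝ) → ℝ≥0∞} (hf : ∀ j, f j ∈ typeG (G j)) :
    ∃ μ : ∀ j, Measure (Fin (d j) → ℝ), (∀ j, IsProbabilityMeasure (μ j)) ∧
      (∃ r : Fin m → ℝ≥0∞, (∀ j, r j ≠ 0) ∧ (∀ j, r j ≠ ∞) ∧
        ∀ j, f j = fun x => r j * gaussianConv (G j) (μ j) x) ∧
      BL B c Q f = BL B c Q fun j => gaussianConv (G j) (μ j) := by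
  choose μ hμ r h0 ht hr using fun j => exists_isProbabilityMeasure_of_mem_typeG (hf j)
  refine ⟨μ, hμ, ⟨r, h0, ht, hr⟩, ?_⟩
  obtain rfl : f = fun j x => r j * gaussianConv (G j) (μ j) x := funext hr
  exact BL_smul (fun j x => gaussianConv_ne_top (hG j) _ x)
    (fun j => lintegral_gaussianConv_ne_top (hG j) _) h0 ht

/-- Under coercivity, a bound on the numerator bounds every weighted integral. -/
lemma IsCoercive.exists_weighted_le (hG : ∀ j, (G j).PosDef) (h : IsCoercive B c Q G) :
    ∃ η : ℝ, 0 < η ∧ ∀ M : ℝ≥0∞, M ≠ ∞ → ∃ M' : ℝ≥0∞, M' ≠ ∞ ∧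
      ∀ μ : ∀ j, Measure (Fin (d j) → ℝ), (∀ j, IsProbabilityMeasure (μ j)) →
        numerator B c Q (fun j => gaussianConv (G j) (μ j)) ≤ M →
        ∀ j : {j // 0 < c j}, ∫⁻ y, expWeight η y * gaussianConv (G j) (μ j) y ^ c j ≤ M' := by
  classical
  obtain ⟨η, hη, C, hC, hle⟩ := h
  refine ⟨η, hη, fun M hM => ?_⟩
  -- Coercivity bounds only the product of the weighted integrals; the uniform lower bounds `κ i` on
  -- the other factors isolate the one with index `j`. Summing over `j` then gives one bound for all
  -- indices.
  choose κ h0 ht hκ using fun j : {j // 0 < c j} =>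
    exists_le_lintegral_expWeight_mul_rpow (hG j) (c j) hη
  have hP0 : ∀ j, ∏ i ∈ Finset.univ.erase j, κ i ≠ 0 := fun j =>
    Finset.prod_ne_zero_iff.2 fun i _ => h0 i
  have hPt : ∀ j, ∏ i ∈ Finset.univ.erase j, κ i ≠ ∞ := fun j =>
    ENNReal.prod_ne_top fun i _ => ht i
  refine ⟨∑ j, C * M / ∏ i ∈ Finset.univ.erase j, κ i, ?_, fun μ hμ hnum j => ?_⟩
  · exact ENNReal.sum_ne_top.2 fun j _ => ENNReal.div_ne_top (ENNReal.mul_ne_top hC hM) (hP0 j)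
  · refine le_trans ?_ (Finset.single_le_sum (f := fun j => C * M / ∏ i ∈ Finset.univ.erase j, κ i)
      (fun _ _ => zero_le) (Finset.mem_univ j))
    rw [ENNReal.le_div_iff_mul_le (Or.inl (hP0 j)) (Or.inl (hPt j))]
    refine le_trans ?_ ((hle μ hμ).trans (mul_le_mul_right hnum C))
    rw [← Finset.mul_prod_erase _ _ (Finset.mem_univ j)]
    exact mul_le_mul_right (Finset.prod_le_prod' fun i _ => hκ i (μ i) (hμ i)) _

/-- Under coercivity the best constant is positive. -/
lemma IsCoercive.inverseConst_ne_zero (hG : ∀ j, (G j).PosDef) (h : IsCoercive B c Q G) :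
    inverseConst B c Q G ≠ 0 := by
  obtain ⟨η, hη, C, hC, hle⟩ := h
  choose κ h0 ht hκ using fun j : {j // 0 < c j} =>
    exists_le_lintegral_expWeight_mul_rpow (hG j) (c j) hη
  have hC1 : C + 1 ≠ 0 := by simp
  have hC2 : C + 1 ≠ ∞ := by simp [hC]
  set L := (∏ j, κ j) / (C + 1) / ∏ j, gaussianMass (G j) ^ c j with hL
  have hL0 : L ≠ 0 := ENNReal.div_ne_zero.2 ⟨ENNReal.div_ne_zero.2
    ⟨Finset.prod_ne_zero_iff.2 fun i _ => h0 i, hC2⟩,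
    prod_rpow_ne_top _ _ (fun j => gaussianMass_ne_zero (hG j))
      fun j => gaussianMass_ne_top (hG j)⟩
  refine ne_of_gt (lt_of_lt_of_le (pos_iff_ne_zero.2 hL0) (le_iInf₂ fun f hf => ?_))
  obtain ⟨μ, hμ, -, hBL⟩ := exists_isProbabilityMeasure_BL_eq (B := B) (c := c) (Q := Q) hG hf
  rw [hBL]
  change L ≤ numerator B c Q _ / _
  simp only [lintegral_gaussianConv_of_isProbabilityMeasure]
  refine ENNReal.div_le_div_right (ENNReal.div_le_of_le_mul' ?_) _
  refine (Finset.prod_le_prod' fun j _ => hκ j (μ j) (hμ j)).trans ((hle μ hμ).trans ?_)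
  gcongr
  exact le_self_add

/-- Multiplication on `[0, ∞]` is discontinuous at `(0, ∞)`. Limits that are nonzero exclude this
and may still be infinite, which is needed for negative powers of a vanishing limit. -/
lemma tendsto_finsetProd_of_ne_zero {ι α : Type*} {f : ι → α → ℝ≥0∞} {l : Filter α}
    {a : ι → ℝ≥0∞} (s : Finset ι) (h : ∀ i ∈ s, Tendsto (f i) l (𝓝 (a i)))
    (h0 : ∀ i ∈ s, a i ≠ 0) :
    Tendsto (fun b => ∏ i ∈ s, f i b) l (𝓝 (∏ i ∈ s, a i)) := by
  classical
  induction s using Finset.induction with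
  | empty => simp [tendsto_const_nhds]
  | insert i s hi ih =>
    simp only [Finset.prod_insert hi]
    exact ENNReal.Tendsto.mul (h i (Finset.mem_insert_self _ _))
      (Or.inl (h0 i (Finset.mem_insert_self _ _)))
      (ih (fun j hj => h j (Finset.mem_insert_of_mem hj))
        fun j hj => h0 j (Finset.mem_insert_of_mem hj))
      (Or.inl (Finset.prod_ne_zero_iff.2 fun j hj => h0 j (Finset.mem_insert_of_mem hj)))

lemma measurable_integrand {f : ∀ j, (Fin (d j) → ℝ) → ℝ≥0∞} (hf : ∀ j, Measurable (f j)) :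
    Measurable fun x : Fin n → ℝ => gaussianKernel Q x * ∏ j, f j (B j *ᵥ x) ^ c j := by
  refine (continuous_gaussianKernel _).measurable.mul
    (Finset.measurable_prod _ fun j _ => ((hf j).comp ?_).pow_const _)
  exact (Continuous.matrix_mulVec continuous_const continuous_id).measurable

/-- Lower semicontinuity of the numerator under pointwise convergence. -/
lemma numerator_le_liminf {f : ℕ → ∀ j, (Fin (d j) → ℝ) → ℝ≥0∞} (hf : ∀ k j, Measurable (f k j))
    {g : ∀ j, (Fin (d j) → ℝ) → ℝ≥0∞} (hg : ∀ j x, g j x ^ c j ≠ 0)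
    (h : ∀ j x, Tendsto (fun k => f k j x) atTop (𝓝 (g j x))) :
    numerator B c Q g ≤ liminf (fun k => numerator B c Q (f k)) atTop := by
  refine le_trans (le_of_eq (lintegral_congr fun x => ?_))
    (lintegral_liminf_le fun k => measurable_integrand (hf k))
  refine (Tendsto.liminf_eq ?_).symm
  refine ENNReal.Tendsto.const_mul (tendsto_finsetProd_of_ne_zero _ (fun j _ => ?_)
    fun j _ => hg j _) (Or.inr (gaussianKernel_ne_top _ _))
  exact (ENNReal.continuous_rpow_const.tendsto _).comp (h j _)

/-- Minimizing sequences converge, along a subsequence, to minimizers. -/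
lemma IsCoercive.exists_subseq_tendsto (hG : ∀ j, (G j).PosDef) (hc : ∀ j, c j ≠ 0)
    (hco : IsCoercive B c Q G) (hI : inverseConst B c Q G ≠ ∞)
    (μ : ℕ → ∀ j, Measure (Fin (d j) → ℝ)) (hμ : ∀ k j, IsProbabilityMeasure (μ k j))
    (hlim : Tendsto (fun k => BL B c Q fun j => gaussianConv (G j) (μ k j)) atTop
      (𝓝 (inverseConst B c Q G))) :
    ∃ φ : ℕ → ℕ, StrictMono φ ∧ ∃ ν : ∀ j, Measure (Fin (d j) → ℝ),
      (∀ j, IsProbabilityMeasure (ν j)) ∧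
      (∀ j x, Tendsto (fun k => gaussianConv (G j) (μ (φ k) j) x) atTop
        (𝓝 (gaussianConv (G j) (ν j) x))) ∧
      BL B c Q (fun j => gaussianConv (G j) (ν j)) = inverseConst B c Q G := by
  obtain ⟨φ, hφ, ν, hν⟩ := exists_subseq_tendsto_gaussianConv hG μ hμ
  have hν1 := fun j => (hν j).1
  have hνl := fun j => (hν j).2
  have hνf : ∀ j, IsFiniteMeasure (ν j) := fun j => ⟨(hν1 j).trans_lt ENNReal.one_lt_top⟩
  set I := inverseConst B c Q G with hIdef
  have hI0 : I ≠ 0 := hco.inverseConst_ne_zero hG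
  set D := ∏ j, gaussianMass (G j) ^ c j with hD
  have hD0 : D ≠ 0 := prod_rpow_ne_zero _ _ (fun j => gaussianMass_ne_zero (hG j))
      fun j => gaussianMass_ne_top (hG j)
  have hDt : D ≠ ∞ := prod_rpow_ne_top _ _ (fun j => gaussianMass_ne_zero (hG j))
      fun j => gaussianMass_ne_top (hG j)
  have hIDt : I * D ≠ ∞ := ENNReal.mul_ne_top hI hDt
  set N : ℕ → ℝ≥0∞ := fun k => numerator B c Q fun j => gaussianConv (G j) (μ (φ k) j) with hN
  have hNlim : Tendsto N atTop (𝓝 (I * D)) := by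
    have h1 := ENNReal.Tendsto.mul_const (hlim.comp hφ.tendsto_atTop) (Or.inr hDt) (b := D)
    refine h1.congr fun k => ?_
    have h2 : (BL B c Q fun j => gaussianConv (G j) (μ (φ k) j)) = N k / D := by
      have := fun j => hμ (φ k) j
      change numerator B c Q _ / _ = _
      simp only [lintegral_gaussianConv_of_isProbabilityMeasure, hN, hD]
    rw [Function.comp_apply, h2, ENNReal.div_mul_cancel hD0 hDt]
  -- positive exponents keep their mass
  have hpos : ∀ j, 0 < c j → ν j Set.univ = 1 := by
    intro j hj
    obtain ⟨η, hη, hw⟩ := hco.exists_weighted_le hG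
    obtain ⟨M', hM', hw⟩ := hw (I * D + 1) (by simp [hIDt])
    obtain ⟨k0, hk0⟩ := eventually_atTop.1 (hNlim.eventually_le_const
      (ENNReal.lt_add_right hIDt one_ne_zero))
    have h1 := gaussianMass_le_lintegral_of_tendsto (hG j) (c j) hη hM'
      (fun k => μ (φ (k + k0)) j) (fun k => hμ _ _)
      (fun k => hw _ (hμ (φ (k + k0))) (hk0 _ (Nat.le_add_left _ _)) ⟨j, hj⟩)
      (fun x => (hνl j x).comp (tendsto_add_atTop_nat k0))
    rw [lintegral_gaussianConv] at h1
    refine le_antisymm (hν1 j) ?_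
    refine (ENNReal.mul_le_mul_iff_right (gaussianMass_ne_zero (hG j))
      (gaussianMass_ne_top (hG j))).1 ?_
    rwa [mul_one]
  -- Positive exponents have kept their mass, so these powers cannot vanish. A negative exponent may
  -- still produce `∞` at this stage.
  have hrpow : ∀ j x, gaussianConv (G j) (ν j) x ^ c j ≠ 0 := by
    intro j x h
    rcases ENNReal.rpow_eq_zero_iff.1 h with ⟨h1, h2⟩ | ⟨h1, -⟩
    · refine gaussianConv_ne_zero (hG j) (fun h3 => ?_) x h1
      have := hpos j h2
      simp [h3] at this
    · exact gaussianConv_ne_top (hG j) _ x h1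
  have hfatou : numerator B c Q (fun j => gaussianConv (G j) (ν j)) ≤ I * D := by
    rw [← hNlim.liminf_eq]
    have hmeas : ∀ k j, Measurable (gaussianConv (G j) (μ (φ k) j)) := fun k j =>
      have := hμ (φ k) j
      measurable_gaussianConv _
    exact numerator_le_liminf (f := fun k j => gaussianConv (G j) (μ (φ k) j))
      (g := fun j => gaussianConv (G j) (ν j)) hmeas hrpow hνl
  -- If all the mass at a negative exponent escaped, the limiting integrand would be `∞` everywhere,
  -- against the finite bound from Fatou.
  have hne : ∀ j, ν j ≠ 0 := by
    intro j hj
    have hneg : c j < 0 := by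
      refine lt_of_le_of_ne (not_lt.1 fun h => ?_) (hc j)
      have := hpos j h
      simp [hj] at this
    refine hIDt (top_le_iff.1 (le_trans (le_of_eq ?_) hfatou))
    have h1 : ∀ x : Fin n → ℝ, gaussianKernel Q x *
        ∏ i, gaussianConv (G i) (ν i) (B i *ᵥ x) ^ c i = ∞ := by
      intro x
      rw [← Finset.mul_prod_erase _ _ (Finset.mem_univ j)]
      have h2 : gaussianConv (G j) (ν j) (B j *ᵥ x) ^ c j = ∞ := by
        simp [hj, gaussianConv, hneg]
      rw [h2, ENNReal.top_mul (Finset.prod_ne_zero_iff.2 fun i _ => hrpow i _),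
        ENNReal.mul_top (gaussianKernel_ne_zero _ _)]
    rw [numerator]
    simp only [h1, lintegral_const]
    rw [ENNReal.top_mul]
    simpa using NeZero.ne (volume : Measure (Fin n → ℝ))
  have hmem : ∀ j, gaussianConv (G j) (ν j) ∈ typeG (G j) := fun j =>
    gaussianConv_mem_typeG _ (hne j)
  -- The limit is a competitor: `I` times its denominator is at most its numerator, hence at most `I
  -- * D`. Cancelling `I` (positive by coercivity) bounds the product by `1`; each factor is at
  -- least `1`, so all masses equal `1`.
  have hθ : ∏ j, ν j Set.univ ^ c j ≤ 1 := by
    have h1 := (inverseConst_mul_le (B := B) (c := c) (Q := Q) hG hmem).trans hfatou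
    rw [ENNReal.mul_le_mul_iff_right hI0 hI] at h1
    simp only [lintegral_gaussianConv] at h1
    rw [prod_mul_rpow _ _ (fun j => gaussianMass_ne_top (hG j)) fun j => measure_ne_top _ _] at h1
    refine (ENNReal.mul_le_mul_iff_right hD0 hDt).1 ?_
    rwa [mul_one]
  have hθ1 : ∀ j, 1 ≤ ν j Set.univ ^ c j := by
    intro j
    rcases lt_or_gt_of_ne (hc j) with h | h
    · have := rpow_le_rpow_of_nonpos (hν1 j) h.le
      rwa [ENNReal.one_rpow] at this
    · rw [hpos j h, ENNReal.one_rpow]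
  have hprob : ∀ j, IsProbabilityMeasure (ν j) := by
    refine fun j => ⟨?_⟩
    have h1 : ν j Set.univ ^ c j ≤ 1 :=
      (Finset.single_le_prod' (f := fun j => ν j Set.univ ^ c j) (fun i _ => hθ1 i)
        (Finset.mem_univ j)).trans hθ
    have h2 := le_antisymm h1 (hθ1 j)
    have h3 := congrArg (fun t => t ^ (c j)⁻¹) h2
    simpa [← ENNReal.rpow_mul, hc j] using h3
  refine ⟨φ, hφ, ν, hprob, hνl, le_antisymm ?_ (inverseConst_le hmem)⟩
  rw [BL_le_iff hG hmem]
  simpa only [lintegral_gaussianConv_of_isProbabilityMeasure] using hfatou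

/-- Scaling invariance normalizes a minimizing sequence to probability measures, to which the
compactness statement applies. -/
lemma IsCoercive.exists_minimizer (hG : ∀ j, (G j).PosDef) (hc : ∀ j, c j ≠ 0)
    (hco : IsCoercive B c Q G) (hI : inverseConst B c Q G ≠ ∞) :
    ∃ f : ∀ j, (Fin (d j) → ℝ) → ℝ≥0∞, (∀ j, f j ∈ typeG (G j)) ∧
      BL B c Q f = inverseConst B c Q G := by
  have h1 : ∀ k : ℕ, ∃ μ : ∀ j, Measure (Fin (d j) → ℝ), (∀ j, IsProbabilityMeasure (μ j)) ∧
      BL B c Q (fun j => gaussianConv (G j) (μ j)) < inverseConst B c Q G + ((k : ℝ≥0∞) + 1)⁻¹ := by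
    intro k
    have h2 : inverseConst B c Q G < inverseConst B c Q G + ((k : ℝ≥0∞) + 1)⁻¹ :=
      ENNReal.lt_add_right hI (by simp)
    obtain ⟨f, hf, h3⟩ := by simpa only [inverseConst, iInf_lt_iff] using h2
    obtain ⟨μ, hμ, -, hBL⟩ := exists_isProbabilityMeasure_BL_eq (B := B) (c := c) (Q := Q) hG hf
    exact ⟨μ, hμ, hBL ▸ h3⟩
  choose μ hμ hlt using h1
  have hlim : Tendsto (fun k => BL B c Q fun j => gaussianConv (G j) (μ k j)) atTop
      (𝓝 (inverseConst B c Q G)) := by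
    have h2 : Tendsto (fun k : ℕ => inverseConst B c Q G + ((k : ℝ≥0∞) + 1)⁻¹) atTop
        (𝓝 (inverseConst B c Q G + 0)) := by
      refine Tendsto.const_add _ ?_
      have := (tendsto_add_atTop_iff_nat 1).2 ENNReal.tendsto_inv_nat_nhds_zero
      simpa using this
    rw [add_zero] at h2
    exact tendsto_of_tendsto_of_tendsto_of_le_of_le tendsto_const_nhds h2
      (fun k => inverseConst_le fun j => have := hμ k j
        gaussianConv_mem_typeG_of_isProbabilityMeasure _ _) fun k => (hlt k).le
  obtain ⟨φ, -, ν, hν, -, h⟩ := hco.exists_subseq_tendsto hG hc hI μ hμ hlim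
  exact ⟨_, fun j => gaussianConv_mem_typeG_of_isProbabilityMeasure _ _, h⟩

end Minimizers

/-! ### The rotation by 45 degrees -/

section Rotation

/-- The scalar `1 / √2`. -/
noncomputable def invSqrtTwo : ℝ := (Real.sqrt 2)⁻¹

lemma invSqrtTwo_mul_self : invSqrtTwo * invSqrtTwo = 2⁻¹ := by
  rw [invSqrtTwo, ← mul_inv, Real.mul_self_sqrt (by norm_num)]

/-- The rotation `(x, y) ↦ ((x + y) / √2, (x - y) / √2)`. -/
noncomputable def rotation {k : ℕ} (z : (Fin k → ℝ) × (Fin k → ℝ)) : (Fin k → ℝ) × (Fin k → ℝ) :=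
  (invSqrtTwo • (z.1 + z.2), invSqrtTwo • (z.1 - z.2))

lemma rotation_rotation {k : ℕ} (z : (Fin k → ℝ) × (Fin k → ℝ)) : rotation (rotation z) = z := by
  have h := invSqrtTwo_mul_self
  refine Prod.ext ?_ ?_
  · simp only [rotation]
    rw [← smul_add, smul_smul, h, add_add_sub_cancel, ← two_smul ℝ, smul_smul]
    norm_num
  · simp only [rotation]
    rw [← smul_sub, smul_smul, h, add_sub_sub_cancel, ← two_smul ℝ, smul_smul]
    norm_num

lemma continuous_rotation {k : ℕ} : Continuous (rotation : (Fin k → ℝ) × (Fin k → ℝ) → _) := by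
  unfold rotation
  fun_prop

/-- The rotation as a continuous linear equivalence. -/
noncomputable def rotationEquiv (k : ℕ) :
    ((Fin k → ℝ) × (Fin k → ℝ)) ≃L[ℝ] (Fin k → ℝ) × (Fin k → ℝ) where
  toFun := rotation
  invFun := rotation
  left_inv := rotation_rotation
  right_inv := rotation_rotation
  map_add' x y := by
    refine Prod.ext ?_ ?_ <;> simp only [rotation, Prod.fst_add, Prod.snd_add] <;> module
  map_smul' t x := by
    refine Prod.ext ?_ ?_ <;>
    simp only [rotation, Prod.smul_fst, Prod.smul_snd, RingHom.id_apply] <;> module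
  continuous_toFun := continuous_rotation
  continuous_invFun := continuous_rotation

/-- A linear automorphism multiplies Haar measure by a scalar `a ≥ 0`; the rotation is an
involution, so `a ^ 2 = 1`. -/
lemma map_rotation (k : ℕ) :
    ((volume : Measure (Fin k → ℝ)).prod (volume : Measure (Fin k → ℝ))).map rotation =
      (volume : Measure (Fin k → ℝ)).prod (volume : Measure (Fin k → ℝ)) := by
  set V := (volume : Measure (Fin k → ℝ)).prod (volume : Measure (Fin k → ℝ)) with hV
  have hV0 : V.IsAddHaarMeasure := Measure.prod.instIsAddHaarMeasure _ _
  have h1 : (V.map (rotationEquiv k)).IsAddHaarMeasure := (rotationEquiv k).isAddHaarMeasure_map V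
  have h2 : V.map rotation = Measure.addHaarScalarFactor (V.map (rotationEquiv k)) V • V :=
    Measure.isAddLeftInvariant_eq_smul (V.map (rotationEquiv k)) V
  set a := Measure.addHaarScalarFactor (V.map (rotationEquiv k)) V
  have h3 : (V.map rotation).map rotation = V := by
    rw [Measure.map_map continuous_rotation.measurable continuous_rotation.measurable]
    have : (rotation ∘ rotation : (Fin k → ℝ) × (Fin k → ℝ) → _) = id :=
      funext rotation_rotation
    rw [this, Measure.map_id]
  have h4 : a • a • V = V := by
    nth_rewrite 2 [← h3]
    rw [h2, Measure.map_smul, h2]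
  have h5 := congrArg (fun μ : Measure _ => μ (Metric.closedBall 0 1)) h4
  have hp : V (Metric.closedBall 0 1) ≠ 0 := (Metric.measure_closedBall_pos _ _ one_pos).ne'
  have ht : V (Metric.closedBall 0 1) ≠ ∞ := measure_closedBall_lt_top.ne
  simp only [Measure.smul_apply, ENNReal.smul_def, smul_eq_mul, ← mul_assoc] at h5
  nth_rewrite 2 [← one_mul (V _)] at h5
  rw [ENNReal.mul_left_inj hp ht, ← ENNReal.coe_mul, ENNReal.coe_eq_one] at h5
  have h6 : a = 1 := by
    have : a ^ 2 = 1 := by rw [sq, h5]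
    exact (pow_eq_one_iff_of_nonneg zero_le two_ne_zero).1 this
  rw [h2, h6, one_smul]

lemma quadForm_rotation {k : ℕ} {A : Matrix (Fin k) (Fin k) ℝ} (hA : A.IsHermitian)
    (z : (Fin k → ℝ) × (Fin k → ℝ)) :
    (rotation z).1 ⬝ᵥ A *ᵥ (rotation z).1 + (rotation z).2 ⬝ᵥ A *ᵥ (rotation z).2 =
      z.1 ⬝ᵥ A *ᵥ z.1 + z.2 ⬝ᵥ A *ᵥ z.2 := by
  simp only [rotation, quadForm_smul, quadForm_add hA, quadForm_sub hA, sq, invSqrtTwo_mul_self]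
  ring

lemma gaussianKernel_rotation {k : ℕ} {A : Matrix (Fin k) (Fin k) ℝ} (hA : A.IsHermitian)
    (z : (Fin k → ℝ) × (Fin k → ℝ)) :
    gaussianKernel A (rotation z).1 * gaussianKernel A (rotation z).2 =
      gaussianKernel A z.1 * gaussianKernel A z.2 := by
  simp only [gaussianKernel]
  rw [← ENNReal.ofReal_mul (Real.exp_pos _).le, ← ENNReal.ofReal_mul (Real.exp_pos _).le,
    ← Real.exp_add, ← Real.exp_add, ← mul_add, ← mul_add, quadForm_rotation hA]

lemma gaussian_eq_mul_kernel {k : ℕ} (A : Matrix (Fin k) (Fin k) ℝ) (x : Fin k → ℝ) :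
    ENNReal.ofReal (gaussian A x) = ENNReal.ofReal (Real.sqrt A.det) * gaussianKernel A x :=
  ENNReal.ofReal_mul (Real.sqrt_nonneg _)

lemma gaussian_rotation {k : ℕ} {A : Matrix (Fin k) (Fin k) ℝ} (hA : A.IsHermitian)
    (z : (Fin k → ℝ) × (Fin k → ℝ)) :
    ENNReal.ofReal (gaussian A (rotation z).1) * ENNReal.ofReal (gaussian A (rotation z).2) =
      ENNReal.ofReal (gaussian A z.1) * ENNReal.ofReal (gaussian A z.2) := by
  simp only [gaussian_eq_mul_kernel]
  rw [mul_mul_mul_comm, gaussianKernel_rotation hA, mul_mul_mul_comm]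

lemma rotation_sub {k : ℕ} (x y : (Fin k → ℝ) × (Fin k → ℝ)) :
    rotation (x - y) = rotation x - rotation y :=
  map_sub (rotationEquiv k) x y

end Rotation

/-! ### Rotated tensor squares stay of type `G` -/

section Doubling

variable {k : ℕ} {G : Matrix (Fin k) (Fin k) ℝ}

/-- The rotated tensor square of a function. -/
noncomputable def doubling (f : (Fin k → ℝ) → ℝ≥0∞) (z w : Fin k → ℝ) : ℝ≥0∞ :=
  f (rotation (z, w)).1 * f (rotation (z, w)).2

/-- The marginal of the rotated tensor square. -/
noncomputable def doublingMarginal (f : (Fin k → ℝ) → ℝ≥0∞) (z : Fin k → ℝ) : ℝ≥0∞ :=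
  ∫⁻ w, doubling f z w

/-- The measure giving `doubling (gaussianConv G μ) z` as a gaussian convolution. -/
noncomputable def doublingMeasure (G : Matrix (Fin k) (Fin k) ℝ) (μ : Measure (Fin k → ℝ))
    (z : Fin k → ℝ) : Measure (Fin k → ℝ) :=
  ((μ.prod μ).withDensity fun p => ENNReal.ofReal (gaussian G (z - (rotation p).1))).map
    fun p => (rotation p).2

lemma measurable_rotation_fst : Measurable fun p : (Fin k → ℝ) × (Fin k → ℝ) => (rotation p).1 :=
  (continuous_fst.comp continuous_rotation).measurable

lemma measurable_rotation_snd : Measurable fun p : (Fin k → ℝ) × (Fin k → ℝ) => (rotation p).2 :=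
  (continuous_snd.comp continuous_rotation).measurable

lemma measurable_gaussian_rotation (G : Matrix (Fin k) (Fin k) ℝ) (z : Fin k → ℝ) :
    Measurable fun p => ENNReal.ofReal (gaussian G (z - (rotation p).1)) :=
  (measurable_gaussian_const_sub G z).comp measurable_rotation_fst

/-- The tensor square of `g_G` is invariant under the rotation, so rotating `f ⊗ f` amounts to
rotating `μ ⊗ μ`. Freezing the first variable at `z` turns its gaussian factor into a density and
leaves a convolution in the second. -/
lemma doubling_gaussianConv (hG : G.PosDef) (μ : Measure (Fin k → ℝ)) [IsFiniteMeasure μ]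
    (z : Fin k → ℝ) :
    doubling (gaussianConv G μ) z = gaussianConv G (doublingMeasure G μ z) := by
  funext w
  rw [doubling, gaussianConv, gaussianConv, gaussianConv, doublingMeasure,
    lintegral_map (measurable_gaussian_const_sub G w) measurable_rotation_snd,
    lintegral_withDensity_eq_lintegral_mul _ (measurable_gaussian_rotation G z)
      (g := fun p => ENNReal.ofReal (gaussian G (w - (rotation p).2)))
      ((measurable_gaussian_const_sub G w).comp measurable_rotation_snd),
    ← lintegral_prod_mul (measurable_gaussian_const_sub G _).aemeasurable
      (measurable_gaussian_const_sub G _).aemeasurable]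
  refine lintegral_congr fun p => ?_
  have h := gaussian_rotation hG.1 ((z, w) - rotation p)
  rw [rotation_sub, rotation_rotation] at h
  exact h

lemma isFiniteMeasure_doublingMeasure (hG : G.PosDef) (μ : Measure (Fin k → ℝ))
    [IsFiniteMeasure μ] (z : Fin k → ℝ) : IsFiniteMeasure (doublingMeasure G μ z) := by
  have : IsFiniteMeasure ((μ.prod μ).withDensity
      fun p => ENNReal.ofReal (gaussian G (z - (rotation p).1))) := by
    refine isFiniteMeasure_withDensity (ne_of_lt (lt_of_le_of_lt (lintegral_mono fun p =>
      ENNReal.ofReal_le_ofReal (gaussian_le hG _)) ?_))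
    rw [lintegral_const]
    exact ENNReal.mul_lt_top ENNReal.ofReal_lt_top (measure_lt_top _ _)
  exact Measure.isFiniteMeasure_map _ _

lemma doublingMeasure_univ (μ : Measure (Fin k → ℝ)) [IsFiniteMeasure μ] (z : Fin k → ℝ) :
    doublingMeasure G μ z Set.univ =
      gaussianConv G ((μ.prod μ).map fun p => (rotation p).1) z := by
  rw [doublingMeasure, Measure.map_apply measurable_rotation_snd MeasurableSet.univ,
    Set.preimage_univ, withDensity_apply _ MeasurableSet.univ, Measure.restrict_univ, gaussianConv,
    lintegral_map (measurable_gaussian_const_sub G z) measurable_rotation_fst]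

lemma map_prod_ne_zero {μ : Measure (Fin k → ℝ)} [IsFiniteMeasure μ] (hμ : μ ≠ 0) :
    (μ.prod μ).map (fun p => (rotation p).1) ≠ 0 := by
  rw [Ne, Measure.map_eq_zero_iff measurable_rotation_fst.aemeasurable,
    ← Measure.measure_univ_eq_zero, Measure.prod_apply MeasurableSet.univ]
  simpa using hμ

lemma doublingMeasure_ne_zero (hG : G.PosDef) {μ : Measure (Fin k → ℝ)} [IsFiniteMeasure μ]
    (hμ : μ ≠ 0) (z : Fin k → ℝ) : doublingMeasure G μ z ≠ 0 := by
  rw [← Measure.measure_univ_ne_zero, doublingMeasure_univ]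
  exact gaussianConv_ne_zero hG (map_prod_ne_zero hμ) z

/-- Integrating a slice gives `gaussianMass G` times the mass of `doublingMeasure G μ z`, and that
mass is itself a gaussian convolution as a function of `z`. -/
lemma doublingMarginal_gaussianConv (hG : G.PosDef) (μ : Measure (Fin k → ℝ)) [IsFiniteMeasure μ] :
    doublingMarginal (gaussianConv G μ) =
      gaussianConv G (gaussianMass G • (μ.prod μ).map fun p => (rotation p).1) := by
  funext z
  have := isFiniteMeasure_doublingMeasure hG μ z
  rw [doublingMarginal, doubling_gaussianConv hG, lintegral_gaussianConv, doublingMeasure_univ,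
    gaussianConv_smul]

lemma doubling_mem_typeG (hG : G.PosDef) {f : (Fin k → ℝ) → ℝ≥0∞} (hf : f ∈ typeG G)
    (z : Fin k → ℝ) : doubling f z ∈ typeG G := by
  obtain ⟨μ, hμ, h0, rfl⟩ := hf
  exact ⟨_, isFiniteMeasure_doublingMeasure hG μ z, doublingMeasure_ne_zero hG h0 z,
    doubling_gaussianConv hG μ z⟩

lemma doublingMarginal_mem_typeG (hG : G.PosDef) {f : (Fin k → ℝ) → ℝ≥0∞} (hf : f ∈ typeG G) :
    doublingMarginal f ∈ typeG G := by
  obtain ⟨μ, hμ, h0, rfl⟩ := hf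
  have : IsFiniteMeasure ((μ.prod μ).map fun p => (rotation p).1) :=
    Measure.isFiniteMeasure_map _ _
  refine ⟨_, Measure.smul_finite _ (gaussianMass_ne_top hG), ?_, doublingMarginal_gaussianConv hG μ⟩
  rw [← Measure.measure_univ_ne_zero, Measure.smul_apply, smul_eq_mul]
  exact mul_ne_zero (gaussianMass_ne_zero hG)
    (Measure.measure_univ_ne_zero.2 (map_prod_ne_zero h0))

lemma lintegral_doublingMarginal (hG : G.PosDef) {f : (Fin k → ℝ) → ℝ≥0∞} (hf : f ∈ typeG G) :
    ∫⁻ z, doublingMarginal f z = (∫⁻ x, f x) * ∫⁻ x, f x := by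
  obtain ⟨μ, hμ, h0, rfl⟩ := hf
  have : IsFiniteMeasure ((μ.prod μ).map fun p => (rotation p).1) :=
    Measure.isFiniteMeasure_map _ _
  rw [doublingMarginal_gaussianConv hG]
  simp only [gaussianConv_smul]
  rw [lintegral_const_mul' _ _ (gaussianMass_ne_top hG), lintegral_gaussianConv,
    lintegral_gaussianConv, Measure.map_apply measurable_rotation_fst MeasurableSet.univ,
    Set.preimage_univ, ← Set.univ_prod_univ, Measure.prod_prod]
  ring

end Doubling

/-! ### Doubling preserves minimizers -/

section DoublingMinimizers

variable {n m : ℕ} {d : Fin m → ℕ} {B : ∀ j, Matrix (Fin (d j)) (Fin n) ℝ} {c : Fin m → ℝ}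
  {Q : Matrix (Fin n) (Fin n) ℝ} {G : ∀ j, Matrix (Fin (d j)) (Fin (d j)) ℝ}

lemma rotation_mulVec {k : ℕ} (A : Matrix (Fin k) (Fin n) ℝ) (z : (Fin n → ℝ) × (Fin n → ℝ)) :
    rotation (A *ᵥ z.1, A *ᵥ z.2) = (A *ᵥ (rotation z).1, A *ᵥ (rotation z).2) := by
  simp only [rotation, mulVec_smul, mulVec_add, mulVec_sub]

lemma measurable_doubling_integrand {f : ∀ j, (Fin (d j) → ℝ) → ℝ≥0∞}
    (hf : ∀ j, Measurable (f j)) :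
    Measurable fun z : (Fin n → ℝ) × (Fin n → ℝ) => gaussianKernel Q z.1 *
      (gaussianKernel Q z.2 * ∏ j, doubling (f j) (B j *ᵥ z.1) (B j *ᵥ z.2) ^ c j) := by
  have hK := (continuous_gaussianKernel Q).measurable
  have hB : ∀ j, Measurable fun z : (Fin n → ℝ) × (Fin n → ℝ) => (B j *ᵥ z.1, B j *ᵥ z.2) :=
    fun j => ((Continuous.matrix_mulVec continuous_const continuous_fst).prodMk
      (Continuous.matrix_mulVec continuous_const continuous_snd)).measurable
  refine (hK.comp measurable_fst).mul ((hK.comp measurable_snd).mul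
    (Finset.measurable_prod _ fun j _ => Measurable.pow_const (Measurable.mul ?_ ?_) _))
  · exact (hf j).comp (measurable_rotation_fst.comp (hB j))
  · exact (hf j).comp (measurable_rotation_snd.comp (hB j))

/-- The square of the numerator, after rotation. -/
lemma numerator_mul_self (hQ : Q.IsHermitian) {f : ∀ j, (Fin (d j) → ℝ) → ℝ≥0∞}
    (hf : ∀ j, Measurable (f j)) (hft : ∀ j x, f j x ≠ ∞) :
    numerator B c Q f * numerator B c Q f =
      ∫⁻ x, gaussianKernel Q x * numerator B c Q fun j => doubling (f j) (B j *ᵥ x) := by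
  have hm := measurable_integrand (B := B) (c := c) (Q := Q) hf
  have hm2 : Measurable fun z : (Fin n → ℝ) × (Fin n → ℝ) =>
      (gaussianKernel Q z.1 * ∏ j, f j (B j *ᵥ z.1) ^ c j) *
        (gaussianKernel Q z.2 * ∏ j, f j (B j *ᵥ z.2) ^ c j) :=
    (hm.comp measurable_fst).mul (hm.comp measurable_snd)
  rw [numerator, ← lintegral_prod_mul hm.aemeasurable hm.aemeasurable, ← map_rotation n,
    lintegral_map hm2 continuous_rotation.measurable]
  have hpt : ∀ z : (Fin n → ℝ) × (Fin n → ℝ),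
      (gaussianKernel Q (rotation z).1 * ∏ j, f j (B j *ᵥ (rotation z).1) ^ c j) *
        (gaussianKernel Q (rotation z).2 * ∏ j, f j (B j *ᵥ (rotation z).2) ^ c j) =
      gaussianKernel Q z.1 *
        (gaussianKernel Q z.2 * ∏ j, doubling (f j) (B j *ᵥ z.1) (B j *ᵥ z.2) ^ c j) := by
    intro z
    simp only [doubling, rotation_mulVec]
    rw [mul_mul_mul_comm, gaussianKernel_rotation hQ, prod_mul_rpow _ _ (fun j => hft j _)
      fun j => hft j _, mul_assoc]
  simp only [hpt]
  rw [lintegral_prod _ (measurable_doubling_integrand hf).aemeasurable]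
  refine lintegral_congr fun x => ?_
  rw [lintegral_const_mul' _ _ (gaussianKernel_ne_top _ _), numerator]

/-- The doubling of a minimizer is a minimizer. -/
lemma BL_doubling_eq (hG : ∀ j, (G j).PosDef) (hQ : Q.IsHermitian)
    (hI : inverseConst B c Q G ≠ ∞) {f : ∀ j, (Fin (d j) → ℝ) → ℝ≥0∞}
    (hf : ∀ j, f j ∈ typeG (G j)) (hmin : BL B c Q f = inverseConst B c Q G) :
    BL B c Q (fun j => doubling (f j) 0) = inverseConst B c Q G := by
  set I := inverseConst B c Q G with hIdef
  have hfm : ∀ j, Measurable (f j) := fun j => (continuous_of_mem_typeG (hG j) (hf j)).measurable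
  have hft : ∀ j x, f j x ≠ ∞ := fun j => ne_top_of_mem_typeG (hG j) (hf j)
  have hdbl : ∀ x j, doubling (f j) (B j *ᵥ x) ∈ typeG (G j) :=
    fun x j => doubling_mem_typeG (hG j) (hf j) _
  have hmar : ∀ j, doublingMarginal (f j) ∈ typeG (G j) :=
    fun j => doublingMarginal_mem_typeG (hG j) (hf j)
  set D := ∏ j, (∫⁻ y, f j y) ^ c j with hD
  have hDt : D ≠ ∞ := denominator_ne_top hG hf
  have hnum : numerator B c Q f ≤ I * D := (BL_le_iff hG hf).1 hmin.le
  -- For each fixed `x` the slices are competitors, and their integrals are the marginals at `B j *ᵥ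
  -- x`.
  have hpt : ∀ x, gaussianKernel Q x * (I * ∏ j, doublingMarginal (f j) (B j *ᵥ x) ^ c j) ≤
      gaussianKernel Q x * numerator B c Q fun j => doubling (f j) (B j *ᵥ x) := fun x =>
    mul_le_mul_right (inverseConst_mul_le hG (hdbl x)) _
  have hint1 : ∫⁻ x, gaussianKernel Q x * (I * ∏ j, doublingMarginal (f j) (B j *ᵥ x) ^ c j) =
      I * numerator B c Q fun j => doublingMarginal (f j) := by
    rw [numerator, ← lintegral_const_mul' _ _ hI]
    exact lintegral_congr fun x => by ring
  have hint2 : ∫⁻ x, gaussianKernel Q x * numerator B c Q (fun j => doubling (f j) (B j *ᵥ x)) ≤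
      (I * D) * (I * D) := by
    rw [← numerator_mul_self hQ hfm hft]
    exact mul_le_mul' hnum hnum
  -- The marginals are competitors too. This closes the chain of integrals, so the pointwise
  -- inequality `hpt` is an equality almost everywhere.
  have hint3 : (I * D) * (I * D) ≤ I * numerator B c Q fun j => doublingMarginal (f j) := by
    have h1 := inverseConst_mul_le (B := B) (c := c) (Q := Q) hG hmar
    have h2 : ∏ j, (∫⁻ y, doublingMarginal (f j) y) ^ c j = D * D := by
      simp only [fun j => lintegral_doublingMarginal (hG j) (hf j)]
      exact prod_mul_rpow _ _ (fun j => lintegral_ne_top_of_mem_typeG (hG j) (hf j))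
        fun j => lintegral_ne_top_of_mem_typeG (hG j) (hf j)
    rw [h2] at h1
    calc (I * D) * (I * D) = I * (I * (D * D)) := by ring
      _ ≤ _ := mul_le_mul_right h1 _
  have hmeas : AEMeasurable fun x => gaussianKernel Q x *
      numerator B c Q fun j => doubling (f j) (B j *ᵥ x) := by
    have h1 := (measurable_doubling_integrand (B := B) (c := c) (Q := Q) hfm).lintegral_prod_right'
      (ν := volume)
    refine h1.aemeasurable.congr (Eventually.of_forall fun x => ?_)
    exact lintegral_const_mul' _ _ (gaussianKernel_ne_top _ _)
  have hfin : ∫⁻ x, gaussianKernel Q x * (I * ∏ j, doublingMarginal (f j) (B j *ᵥ x) ^ c j) ≠ ∞ :=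
    ne_top_of_le_ne_top (ENNReal.mul_ne_top (ENNReal.mul_ne_top hI hDt) (ENNReal.mul_ne_top hI hDt))
      ((lintegral_mono hpt).trans hint2)
  have hae := ae_eq_of_ae_le_of_lintegral_le (Eventually.of_forall hpt) hfin hmeas
    (hint2.trans (hint3.trans hint1.ge))
  -- The equality set may miss `0`, but it is dense. Along a sequence in it tending to `0`, the
  -- numerator is lower semicontinuous and the marginals are continuous, which is the right
  -- direction for a minimizer.
  have hdense := Measure.dense_of_ae hae
  obtain ⟨x, hx, hx0⟩ := mem_closure_iff_seq_limit.1 (hdense 0)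
  have hxB : ∀ j, Tendsto (fun k => B j *ᵥ x k) atTop (𝓝 0) := fun j => by
    have h1 : Continuous fun y : Fin n → ℝ => B j *ᵥ y :=
      Continuous.matrix_mulVec continuous_const continuous_id
    have h2 := (h1.tendsto 0).comp hx0
    rwa [mulVec_zero] at h2
  have hxk : ∀ k, numerator B c Q (fun j => doubling (f j) (B j *ᵥ x k)) =
      I * ∏ j, doublingMarginal (f j) (B j *ᵥ x k) ^ c j := fun k =>
    ((ENNReal.mul_right_inj (gaussianKernel_ne_zero _ _) (gaussianKernel_ne_top _ _)).1 (hx k)).symm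
  have hd0 : ∀ j, doubling (f j) 0 ∈ typeG (G j) := fun j => doubling_mem_typeG (hG j) (hf j) _
  have hlsc := numerator_le_liminf (B := B) (c := c) (Q := Q)
    (f := fun k j => doubling (f j) (B j *ᵥ x k)) (g := fun j => doubling (f j) 0)
    (fun k j => (continuous_of_mem_typeG (hG j) (hdbl _ j)).measurable)
    (fun j w => (ENNReal.rpow_pos (pos_iff_ne_zero.2 (ne_zero_of_mem_typeG (hG j) (hd0 j) w))
      (ne_top_of_mem_typeG (hG j) (hd0 j) w)).ne') ?_
  swap
  · intro j w
    have hc := continuous_of_mem_typeG (hG j) (hf j)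
    have h1 : Tendsto (fun k => rotation (B j *ᵥ x k, w)) atTop (𝓝 (rotation (0, w))) :=
      (continuous_rotation.tendsto _).comp ((hxB j).prodMk_nhds tendsto_const_nhds)
    exact ENNReal.Tendsto.mul
      ((hc.tendsto _).comp ((continuous_fst.tendsto _).comp h1)) (Or.inr (hft j _))
      ((hc.tendsto _).comp ((continuous_snd.tendsto _).comp h1)) (Or.inr (hft j _))
  have hlim : Tendsto (fun k => numerator B c Q fun j => doubling (f j) (B j *ᵥ x k)) atTop
      (𝓝 (I * ∏ j, doublingMarginal (f j) 0 ^ c j)) := by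
    simp only [hxk]
    have h0 := fun j => ne_zero_of_mem_typeG (hG j) (hmar j) 0
    have ht := fun j => ne_top_of_mem_typeG (hG j) (hmar j) 0
    refine ENNReal.Tendsto.const_mul (tendsto_finsetProd_of_ne_zero _ (fun j _ => ?_)
      fun j _ => (ENNReal.rpow_pos (pos_iff_ne_zero.2 (h0 j)) (ht j)).ne') (Or.inr hI)
    exact (ENNReal.continuous_rpow_const.tendsto _).comp
      (((continuous_of_mem_typeG (hG j) (hmar j)).tendsto 0).comp (hxB j))
  refine le_antisymm ?_ (inverseConst_le hd0)
  rw [BL_le_iff hG hd0]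
  exact hlsc.trans hlim.liminf_eq.le

end DoublingMinimizers

/-! ### Estimates for the central limit argument -/

section Cosh

lemma cosh_sub_one (y : ℝ) : Real.cosh y - 1 = 2 * Real.sinh (y / 2) ^ 2 := by
  have h := Real.cosh_two_mul (y / 2)
  rw [mul_div_cancel₀ y two_ne_zero, Real.cosh_sq] at h
  rw [h]
  ring

lemma sq_le_two_mul_cosh_sub_one (y : ℝ) : y ^ 2 ≤ 2 * (Real.cosh y - 1) := by
  rw [cosh_sub_one]
  have h : (y / 2) ^ 2 ≤ Real.sinh (y / 2) ^ 2 := by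
    rw [sq_le_sq, Real.abs_sinh]
    exact Real.self_le_sinh_iff.2 (abs_nonneg _)
  nlinarith

/-- Compare power series termwise: `t ^ (2k) ≤ t ^ 2` for `k ≥ 1`. This gives a dominating function
for the rescaled increments that is independent of `t`. -/
lemma cosh_mul_sub_one_le {t : ℝ} (ht : t ^ 2 ≤ 1) (y : ℝ) :
    Real.cosh (t * y) - 1 ≤ t ^ 2 * (Real.cosh y - 1) := by
  have h1 := Real.hasSum_cosh (t * y)
  -- The extra `1 - t ^ 2` at index `0` makes the constant terms agree.
  have h2 := ((Real.hasSum_cosh y).mul_left (t ^ 2)).add (hasSum_ite_eq 0 (1 - t ^ 2))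
  have h3 := hasSum_le (fun k => ?_) h1 h2
  · linarith
  rcases k with _ | k
  · simp
  · simp only [Nat.add_eq_zero_iff, one_ne_zero, and_false, if_false, add_zero]
    rw [mul_pow, ← mul_div_assoc]
    have h4 : t ^ (2 * (k + 1)) ≤ t ^ 2 := by
      rw [pow_mul]
      exact pow_le_of_le_one (sq_nonneg t) ht k.succ_ne_zero
    have h5 : 0 ≤ y ^ (2 * (k + 1)) := by rw [pow_mul]; positivity
    gcongr

lemma tendsto_cosh_sub_one_div (y : ℝ) {t : ℕ → ℝ} (ht : Tendsto t atTop (𝓝[≠] 0)) :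
    Tendsto (fun k => (t k ^ 2)⁻¹ * (Real.cosh (t k * y) - 1)) atTop (𝓝 (y ^ 2 / 2)) := by
  have h1 : HasDerivAt (fun x : ℝ => Real.sinh (x * (y / 2))) (y / 2) 0 := by
    have := ((hasDerivAt_id (0 : ℝ)).mul_const (y / 2)).sinh
    simpa using this
  have h2 := (hasDerivAt_iff_tendsto_slope_zero.1 h1).comp ht
  have h3 := (h2.pow 2).const_mul 2
  have h4 : 2 * (y / 2) ^ 2 = y ^ 2 / 2 := by ring
  rw [h4] at h3
  refine h3.congr fun k => ?_
  rw [cosh_sub_one]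
  simp only [Function.comp_apply, zero_add, zero_mul, Real.sinh_zero, sub_zero, smul_eq_mul]
  rw [mul_div_assoc]
  ring

/-- After taking logarithms, `N log (1 + v)` is squeezed between `2Nv / (v + 2)` and `Nv`. -/
lemma tendsto_one_add_pow {v : ℕ → ℝ} {N : ℕ → ℕ} {L : ℝ} (hv : ∀ k, 0 ≤ v k)
    (hv0 : Tendsto v atTop (𝓝 0)) (h : Tendsto (fun k => N k * v k) atTop (𝓝 L)) :
    Tendsto (fun k => (1 + v k) ^ N k) atTop (𝓝 (Real.exp L)) := by
  have h1 : Tendsto (fun k => N k * Real.log (1 + v k)) atTop (𝓝 L) := by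
    have h2 : Tendsto (fun k => (N k * v k) * (2 / (v k + 2))) atTop (𝓝 (L * (2 / (0 + 2)))) :=
      h.mul (tendsto_const_nhds.div (hv0.add_const 2) (by norm_num))
    rw [zero_add, div_self two_ne_zero, mul_one] at h2
    refine tendsto_of_tendsto_of_tendsto_of_le_of_le h2 h (fun k => ?_) fun k => ?_
    · have h3 := mul_le_mul_of_nonneg_left (Real.le_log_one_add_of_nonneg (hv k))
        (Nat.cast_nonneg (α := ℝ) (N k))
      refine le_trans (le_of_eq ?_) h3
      ring
    · have h3 := Real.log_le_sub_one_of_pos (show 0 < 1 + v k by linarith [hv k])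
      have h4 := mul_le_mul_of_nonneg_left h3 (Nat.cast_nonneg (α := ℝ) (N k))
      simpa using h4
  refine ((Real.continuous_exp.tendsto L).comp h1).congr fun k => ?_
  rw [Function.comp_apply, mul_comm, Real.exp_mul, Real.exp_log (by linarith [hv k]),
    Real.rpow_natCast]

end Cosh

/-! ### Rescaled powers converge to a gaussian -/

section GaussianLimit

variable {k : ℕ} {G : Matrix (Fin k) (Fin k) ℝ}

lemma gaussian_sub_eq (hG : G.IsHermitian) (w a : Fin k → ℝ) :
    gaussian G (w - a) = Real.exp (-Real.pi * (w ⬝ᵥ G *ᵥ w)) *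
      (gaussian G (0 - a) * Real.exp (2 * Real.pi * (w ⬝ᵥ G *ᵥ a))) := by
  have h0 : (0 - a) ⬝ᵥ G *ᵥ (0 - a) = a ⬝ᵥ G *ᵥ a := by
    rw [zero_sub, mulVec_neg, neg_dotProduct_neg]
  rw [gaussian, gaussian, quadForm_sub hG, h0, mul_left_comm, mul_assoc, ← Real.exp_add,
    ← Real.exp_add]
  congr 2
  ring

/-- A normalized function of type `G` in terms of exponential moments. -/
lemma exists_exp_moments (hG : G.PosDef) {e : (Fin k → ℝ) → ℝ≥0∞} (he : e ∈ typeG G) :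
    ∃ ν : Measure (Fin k → ℝ), IsProbabilityMeasure ν ∧
      ∀ w, e w / e 0 = ENNReal.ofReal (Real.exp (-Real.pi * (w ⬝ᵥ G *ᵥ w))) *
        ∫⁻ a, ENNReal.ofReal (Real.exp (2 * Real.pi * (w ⬝ᵥ G *ᵥ a))) ∂ν := by
  have h0 := ne_zero_of_mem_typeG hG he 0
  have ht := ne_top_of_mem_typeG hG he 0
  obtain ⟨μ, hμ, hμ0, rfl⟩ := he
  -- Tilting `μ` by `g_G(0 - a)` and normalizing absorbs every factor that does not depend on `w`.
  refine ⟨(gaussianConv G μ 0)⁻¹ • μ.withDensity fun a => ENNReal.ofReal (gaussian G (0 - a)),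
    ⟨?_⟩, fun w => ?_⟩
  · rw [Measure.smul_apply, withDensity_apply _ MeasurableSet.univ, Measure.restrict_univ,
      smul_eq_mul]
    exact ENNReal.inv_mul_cancel h0 ht
  · have hm : Measurable fun a : Fin k → ℝ =>
        ENNReal.ofReal (Real.exp (2 * Real.pi * (w ⬝ᵥ G *ᵥ a))) := by
      have : Continuous fun a : Fin k → ℝ => w ⬝ᵥ G *ᵥ a :=
        continuous_const.dotProduct (continuous_const.matrix_mulVec continuous_id)
      fun_prop
    rw [lintegral_smul_measure, lintegral_withDensity_eq_lintegral_mul _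
      (measurable_gaussian_const_sub G 0) hm, smul_eq_mul, ENNReal.div_eq_inv_mul, mul_left_comm,
      ← lintegral_const_mul' _ _ ENNReal.ofReal_ne_top]
    congr 1
    refine lintegral_congr fun a => ?_
    rw [gaussian_sub_eq hG.1, ENNReal.ofReal_mul (Real.exp_pos _).le,
      ENNReal.ofReal_mul (gaussian_pos hG _).le]
    rfl

/-- An even normalized function of type `G` in terms of hyperbolic cosines. -/
lemma exists_cosh_moments (hG : G.PosDef) {e : (Fin k → ℝ) → ℝ≥0∞} (he : e ∈ typeG G)
    (heven : ∀ w, e (-w) = e w) :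
    ∃ ν : Measure (Fin k → ℝ), IsProbabilityMeasure ν ∧
      ∀ w, Integrable (fun a => Real.cosh (2 * Real.pi * (w ⬝ᵥ G *ᵥ a))) ν ∧
        e w / e 0 = ENNReal.ofReal (Real.exp (-Real.pi * (w ⬝ᵥ G *ᵥ w)) *
          ∫ a, Real.cosh (2 * Real.pi * (w ⬝ᵥ G *ᵥ a)) ∂ν) := by
  obtain ⟨ν, hν, h⟩ := exists_exp_moments hG he
  have hc : ∀ w, Continuous fun a : Fin k → ℝ => 2 * Real.pi * (w ⬝ᵥ G *ᵥ a) := fun w =>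
    continuous_const.mul
      (continuous_const.dotProduct (continuous_const.matrix_mulVec continuous_id))
  have hfin : ∀ w, e w / e 0 ≠ ∞ := fun w =>
    ENNReal.div_ne_top (ne_top_of_mem_typeG hG he w) (ne_zero_of_mem_typeG hG he 0)
  have hexp0 : ∀ x : ℝ, ENNReal.ofReal (Real.exp x) ≠ 0 := fun x => by
    simpa using Real.exp_pos x
  have hfinexp : ∀ w, ∫⁻ a, ENNReal.ofReal (Real.exp (2 * Real.pi * (w ⬝ᵥ G *ᵥ a))) ∂ν ≠ ∞ := by
    intro w h1
    refine hfin w ?_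
    rw [h w, h1, ENNReal.mul_top (hexp0 _)]
  have hint : ∀ w, Integrable (fun a => Real.exp (2 * Real.pi * (w ⬝ᵥ G *ᵥ a))) ν := fun w =>
    (lintegral_ofReal_ne_top_iff_integrable
      (Real.continuous_exp.comp (hc w)).aestronglyMeasurable
      (Eventually.of_forall fun a => (Real.exp_pos _).le)).1 (hfinexp w)
  have hneg : ∀ w a : Fin k → ℝ, 2 * Real.pi * ((-w) ⬝ᵥ G *ᵥ a) = -(2 * Real.pi * (w ⬝ᵥ G *ᵥ a)) :=
    fun w a => by rw [neg_dotProduct]; ring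
  have hval : ∀ w, e w / e 0 = ENNReal.ofReal (Real.exp (-Real.pi * (w ⬝ᵥ G *ᵥ w)) *
      ∫ a, Real.exp (2 * Real.pi * (w ⬝ᵥ G *ᵥ a)) ∂ν) := fun w => by
    rw [h w, ENNReal.ofReal_mul (Real.exp_pos _).le, ofReal_integral_eq_lintegral_ofReal (hint w)
      (Eventually.of_forall fun a => (Real.exp_pos _).le)]
  -- Evenness of `e` equates the exponential moments at `w` and `-w`. Their average is a `cosh`
  -- moment, with no linear term to spoil the rescaling.
  have hsymm : ∀ w, ∫ a, Real.exp (-(2 * Real.pi * (w ⬝ᵥ G *ᵥ a))) ∂ν =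
      ∫ a, Real.exp (2 * Real.pi * (w ⬝ᵥ G *ᵥ a)) ∂ν := by
    intro w
    have h1 := hval (-w)
    rw [heven, hval w] at h1
    simp only [hneg, mulVec_neg, neg_dotProduct_neg] at h1
    have hnn : ∀ g : (Fin k → ℝ) → ℝ, 0 ≤ Real.exp (-Real.pi * (w ⬝ᵥ G *ᵥ w)) *
        ∫ a, Real.exp (g a) ∂ν := fun g =>
      mul_nonneg (Real.exp_pos _).le (integral_nonneg fun a => (Real.exp_pos _).le)
    rw [ENNReal.ofReal_eq_ofReal_iff (hnn _) (hnn _)] at h1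
    exact (mul_left_cancel₀ (Real.exp_pos _).ne' h1).symm
  have hint2 : ∀ w, Integrable (fun a => Real.exp (-(2 * Real.pi * (w ⬝ᵥ G *ᵥ a)))) ν := fun w => by
    simpa only [hneg] using hint (-w)
  refine ⟨ν, hν, fun w => ⟨?_, ?_⟩⟩
  · simp only [Real.cosh_eq]
    exact ((hint w).add (hint2 w)).div_const 2
  · rw [hval w]
    simp only [Real.cosh_eq]
    rw [integral_div, integral_add (hint w) (hint2 w), hsymm w, add_self_div_two]

/-- The rescaled powers of an even function of type `G` converge to a gaussian. -/
lemma exists_gaussian_limit (hG : G.PosDef) {e : (Fin k → ℝ) → ℝ≥0∞} (he : e ∈ typeG G)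
    (heven : ∀ w, e (-w) = e w) :
    ∃ A : Matrix (Fin k) (Fin k) ℝ, A.IsHermitian ∧ (G - A).PosSemidef ∧
      ∀ w, Tendsto (fun i : ℕ => (e ((invSqrtTwo ^ i) • w) / e 0) ^ 2 ^ i) atTop
        (𝓝 (ENNReal.ofReal (Real.exp (-Real.pi * (w ⬝ᵥ A *ᵥ w))))) := by
  obtain ⟨ν, hν, h⟩ := exists_cosh_moments hG he heven
  set ℓ : (Fin k → ℝ) → (Fin k → ℝ) → ℝ := fun w a => 2 * Real.pi * (w ⬝ᵥ G *ᵥ a) with hℓ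
  have hℓc : ∀ w, Continuous (ℓ w) := fun w => continuous_const.mul
      (continuous_const.dotProduct (continuous_const.matrix_mulVec continuous_id))
  have hcosh : ∀ w, Integrable (fun a => Real.cosh (ℓ w a)) ν := fun w => (h w).1
  have hsq : ∀ w, Integrable (fun a => ℓ w a ^ 2) ν := fun w => by
    refine Integrable.mono' (((hcosh w).sub (integrable_const 1)).const_mul 2)
      ((hℓc w).pow 2).aestronglyMeasurable (Eventually.of_forall fun a => ?_)
    rw [Real.norm_of_nonneg (sq_nonneg _)]
    exact sq_le_two_mul_cosh_sub_one _
  -- the covariance matrix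
  set E : Fin k → (Fin k → ℝ) → ℝ := fun i a => 2 * Real.pi * (G *ᵥ a) i with hE
  have hEℓ : ∀ i a, E i a = ℓ (Pi.single i 1) a := fun i a => by simp [hE, hℓ]
  have hℓE : ∀ w a, ℓ w a = ∑ i, w i * E i a := fun w a => by
    simp only [hℓ, hE, dotProduct, Finset.mul_sum]
    exact Finset.sum_congr rfl fun i _ => by ring
  have hEE : ∀ i j, Integrable (fun a => E i a * E j a) ν := fun i j => by
    refine Integrable.mono' ((hsq (Pi.single i 1)).add (hsq (Pi.single j 1))) ?_
      (Eventually.of_forall fun a => ?_)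
    · simp only [hEℓ]
      exact ((hℓc _).mul (hℓc _)).aestronglyMeasurable
    · simp only [hEℓ, Pi.add_apply, Real.norm_eq_abs, abs_mul]
      nlinarith [sq_nonneg (|ℓ (Pi.single i 1) a| - |ℓ (Pi.single j 1) a|),
        sq_abs (ℓ (Pi.single i 1) a), sq_abs (ℓ (Pi.single j 1) a),
        sq_nonneg (ℓ (Pi.single i 1) a), sq_nonneg (ℓ (Pi.single j 1) a)]
  set M : Matrix (Fin k) (Fin k) ℝ := fun i j => ∫ a, E i a * E j a ∂ν with hM
  have hMq : ∀ w, w ⬝ᵥ M *ᵥ w = ∫ a, ℓ w a ^ 2 ∂ν := by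
    intro w
    have h1 : ∀ a, ℓ w a ^ 2 = ∑ i, ∑ j, w i * w j * (E i a * E j a) := fun a => by
      rw [hℓE, sq, Finset.sum_mul_sum]
      exact Finset.sum_congr rfl fun i _ => Finset.sum_congr rfl fun j _ => by ring
    simp only [h1]
    rw [integral_finsetSum _ fun i _ => integrable_finsetSum _ fun j _ => (hEE i j).const_mul _]
    simp only [dotProduct, mulVec, Finset.mul_sum]
    refine Finset.sum_congr rfl fun i _ => ?_
    rw [integral_finsetSum _ fun j _ => (hEE i j).const_mul _]
    refine Finset.sum_congr rfl fun j _ => ?_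
    rw [integral_const_mul]
    simp only [hM]
    ring
  have hMh : M.IsHermitian := by
    ext i j
    rw [conjTranspose_apply, star_trivial]
    exact integral_congr_ae (Eventually.of_forall fun a => mul_comm _ _)
  have hMpos : M.PosSemidef := .of_dotProduct_mulVec_nonneg hMh fun w => by
    rw [star_trivial, hMq]
    exact integral_nonneg fun a => sq_nonneg _
  have hpi := Real.pi_pos
  -- With `t i ^ 2 = 2⁻ⁱ`, the `2 ^ i`-th power of the `cosh` moment tends to `exp (⟨w, M w⟩ / 2)`,
  -- where `M` is the second moment matrix. Written as `exp (-π ⟨w, · w⟩)` this subtracts `M / (2π)`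
  -- from `G`, and `M ≥ 0` gives `A ≤ G`.
  refine ⟨G - (2 * Real.pi)⁻¹ • M, ?_, ?_, fun w => ?_⟩
  · exact hG.1.sub (hMpos.smul (by positivity : (0 : ℝ) ≤ (2 * Real.pi)⁻¹)).1
  · rw [sub_sub_cancel]
    exact hMpos.smul (by positivity)
  set t : ℕ → ℝ := fun i => invSqrtTwo ^ i with ht
  have hs0 : 0 < invSqrtTwo := by unfold invSqrtTwo; positivity
  have ht2 : ∀ i, t i ^ 2 = ((2 : ℝ) ^ i)⁻¹ := fun i => by
    rw [ht, ← pow_mul, mul_comm, pow_mul, sq, invSqrtTwo_mul_self, inv_pow]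
  have hs1 : invSqrtTwo < 1 := by
    nlinarith [invSqrtTwo_mul_self]
  have ht0 : Tendsto t atTop (𝓝[≠] 0) :=
    tendsto_nhdsWithin_iff.2 ⟨tendsto_pow_atTop_nhds_zero_of_lt_one hs0.le hs1,
      Eventually.of_forall fun i => (pow_pos hs0 i).ne'⟩
  have ht1 : ∀ i, t i ^ 2 ≤ 1 := fun i => by
    rw [ht2]
    exact inv_le_one_of_one_le₀ (one_le_pow₀ one_le_two)
  have hℓt : ∀ i a, ℓ (t i • w) a = t i * ℓ w a := fun i a => by
    simp only [hℓ, smul_dotProduct, smul_eq_mul]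
    ring
  set v : ℕ → ℝ := fun i => ∫ a, (Real.cosh (t i * ℓ w a) - 1) ∂ν with hv
  have hvint : ∀ i, Integrable (fun a => Real.cosh (t i * ℓ w a)) ν := fun i => by
    simpa only [hℓt] using hcosh (t i • w)
  have hv1 : ∀ i, ∫ a, Real.cosh (t i * ℓ w a) ∂ν = 1 + v i := fun i => by
    simp only [hv]
    rw [integral_sub (hvint i) (integrable_const 1)]
    simp
  have hv0 : ∀ i, 0 ≤ v i := fun i =>
    integral_nonneg fun a => sub_nonneg.2 (Real.one_le_cosh _)
  have hlim : Tendsto (fun i => ((2 ^ i : ℕ) : ℝ) * v i) atTop (𝓝 (∫ a, ℓ w a ^ 2 / 2 ∂ν)) := by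
    have h1 : ∀ i, ((2 ^ i : ℕ) : ℝ) * v i =
        ∫ a, (t i ^ 2)⁻¹ * (Real.cosh (t i * ℓ w a) - 1) ∂ν := fun i => by
      rw [integral_const_mul, ht2, inv_inv]
      push_cast
      rfl
    simp only [h1]
    refine tendsto_integral_of_dominated_convergence (fun a => Real.cosh (ℓ w a) - 1)
      (fun i => ?_) ((hcosh w).sub (integrable_const 1)) (fun i => Eventually.of_forall fun a => ?_)
      (Eventually.of_forall fun a => tendsto_cosh_sub_one_div _ ht0)
    · exact (((hvint i).sub (integrable_const 1)).const_mul _).aestronglyMeasurable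
    · have h2 := sub_nonneg.2 (Real.one_le_cosh (t i * ℓ w a))
      have h3 : 0 < t i ^ 2 := by rw [ht2]; positivity
      rw [Real.norm_of_nonneg (by positivity), inv_mul_le_iff₀ h3]
      exact cosh_mul_sub_one_le (ht1 i) _
  have hvlim : Tendsto v atTop (𝓝 0) := by
    have h1 := hlim.mul (tendsto_pow_atTop_nhds_zero_of_lt_one (r := (2 : ℝ)⁻¹)
      (by norm_num) (by norm_num))
    rw [mul_zero] at h1
    refine h1.congr fun i => ?_
    rw [inv_pow]
    push_cast
    field_simp
  have hpow := (tendsto_one_add_pow hv0 hvlim hlim).const_mul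
    (Real.exp (-Real.pi * (w ⬝ᵥ G *ᵥ w)))
  have hfinal : Real.exp (-Real.pi * (w ⬝ᵥ G *ᵥ w)) * Real.exp (∫ a, ℓ w a ^ 2 / 2 ∂ν) =
      Real.exp (-Real.pi * (w ⬝ᵥ (G - (2 * Real.pi)⁻¹ • M) *ᵥ w)) := by
    rw [← Real.exp_add, integral_div, ← hMq, sub_mulVec, dotProduct_sub, smul_mulVec,
      dotProduct_smul, smul_eq_mul]
    congr 1
    field_simp
    ring
  rw [hfinal] at hpow
  refine ((ENNReal.continuous_ofReal.tendsto _).comp hpow).congr fun i => ?_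
  rw [(h _).2, quadForm_smul, ht2, Function.comp_apply]
  change _ = ENNReal.ofReal (_ * ∫ a, Real.cosh (ℓ (t i • w) a) ∂ν) ^ 2 ^ i
  simp only [hℓt]
  rw [hv1, ← ENNReal.ofReal_pow (by have := hv0 i; positivity), mul_pow, ← Real.exp_nat_mul]
  congr 3
  push_cast
  field_simp

end GaussianLimit

/-! ### Gaussian minimizers for coercive data -/

section GaussianMinimizer

variable {k : ℕ} {G : Matrix (Fin k) (Fin k) ℝ}

lemma doubling_zero (f : (Fin k → ℝ) → ℝ≥0∞) (w : Fin k → ℝ) :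
    doubling f 0 w = f (invSqrtTwo • w) * f (-(invSqrtTwo • w)) := by
  simp [doubling, rotation]

lemma doubling_zero_neg (f : (Fin k → ℝ) → ℝ≥0∞) (w : Fin k → ℝ) :
    doubling f 0 (-w) = doubling f 0 w := by
  rw [doubling_zero, doubling_zero, smul_neg, neg_neg, mul_comm]

/-- Iterated doublings of an even function are its rescaled powers. -/
lemma iterate_doubling_zero {e : (Fin k → ℝ) → ℝ≥0∞} (heven : ∀ w, e (-w) = e w) (i : ℕ) :
    ∀ w, (fun g => doubling g 0)^[i] e w = e ((invSqrtTwo ^ i) • w) ^ 2 ^ i := by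
  induction i with
  | zero => intro w; simp
  | succ i ih =>
    intro w
    rw [Function.iterate_succ_apply', doubling_zero, ih, ih, smul_neg, heven, smul_smul, ← pow_succ,
      ← sq, ← pow_mul, ← pow_succ]

lemma tendsto_gaussianConv_nsmul (hG : G.PosDef) (μ : Measure (Fin k → ℝ)) [IsFiniteMeasure μ]
    {w : Fin k → ℝ} (hw : w ≠ 0) :
    Tendsto (fun i : ℕ => gaussianConv G μ ((i : ℝ) • w)) atTop (𝓝 0) := by
  rw [← lintegral_zero (μ := μ)]
  refine tendsto_lintegral_of_dominated_convergence (fun _ => ENNReal.ofReal (Real.sqrt G.det))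
    (fun i => measurable_gaussian_const_sub G _)
    (fun i => Eventually.of_forall fun y => ENNReal.ofReal_le_ofReal (gaussian_le hG _)) ?_
    (Eventually.of_forall fun y => ?_)
  · rw [lintegral_const]
    exact ENNReal.mul_ne_top ENNReal.ofReal_ne_top (measure_ne_top _ _)
  · have h1 : Tendsto (fun i : ℕ => (i : ℝ) • w - y) atTop (cocompact _) := by
      rw [← Metric.cobounded_eq_cocompact, ← tendsto_norm_atTop_iff_cobounded]
      have h2 : Tendsto (fun i : ℕ => (i : ℝ) * ‖w‖ - ‖y‖) atTop atTop :=
        tendsto_atTop_add_const_right _ _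
          (tendsto_natCast_atTop_atTop.atTop_mul_const (norm_pos_iff.2 hw))
      refine tendsto_atTop_mono (fun i => ?_) h2
      have h3 := norm_sub_norm_le ((i : ℝ) • w) y
      rwa [norm_smul, Real.norm_natCast] at h3
    have h2 := (ENNReal.continuous_ofReal.tendsto 0).comp ((tendsto_gaussian_cocompact hG).comp h1)
    rwa [ENNReal.ofReal_zero] at h2

/-- If `⟨w, A w⟩ ≤ 0` for some `w ≠ 0`, the function would stay at least its positive value at `0`
along the multiples of `w`, whereas a convolution of `g_G` with a finite measure tends to zero
there. -/
lemma posDef_of_gaussianConv_eq (hG : G.PosDef) (μ : Measure (Fin k → ℝ)) [IsFiniteMeasure μ]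
    (hμ : μ ≠ 0) {A : Matrix (Fin k) (Fin k) ℝ} (hA : A.IsHermitian)
    (h : ∀ w, gaussianConv G μ w =
      gaussianConv G μ 0 * ENNReal.ofReal (Real.exp (-Real.pi * (w ⬝ᵥ A *ᵥ w)))) : A.PosDef := by
  refine .of_dotProduct_mulVec_pos hA fun w hw => ?_
  rw [star_trivial]
  by_contra! hle
  have h1 := tendsto_gaussianConv_nsmul hG μ hw
  have h2 : gaussianConv G μ 0 ≤ 0 := by
    refine ge_of_tendsto' h1 fun i => ?_
    rw [h ((i : ℝ) • w)]
    refine le_mul_of_one_le_right' (ENNReal.one_le_ofReal.2 (Real.one_le_exp ?_))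
    rw [quadForm_smul]
    have h3 : (i : ℝ) ^ 2 * (w ⬝ᵥ A *ᵥ w) ≤ 0 :=
      mul_nonpos_of_nonneg_of_nonpos (sq_nonneg _) hle
    nlinarith [Real.pi_pos]
  exact gaussianConv_ne_zero hG hμ 0 (le_antisymm h2 zero_le)

variable {n m : ℕ} {d : Fin m → ℕ} {B : ∀ j, Matrix (Fin (d j)) (Fin n) ℝ} {c : Fin m → ℝ}
  {Q : Matrix (Fin n) (Fin n) ℝ} {G : ∀ j, Matrix (Fin (d j)) (Fin (d j)) ℝ}

/-- For a coercive datum the infimum is attained at gaussians. -/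
lemma IsCoercive.gaussianInverseConst_le (hG : ∀ j, (G j).PosDef) (hc : ∀ j, c j ≠ 0)
    (hQ : Q.IsHermitian) (hco : IsCoercive B c Q G) :
    gaussianInverseConst B c Q G ≤ inverseConst B c Q G := by
  by_cases hI : inverseConst B c Q G = ∞
  · rw [hI]
    exact le_top
  obtain ⟨f, hf, hmin⟩ := hco.exists_minimizer hG hc hI
  -- One preliminary doubling makes the minimizer even, so that further doublings are exact rescaled
  -- powers.
  set e : ∀ j, (Fin (d j) → ℝ) → ℝ≥0∞ := fun j => doubling (f j) 0 with he
  have hemem : ∀ j, e j ∈ typeG (G j) := fun j => doubling_mem_typeG (hG j) (hf j) 0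
  have heven : ∀ j w, e j (-w) = e j w := fun j => doubling_zero_neg (f j)
  have hemin : BL B c Q e = inverseConst B c Q G := BL_doubling_eq hG hQ hI hf hmin
  set H : ℕ → ∀ j, (Fin (d j) → ℝ) → ℝ≥0∞ := fun i j => (fun g => doubling g 0)^[i] (e j) with hH
  have hHmem : ∀ i, (∀ j, H i j ∈ typeG (G j)) ∧ BL B c Q (H i) = inverseConst B c Q G := by
    intro i
    induction i with
    | zero => exact ⟨hemem, hemin⟩
    | succ i ih =>
      have hs : H (i + 1) = fun j => doubling (H i j) 0 := by
        funext j
        simp only [hH, Function.iterate_succ_apply']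
      rw [hs]
      exact ⟨fun j => doubling_mem_typeG (hG j) (ih.1 j) 0, BL_doubling_eq hG hQ hI ih.1 ih.2⟩
  choose μ hμ hr hBL using fun i =>
    exists_isProbabilityMeasure_BL_eq (B := B) (c := c) (Q := Q) hG (hHmem i).1
  choose r hr0 hrt hr using hr
  have hconst : ∀ i, BL B c Q (fun j => gaussianConv (G j) (μ i j)) = inverseConst B c Q G :=
    fun i => (hBL i).symm.trans (hHmem i).2
  obtain ⟨φ, hφ, ν, hν, hlim, hνBL⟩ := hco.exists_subseq_tendsto hG hc hI μ hμ
    (by simp only [hconst]; exact tendsto_const_nhds)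
  choose A hAh hAG hA using fun j => exists_gaussian_limit (hG j) (hemem j) (heven j)
  have hν0 : ∀ j, ν j ≠ 0 := fun j => IsProbabilityMeasure.ne_zero _
  have hz : ∀ j, gaussianConv (G j) (ν j) 0 ≠ 0 := fun j => gaussianConv_ne_zero (hG j) (hν0 j) 0
  have ht : ∀ j, gaussianConv (G j) (ν j) 0 ≠ ∞ := fun j => gaussianConv_ne_top (hG j) _ 0
  -- Compactness supplies a minimizing limit without identifying it. Dividing by the value at `0`
  -- cancels the normalizing factors `r`, and the quotients have a known gaussian limit.
  have hratio : ∀ j w, gaussianConv (G j) (ν j) w = gaussianConv (G j) (ν j) 0 *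
      ENNReal.ofReal (Real.exp (-Real.pi * (w ⬝ᵥ A j *ᵥ w))) := by
    intro j w
    have h1 := ENNReal.Tendsto.div (hlim j w) (Or.inr (hz j)) (hlim j 0) (Or.inl (ht j))
    have h2 := (hA j w).comp hφ.tendsto_atTop
    have h3 : ∀ i, gaussianConv (G j) (μ (φ i) j) w / gaussianConv (G j) (μ (φ i) j) 0 =
        ((fun i : ℕ => (e j ((invSqrtTwo ^ i) • w) / e j 0) ^ 2 ^ i) ∘ φ) i := by
      intro i
      have h4 := hr (φ i) j
      have h5 := iterate_doubling_zero (heven j) (φ i)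
      rw [← ENNReal.mul_div_mul_left _ _ (hr0 (φ i) j) (hrt (φ i) j)]
      rw [← congrFun h4 w, ← congrFun h4 0]
      simp only [hH, h5, smul_zero, Function.comp_apply]
      rw [ENNReal.div_eq_inv_mul, ENNReal.div_eq_inv_mul, mul_pow, ENNReal.inv_pow]
    simp only [h3] at h1
    rw [← tendsto_nhds_unique h1 h2, ENNReal.mul_div_cancel (hz j) (ht j)]
  have hApos : ∀ j, (A j).PosDef := fun j =>
    posDef_of_gaussianConv_eq (hG j) (ν j) (hν0 j) (hAh j) (hratio j)
  have hgauss : BLGaussian B c Q A = inverseConst B c Q G := by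
    rw [← hνBL, BLGaussian]
    have h1 : ∀ j, ENNReal.ofReal (Real.sqrt (A j).det) ≠ 0 := fun j => by
      simpa using (hApos j).det_pos
    rw [← BL_smul (r := fun j => ENNReal.ofReal (Real.sqrt (A j).det) / gaussianConv (G j) (ν j) 0)
      (fun j x => gaussianConv_ne_top (hG j) _ x)
      (fun j => lintegral_gaussianConv_ne_top (hG j) _)
      (fun j => ENNReal.div_ne_zero.2 ⟨h1 j, ht j⟩)
      (fun j => ENNReal.div_ne_top ENNReal.ofReal_ne_top (hz j))]
    congr 1
    funext j x
    rw [hratio j x, ← mul_assoc, ENNReal.div_mul_cancel (hz j) (ht j)]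
    exact gaussian_eq_mul_kernel _ _
  rw [← hgauss]
  exact iInf₂_le A fun j => ⟨hApos j, hAG j⟩

end GaussianMinimizer

/-! ### Gaussians are admissible inputs -/

section GaussianInputs

variable {k : ℕ} {G : Matrix (Fin k) (Fin k) ℝ}

lemma isUnit_det_of_posDef (hG : G.PosDef) : IsUnit G.det := isUnit_iff_ne_zero.2 hG.det_pos.ne'

open scoped MatrixOrder in
lemma exists_transpose_mul_self_of_posSemidef {M : Matrix (Fin k) (Fin k) ℝ}
    (hM : M.PosSemidef) : ∃ L : Matrix (Fin k) (Fin k) ℝ, M = Lᵀ * L := by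
  obtain ⟨L, hL⟩ := CStarAlgebra.nonneg_iff_eq_star_mul_self.mp hM.nonneg
  exact ⟨L, by rw [hL, star_eq_conjTranspose, conjTranspose_eq_transpose_of_trivial]⟩

/-- A gaussian `g_A` with `A ≤ G` is of type `G`, up to a constant. -/
lemma exists_gaussian_eq_smul_gaussianConv (hG : G.PosDef) {A : Matrix (Fin k) (Fin k) ℝ}
    (hA : A.PosDef) (hGA : (G - A).PosSemidef) :
    ∃ μ : Measure (Fin k → ℝ), IsFiniteMeasure μ ∧ μ ≠ 0 ∧ ∃ r : ℝ≥0∞, r ≠ 0 ∧ r ≠ ∞ ∧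
      ∀ x, ENNReal.ofReal (gaussian A x) = r * gaussianConv G μ x := by
  -- With `G - A = LᵀL` and `a z = G⁻¹Lᵀz`, the exponent `-⟨y - a, G (y - a)⟩ + ⟨a, G a⟩ - |z|²`
  -- equals `-⟨y, A y⟩ - |L y - z|²`, so integrating over `z` leaves a multiple of the kernel of
  -- `A`. Taking `μ` as a pushforward under `a` allows `L` to be singular.
  obtain ⟨L, hL⟩ := exists_transpose_mul_self_of_posSemidef hGA
  set a : (Fin k → ℝ) → (Fin k → ℝ) := fun z => G⁻¹ *ᵥ (Lᵀ *ᵥ z) with ha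
  have hac : Continuous a := Continuous.matrix_mulVec continuous_const
    (Continuous.matrix_mulVec continuous_const continuous_id)
  have hGa : ∀ y z, y ⬝ᵥ G *ᵥ a z = (L *ᵥ y) ⬝ᵥ z := fun y z => by
    simp only [ha]
    rw [mulVec_mulVec, mul_nonsing_inv _ (isUnit_det_of_posDef hG), one_mulVec, mulVec_transpose,
      dotProduct_comm, ← dotProduct_mulVec, dotProduct_comm]
  have hLL : ∀ y, y ⬝ᵥ G *ᵥ y = y ⬝ᵥ A *ᵥ y + (L *ᵥ y) ⬝ᵥ (L *ᵥ y) := fun y => by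
    have h1 : y ⬝ᵥ (G - A) *ᵥ y = (L *ᵥ y) ⬝ᵥ (L *ᵥ y) := by
      rw [hL, ← mulVec_mulVec, dotProduct_mulVec, vecMul_transpose]
    rw [sub_mulVec, dotProduct_sub] at h1
    linarith
  set ρ : (Fin k → ℝ) → ℝ≥0∞ := fun z =>
    ENNReal.ofReal (Real.exp (Real.pi * (a z ⬝ᵥ G *ᵥ a z) - Real.pi * (z ⬝ᵥ z))) with hρ
  have hρm : Measurable ρ := by
    have h1 : Continuous fun z => a z ⬝ᵥ G *ᵥ a z := (continuous_quadForm G).comp hac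
    have h2 : Continuous fun z : Fin k → ℝ => z ⬝ᵥ z := continuous_id.dotProduct continuous_id
    exact (ENNReal.continuous_ofReal.comp (Real.continuous_exp.comp
      ((continuous_const.mul h1).sub (continuous_const.mul h2)))).measurable
  set μ : Measure (Fin k → ℝ) := (volume.withDensity ρ).map a with hμ
  set J := gaussianMass (1 : Matrix (Fin k) (Fin k) ℝ) with hJ
  have hJ0 : J ≠ 0 := gaussianMass_ne_zero PosDef.one
  have hJt : J ≠ ∞ := gaussianMass_ne_top PosDef.one
  have hconv : ∀ y, gaussianConv G μ y =
      ENNReal.ofReal (Real.sqrt G.det) * gaussianKernel A y * J := by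
    intro y
    rw [gaussianConv, hμ, lintegral_map (measurable_gaussian_const_sub G y) hac.measurable,
      lintegral_withDensity_eq_lintegral_mul _ hρm
        (g := fun z => ENNReal.ofReal (gaussian G (y - a z)))
        ((measurable_gaussian_const_sub G y).comp hac.measurable), hJ,
      ← lintegral_gaussian_sub 1 (L *ᵥ y), ← lintegral_const_mul' _ _
        (ENNReal.mul_ne_top ENNReal.ofReal_ne_top (gaussianKernel_ne_top _ _))]
    refine lintegral_congr fun z => ?_
    rw [Pi.mul_apply, gaussian_eq_mul_kernel, gaussian_eq_mul_kernel, mul_left_comm, mul_assoc]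
    congr 1
    simp only [hρ, gaussianKernel, det_one, Real.sqrt_one, ENNReal.ofReal_one, one_mul, one_mulVec]
    rw [← ENNReal.ofReal_mul (Real.exp_pos _).le, ← ENNReal.ofReal_mul (Real.exp_pos _).le,
      ← Real.exp_add, ← Real.exp_add, quadForm_sub hG.1, hGa y, hLL y, sub_dotProduct,
      dotProduct_sub, dotProduct_sub, dotProduct_comm z (L *ᵥ y)]
    congr 2
    ring
  have hs0 : ENNReal.ofReal (Real.sqrt G.det) ≠ 0 := by simpa using hG.det_pos
  have hA0 : ENNReal.ofReal (Real.sqrt A.det) ≠ 0 := by simpa using hA.det_pos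
  have hker : ∫⁻ y, gaussianKernel A y ≠ ∞ := by
    have h1 := gaussianMass_ne_top hA
    rw [gaussianMass] at h1
    simp only [gaussian_eq_mul_kernel] at h1
    rw [lintegral_const_mul' _ _ ENNReal.ofReal_ne_top] at h1
    exact fun h2 => h1 (by rw [h2, ENNReal.mul_top hA0])
  -- Finiteness is read off from the convolution: infinite mass of `μ` would make its integral
  -- infinite, but it is a multiple of an integrable gaussian.
  have hμfin : IsFiniteMeasure μ := by
    refine ⟨lt_top_iff_ne_top.2 fun htop => ?_⟩
    have h1 := lintegral_gaussianConv (G := G) μ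
    rw [htop, ENNReal.mul_top (gaussianMass_ne_zero hG)] at h1
    simp only [hconv] at h1
    rw [lintegral_mul_const' _ _ hJt, lintegral_const_mul' _ _ ENNReal.ofReal_ne_top] at h1
    exact ENNReal.mul_ne_top (ENNReal.mul_ne_top ENNReal.ofReal_ne_top hker) hJt h1
  have hμ0 : μ ≠ 0 := by
    intro h0
    have h1 := hconv 0
    rw [h0, gaussianConv, lintegral_zero_measure] at h1
    exact mul_ne_zero (mul_ne_zero hs0 (gaussianKernel_ne_zero _ _)) hJ0 h1.symm
  have hsJ0 : ENNReal.ofReal (Real.sqrt G.det) * J ≠ 0 := mul_ne_zero hs0 hJ0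
  have hsJt : ENNReal.ofReal (Real.sqrt G.det) * J ≠ ∞ := ENNReal.mul_ne_top ENNReal.ofReal_ne_top hJt
  refine ⟨μ, hμfin, hμ0, ENNReal.ofReal (Real.sqrt A.det) / (ENNReal.ofReal (Real.sqrt G.det) * J),
    ENNReal.div_ne_zero.2 ⟨hA0, hsJt⟩, ENNReal.div_ne_top ENNReal.ofReal_ne_top hsJ0, fun x => ?_⟩
  rw [hconv, gaussian_eq_mul_kernel, mul_right_comm, ← mul_assoc,
    ENNReal.div_mul_cancel hsJ0 hsJt]

variable {n m : ℕ} {d : Fin m → ℕ} {B : ∀ j, Matrix (Fin (d j)) (Fin n) ℝ} {c : Fin m → ℝ}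
  {Q : Matrix (Fin n) (Fin n) ℝ} {G : ∀ j, Matrix (Fin (d j)) (Fin (d j)) ℝ}

/-- Gaussian inputs are admissible. -/
lemma inverseConst_le_gaussianInverseConst (hG : ∀ j, (G j).PosDef) :
    inverseConst B c Q G ≤ gaussianInverseConst B c Q G := by
  refine le_iInf₂ fun A hA => ?_
  choose μ hμ h0 r hr0 hrt hr using fun j =>
    exists_gaussian_eq_smul_gaussianConv (hG j) (hA j).1 (hA j).2
  have h1 : BLGaussian B c Q A = BL B c Q fun j => gaussianConv (G j) (μ j) := by
    rw [← BL_smul (fun j x => gaussianConv_ne_top (hG j) (μ j) x)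
      (fun j => lintegral_gaussianConv_ne_top (hG j) (μ j)) hr0 hrt, BLGaussian]
    congr 1
    funext j x
    exact hr j x
  rw [h1]
  exact inverseConst_le fun j => gaussianConv_mem_typeG _ (h0 j)

end GaussianInputs

/-! ### Removing the perturbation -/

section Approximation

lemma ofReal_exp_rpow (X c : ℝ) :
    ENNReal.ofReal (Real.exp X) ^ c = ENNReal.ofReal (Real.exp (X * c)) := by
  rw [ENNReal.ofReal_rpow_of_pos (Real.exp_pos _), Real.exp_mul]

lemma mul_ofReal_exp_rpow {M : ℝ≥0∞} (hM : M ≠ ∞) (X c : ℝ) :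
    (M * ENNReal.ofReal (Real.exp X)) ^ c = M ^ c * ENNReal.ofReal (Real.exp (X * c)) := by
  rw [ENNReal.mul_rpow_of_ne_top hM ENNReal.ofReal_ne_top, ofReal_exp_rpow]

variable {k : ℕ} {G : Matrix (Fin k) (Fin k) ℝ}

/-- A gaussian convolution of a compactly supported measure decays almost like the gaussian. -/
lemma gaussianConv_restrict_rpow_le (hG : G.PosDef) {c : ℝ} (hc : 0 < c) {ε : ℝ} (hε : 0 < ε)
    (R : ℝ) (μ : Measure (Fin k → ℝ)) [IsFiniteMeasure μ] :
    ∃ C : ℝ≥0∞, C ≠ ∞ ∧ ∀ z, gaussianConv G (μ.restrict (Metric.closedBall 0 R)) z ^ c ≤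
      C * ENNReal.ofReal (Real.exp (-Real.pi * (c * (z ⬝ᵥ G *ᵥ z) - ε * c * ‖z‖ ^ 2))) := by
  obtain ⟨K, hK, hKle⟩ := abs_dotProduct_mulVec_le G
  set M : ℝ≥0∞ := ENNReal.ofReal (Real.sqrt G.det * Real.exp (Real.pi * ((K * R) ^ 2 / ε))) *
    μ Set.univ with hM
  have hMt : M ≠ ∞ := ENNReal.mul_ne_top ENNReal.ofReal_ne_top (measure_ne_top _ _)
  refine ⟨M ^ c, ENNReal.rpow_ne_top_of_nonneg hc.le hMt, fun z => ?_⟩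
  have hpt : ∀ a ∈ Metric.closedBall (0 : Fin k → ℝ) R, ENNReal.ofReal (gaussian G (z - a)) ≤
      ENNReal.ofReal (Real.sqrt G.det * Real.exp (Real.pi * ((K * R) ^ 2 / ε))) *
        ENNReal.ofReal (Real.exp (-Real.pi * (z ⬝ᵥ G *ᵥ z - ε * ‖z‖ ^ 2))) := by
    intro a ha
    have haR : ‖a‖ ≤ R := by simpa using ha
    rw [← ENNReal.ofReal_mul (by positivity), mul_assoc, ← Real.exp_add, gaussian]
    refine ENNReal.ofReal_le_ofReal (mul_le_mul_of_nonneg_left (Real.exp_le_exp.2 ?_)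
      (Real.sqrt_nonneg _))
    have h1 : z ⬝ᵥ G *ᵥ a ≤ K * R * ‖z‖ := by
      refine (le_abs_self _).trans ((hKle z a).trans ?_)
      calc K * ‖z‖ * ‖a‖ ≤ K * ‖z‖ * R := by gcongr
        _ = _ := by ring
    have h2 : 2 * (K * R * ‖z‖) ≤ ε * ‖z‖ ^ 2 + (K * R) ^ 2 / ε := by
      have h3 : 0 ≤ (K * R - ε * ‖z‖) ^ 2 / ε := by positivity
      have h4 : (K * R - ε * ‖z‖) ^ 2 / ε =
          (K * R) ^ 2 / ε + ε * ‖z‖ ^ 2 - 2 * (K * R * ‖z‖) := by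
        field_simp
        ring
      linarith
    have h5 := quadForm_nonneg hG a
    rw [quadForm_sub hG.1]
    nlinarith [Real.pi_pos]
  have hle : gaussianConv G (μ.restrict (Metric.closedBall 0 R)) z ≤
      M * ENNReal.ofReal (Real.exp (-Real.pi * (z ⬝ᵥ G *ᵥ z - ε * ‖z‖ ^ 2))) := by
    refine (setLIntegral_mono' Metric.isClosed_closedBall.measurableSet hpt).trans ?_
    rw [setLIntegral_const, hM, mul_right_comm]
    exact mul_le_mul_left (mul_le_mul_right (measure_mono (Set.subset_univ _)) _) _
  refine (ENNReal.rpow_le_rpow hle hc.le).trans (le_of_eq ?_)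
  rw [mul_ofReal_exp_rpow hMt]
  congr 3
  ring

lemma gaussianConv_add (μ ν : Measure (Fin k → ℝ)) (x : Fin k → ℝ) :
    gaussianConv G (μ + ν) x = gaussianConv G μ x + gaussianConv G ν x := by
  rw [gaussianConv, lintegral_add_measure, gaussianConv, gaussianConv]

/-- Adding a wide gaussian gives control on negative powers. -/
lemma gaussianConv_add_rpow_le {c : ℝ} (hc : c < 0) {K : ℝ}
    (hK : ∀ z : Fin k → ℝ, z ⬝ᵥ G *ᵥ z ≤ K * ‖z‖ ^ 2) {ε : ℝ} (hε : 0 < ε) (hG : G.PosDef)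
    (μ γ : Measure (Fin k → ℝ)) {r : ℝ≥0∞} (hr0 : r ≠ 0) (hrt : r ≠ ∞)
    (hr : ∀ x, ENNReal.ofReal (gaussian (ε • G) x) = r * gaussianConv G γ x)
    {s : ℝ≥0∞} (hs0 : s ≠ 0) (hst : s ≠ ∞) :
    ∃ C : ℝ≥0∞, C ≠ ∞ ∧ ∀ z, gaussianConv G (μ + s • γ) z ^ c ≤
      C * ENNReal.ofReal (Real.exp (-Real.pi * (0 - ε * (-c * K) * ‖z‖ ^ 2))) := by
  have hεG : (ε • G).PosDef := hG.smul hε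
  set M : ℝ≥0∞ := s * (r⁻¹ * ENNReal.ofReal (Real.sqrt (ε • G).det)) with hM
  have hd0 : ENNReal.ofReal (Real.sqrt (ε • G).det) ≠ 0 := by simpa using hεG.det_pos
  have hM0 : M ≠ 0 := mul_ne_zero hs0 (mul_ne_zero (ENNReal.inv_ne_zero.2 hrt) hd0)
  have hMt : M ≠ ∞ := ENNReal.mul_ne_top hst
    (ENNReal.mul_ne_top (ENNReal.inv_ne_top.2 hr0) ENNReal.ofReal_ne_top)
  refine ⟨M ^ c, ENNReal.rpow_ne_top_of_ne_zero hM0 hMt, fun z => ?_⟩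
  have hle : M * ENNReal.ofReal (Real.exp (-Real.pi * (ε * (z ⬝ᵥ G *ᵥ z)))) ≤
      gaussianConv G (μ + s • γ) z := by
    rw [gaussianConv_add, gaussianConv_smul]
    refine le_trans (le_of_eq ?_) le_add_self
    have h1 : gaussianConv G γ z = r⁻¹ * ENNReal.ofReal (gaussian (ε • G) z) := by
      rw [hr, ← mul_assoc, ENNReal.inv_mul_cancel hr0 hrt, one_mul]
    rw [h1, gaussian_eq_mul_kernel, gaussianKernel, smul_mulVec, dotProduct_smul, smul_eq_mul, hM]
    ring
  refine (rpow_le_rpow_of_nonpos hle hc.le).trans ?_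
  rw [mul_ofReal_exp_rpow hMt]
  refine mul_le_mul_right (ENNReal.ofReal_le_ofReal (Real.exp_le_exp.2 ?_)) _
  have h2 := mul_le_mul_of_nonneg_left (hK z)
    (mul_nonneg (mul_nonneg Real.pi_pos.le hε.le) (neg_nonneg.2 hc.le))
  linarith

variable {n m : ℕ} {d : Fin m → ℕ} {B : ∀ j, Matrix (Fin (d j)) (Fin n) ℝ} {c : Fin m → ℝ}
  {Q : Matrix (Fin n) (Fin n) ℝ} {G : ∀ j, Matrix (Fin (d j)) (Fin (d j)) ℝ}

lemma exists_norm_mulVec_sq_le {l : ℕ} (A : Matrix (Fin l) (Fin n) ℝ) :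
    ∃ β : ℝ, 0 ≤ β ∧ ∀ x : Fin n → ℝ, ‖A *ᵥ x‖ ^ 2 ≤ β * ‖x‖ ^ 2 := by
  let L : (Fin n → ℝ) →L[ℝ] (Fin l → ℝ) := LinearMap.toContinuousLinearMap A.mulVecLin
  refine ⟨‖L‖ ^ 2, sq_nonneg _, fun x => ?_⟩
  rw [← mul_pow]
  have h : ‖A *ᵥ x‖ ≤ ‖L‖ * ‖x‖ := L.le_opNorm x
  gcongr

/-- Inputs with almost critical gaussian decay have a finite perturbed numerator. -/
lemma exists_numerator_perturb_ne_top
    (hpos : (Q + ∑ j with 0 < c j, c j • ((B j)ᵀ * G j * B j)).PosDef)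
    {b : Fin m → ℝ} (hb : ∀ j, 0 ≤ b j) :
    ∃ ε : ℝ, 0 < ε ∧ ε ≤ 1 ∧ ∀ f : ∀ j, (Fin (d j) → ℝ) → ℝ≥0∞,
      (∀ j, ∃ C : ℝ≥0∞, C ≠ ∞ ∧ ∀ z, f j z ^ c j ≤ C * ENNReal.ofReal (Real.exp (-Real.pi *
        ((if 0 < c j then c j * (z ⬝ᵥ G j *ᵥ z) else 0) - ε * b j * ‖z‖ ^ 2)))) →
      numerator B c (perturb B c Q ε) f ≠ ∞ := by
  obtain ⟨p, hp, hple⟩ := exists_pos_mul_le_quadForm hpos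
  choose β hβ hβle using fun j => exists_norm_mulVec_sq_le (B j)
  -- `S` measures the total loss per unit of `ε`: `d j` comes from the perturbation through `y ⬝ᵥ y
  -- ≤ d j ‖y‖²`, and `b j` from the decay defect. The choice of `ε` keeps the loss below half of
  -- the lower bound `p` given by hypothesis (iii).
  set S := ∑ j, (d j + b j) * β j with hS
  have hS0 : 0 ≤ S := Finset.sum_nonneg fun j _ =>
    mul_nonneg (add_nonneg (Nat.cast_nonneg _) (hb j)) (hβ j)
  set ε := min 1 (p / (2 * (S + 1))) with hεdef
  have hε : 0 < ε := lt_min one_pos (by positivity)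
  have hεS : ε * S ≤ p / 2 := by
    have h1 : ε ≤ p / (2 * (S + 1)) := min_le_right _ _
    calc ε * S ≤ p / (2 * (S + 1)) * (S + 1) := by gcongr; linarith
      _ = p / 2 := by field_simp
  refine ⟨ε, hε, min_le_left _ _, fun f hf => ?_⟩
  choose C hC hfC using hf
  set q : ∀ j, (Fin (d j) → ℝ) → ℝ := fun j z =>
    (if 0 < c j then c j * (z ⬝ᵥ G j *ᵥ z) else 0) - ε * b j * ‖z‖ ^ 2 with hq
  have hquad : ∀ x : Fin n → ℝ,
      p / 2 * ‖x‖ ^ 2 ≤ x ⬝ᵥ perturb B c Q ε *ᵥ x + ∑ j, q j (B j *ᵥ x) := by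
    intro x
    have h1 := hple x
    rw [add_mulVec, dotProduct_add, dotProduct_sum_mulVec] at h1
    have h2 : ∀ j, x ⬝ᵥ (c j • ((B j)ᵀ * G j * B j)) *ᵥ x =
        c j * ((B j *ᵥ x) ⬝ᵥ G j *ᵥ (B j *ᵥ x)) := fun j => by
      rw [smul_mulVec, dotProduct_smul, smul_eq_mul, ← mulVec_mulVec, ← mulVec_mulVec,
        dotProduct_mulVec, vecMul_transpose]
    simp only [h2] at h1
    have h3 : ∑ j, q j (B j *ᵥ x) =
        (∑ j with 0 < c j, c j * ((B j *ᵥ x) ⬝ᵥ G j *ᵥ (B j *ᵥ x))) -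
          ε * ∑ j, b j * ‖B j *ᵥ x‖ ^ 2 := by
      simp only [hq]
      rw [Finset.sum_sub_distrib, Finset.sum_filter, Finset.mul_sum]
      simp only [mul_assoc]
    have h4 : (∑ j with 0 < c j, (B j *ᵥ x) ⬝ᵥ (B j *ᵥ x)) + ∑ j, b j * ‖B j *ᵥ x‖ ^ 2 ≤
        S * ‖x‖ ^ 2 := by
      have h5 : ∑ j with 0 < c j, (B j *ᵥ x) ⬝ᵥ (B j *ᵥ x) ≤ ∑ j, (d j : ℝ) * ‖B j *ᵥ x‖ ^ 2 :=
        (Finset.sum_le_sum_of_subset_of_nonneg (Finset.filter_subset _ _) fun j _ _ =>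
          (sq_nonneg _).trans (norm_sq_le_dotProduct _)).trans
          (Finset.sum_le_sum fun j _ => dotProduct_self_le _)
      refine (add_le_add_left h5 _).trans ?_
      rw [← Finset.sum_add_distrib, hS, Finset.sum_mul]
      refine Finset.sum_le_sum fun j _ => ?_
      rw [← add_mul, mul_assoc]
      exact mul_le_mul_of_nonneg_left (hβle j x) (add_nonneg (Nat.cast_nonneg _) (hb j))
    rw [quadForm_perturb, h3]
    have h6 := mul_le_mul_of_nonneg_left h4 hε.le
    have h7 := mul_le_mul_of_nonneg_right hεS (sq_nonneg ‖x‖)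
    linarith
  have hle : numerator B c (perturb B c Q ε) f ≤ ∫⁻ x : Fin n → ℝ, (∏ j, C j) *
      ENNReal.ofReal (Real.exp (-(Real.pi * (p / 2)) * ‖x‖ ^ 2)) := by
    refine lintegral_mono fun x => ?_
    calc gaussianKernel (perturb B c Q ε) x * ∏ j, f j (B j *ᵥ x) ^ c j
        ≤ gaussianKernel (perturb B c Q ε) x *
          ∏ j, C j * ENNReal.ofReal (Real.exp (-Real.pi * q j (B j *ᵥ x))) :=
          mul_le_mul_right (Finset.prod_le_prod' fun j _ => hfC j _) _
      _ = (∏ j, C j) * ENNReal.ofReal (Real.exp (-Real.pi *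
          (x ⬝ᵥ perturb B c Q ε *ᵥ x + ∑ j, q j (B j *ᵥ x)))) := by
          rw [Finset.prod_mul_distrib, mul_left_comm, gaussianKernel,
            ← ENNReal.ofReal_prod_of_nonneg fun j _ => (Real.exp_pos _).le, ← Real.exp_sum,
            ← ENNReal.ofReal_mul (Real.exp_pos _).le, ← Real.exp_add, ← Finset.mul_sum, ← mul_add]
      _ ≤ _ := by
          refine mul_le_mul_right (ENNReal.ofReal_le_ofReal (Real.exp_le_exp.2 ?_)) _
          have := mul_le_mul_of_nonneg_left (hquad x) Real.pi_pos.le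
          linarith
  refine ne_top_of_le_ne_top ?_ hle
  have hCt : ∏ j, C j ≠ ∞ := ENNReal.prod_ne_top fun j _ => hC j
  rw [lintegral_const_mul' _ _ hCt]
  exact ENNReal.mul_ne_top hCt (lintegral_exp_neg_norm_sq_lt_top (by positivity)).ne

lemma gaussianKernel_perturb_mono {δ ε : ℝ} (h : δ ≤ ε) (x : Fin n → ℝ) :
    gaussianKernel (perturb B c Q δ) x ≤ gaussianKernel (perturb B c Q ε) x := by
  refine ENNReal.ofReal_le_ofReal (Real.exp_le_exp.2 ?_)
  rw [quadForm_perturb, quadForm_perturb]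
  have h1 : 0 ≤ ∑ j with 0 < c j, (B j *ᵥ x) ⬝ᵥ (B j *ᵥ x) :=
    Finset.sum_nonneg fun j _ => (sq_nonneg _).trans (norm_sq_le_dotProduct _)
  have h2 := mul_le_mul_of_nonneg_right h h1
  nlinarith [Real.pi_pos]

/-- The perturbed numerators converge as the perturbation vanishes. -/
lemma tendsto_numerator_perturb (hG : ∀ j, (G j).PosDef) {f : ∀ j, (Fin (d j) → ℝ) → ℝ≥0∞}
    (hf : ∀ j, f j ∈ typeG (G j)) {ε : ℝ} (hε : 0 < ε)
    (hfin : numerator B c (perturb B c Q ε) f ≠ ∞) :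
    Tendsto (fun i : ℕ => numerator B c (perturb B c Q (ε / (i + 1))) f) atTop
      (𝓝 (numerator B c Q f)) := by
  have hprod : ∀ x : Fin n → ℝ, ∏ j, f j (B j *ᵥ x) ^ c j ≠ ∞ := fun x =>
    prod_rpow_ne_top _ _ (fun j => ne_zero_of_mem_typeG (hG j) (hf j) _)
      fun j => ne_top_of_mem_typeG (hG j) (hf j) _
  refine tendsto_lintegral_of_dominated_convergence _
    (fun i => measurable_integrand fun j => (continuous_of_mem_typeG (hG j) (hf j)).measurable)
    (fun i => Eventually.of_forall fun x =>
      mul_le_mul_left (gaussianKernel_perturb_mono (div_le_self hε.le ?_) x) _) hfin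
    (Eventually.of_forall fun x => ?_)
  · linarith [Nat.cast_nonneg (α := ℝ) i]
  · refine ENNReal.Tendsto.mul_const ?_ (Or.inr (hprod x))
    refine (ENNReal.continuous_ofReal.tendsto _).comp ((Real.continuous_exp.tendsto _).comp
      (Tendsto.const_mul _ ?_))
    simp only [quadForm_perturb]
    have h1 : Tendsto (fun i : ℕ => ε / ((i : ℝ) + 1)) atTop (𝓝 0) :=
      tendsto_const_nhds.div_atTop (tendsto_atTop_add_const_right _ _ tendsto_natCast_atTop_atTop)
    have h2 := (h1.mul_const (∑ j with 0 < c j, (B j *ᵥ x) ⬝ᵥ (B j *ᵥ x))).const_sub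
      (x ⬝ᵥ Q *ᵥ x)
    rwa [zero_mul, sub_zero] at h2

lemma isHermitian_perturb (hQ : Q.IsHermitian) (δ : ℝ) : (perturb B c Q δ).IsHermitian := by
  have h1 : (∑ j with 0 < c j, (B j)ᵀ * B j).IsHermitian := by
    refine IsHermitian.ext fun i j => ?_
    simp only [star_trivial, Matrix.sum_apply, mul_apply, transpose_apply]
    exact Finset.sum_congr rfl fun l _ => Finset.sum_congr rfl fun _ _ => mul_comm _ _
  rw [perturb, IsHermitian, conjTranspose_sub, conjTranspose_smul, hQ.eq, h1.eq, star_trivial]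

/-- The perturbation raises the kernel and leaves the denominators alone. This monotonicity spares
any limit of gaussian constants as `δ → 0`. -/
lemma gaussianInverseConst_le_perturb {δ : ℝ} (hδ : 0 ≤ δ) :
    gaussianInverseConst B c Q G ≤ gaussianInverseConst B c (perturb B c Q δ) G :=
  iInf₂_mono fun _ _ => ENNReal.div_le_div_right (lintegral_mono fun x =>
    mul_le_mul_left (gaussianKernel_le_perturb hδ x) _) _

/-- The gaussian lower bound for inputs with finite perturbed numerator. -/
lemma gaussianInverseConst_mul_le (h : IsNondegenerate B c Q G)
    {f : ∀ j, (Fin (d j) → ℝ) → ℝ≥0∞} (hf : ∀ j, f j ∈ typeG (G j)) {ε : ℝ} (hε : 0 < ε)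
    (hfin : numerator B c (perturb B c Q ε) f ≠ ∞) :
    gaussianInverseConst B c Q G * ∏ j, (∫⁻ y, f j y) ^ c j ≤ numerator B c Q f := by
  refine ge_of_tendsto' (tendsto_numerator_perturb h.posDef hf hε hfin) fun i => ?_
  have hi : 0 < ε / ((i : ℝ) + 1) := by positivity
  refine le_trans (mul_le_mul_left ?_ _) (inverseConst_mul_le h.posDef hf)
  exact (gaussianInverseConst_le_perturb hi.le).trans
    ((isCoercive_perturb h hi).gaussianInverseConst_le h.posDef h.exponent_ne_zero
      (isHermitian_perturb h.selfAdjoint _))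

/-- The gaussian lower bound for all inputs of type `G`. -/
lemma gaussianInverseConst_le_BL (h : IsNondegenerate B c Q G)
    {f : ∀ j, (Fin (d j) → ℝ) → ℝ≥0∞} (hf : ∀ j, f j ∈ typeG (G j)) :
    gaussianInverseConst B c Q G ≤ BL B c Q f := by
  have hG := h.posDef
  rw [le_BL_iff hG hf]
  have hK : ∀ j, ∃ K : ℝ, 0 ≤ K ∧ ∀ z : Fin (d j) → ℝ, z ⬝ᵥ G j *ᵥ z ≤ K * ‖z‖ ^ 2 := fun j => by
    obtain ⟨K, hK, hle⟩ := abs_dotProduct_mulVec_le (G j)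
    exact ⟨K, hK, fun z => (le_abs_self _).trans ((hle z z).trans_eq (by ring))⟩
  choose K hK0 hK using hK
  -- The defects `b j` match `gaussianConv_restrict_rpow_le` and `gaussianConv_add_rpow_le`; the
  -- bound `ε ≤ 1` makes `ε • G j ≤ G j`, so the wide gaussian is itself of type `G j` up to a
  -- factor.
  obtain ⟨ε, hε, hε1, hfin⟩ := exists_numerator_perturb_ne_top h.pos_at_G
    (b := fun j => if 0 < c j then c j else -c j * K j) (fun j => by
      split_ifs with hj
      · exact hj.le
      · exact mul_nonneg (neg_nonneg.2 (not_lt.1 hj)) (hK0 j))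
  have hεG : ∀ j, (G j - ε • G j).PosSemidef := fun j => by
    have : G j - ε • G j = (1 - ε) • G j := by rw [sub_smul, one_smul]
    rw [this]
    exact (hG j).posSemidef.smul (sub_nonneg.2 hε1)
  choose γ hγ hγ0 r hr0 hrt hr using fun j =>
    exists_gaussian_eq_smul_gaussianConv (hG j) ((hG j).smul hε) (hεG j)
  choose μ hμ hμ0 hfμ using hf
  obtain rfl : f = fun j => gaussianConv (G j) (μ j) := funext hfμ
  set s : ℕ → ℝ≥0∞ := fun i => ((i : ℝ≥0∞) + 1)⁻¹ with hs
  have hs0 : ∀ i, s i ≠ 0 := fun i => ENNReal.inv_ne_zero.2 (by simp)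
  have hst : ∀ i, s i ≠ ∞ := fun i => ENNReal.inv_ne_top.2 (by simp)
  have hslim : Tendsto s atTop (𝓝 0) := by
    have := (tendsto_add_atTop_iff_nat 1).2 ENNReal.tendsto_inv_nat_nhds_zero
    simpa [hs] using this
  -- Truncation lowers `f_j` where `c_j > 0`, and the added gaussian raises it where `c_j < 0`. Both
  -- lower `f_j ^ c_j`, so the modified numerator stays below the original one.
  set ν : ℕ → ∀ j, Measure (Fin (d j) → ℝ) := fun i j =>
    if 0 < c j then (μ j).restrict (Metric.closedBall 0 i) else μ j + s i • γ j with hν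
  have hνpos : ∀ i j, 0 < c j → ν i j = (μ j).restrict (Metric.closedBall 0 i) :=
    fun i j hj => if_pos hj
  have hνneg : ∀ i j, ¬ 0 < c j → ν i j = μ j + s i • γ j := fun i j hj => if_neg hj
  have hνfin : ∀ i j, IsFiniteMeasure (ν i j) := fun i j => by
    by_cases hj : 0 < c j
    · rw [hνpos i j hj]
      infer_instance
    · rw [hνneg i j hj]
      have := Measure.smul_finite (γ j) (hst i)
      infer_instance
  have hνlim : ∀ j, Tendsto (fun i => ν i j Set.univ) atTop (𝓝 (μ j Set.univ)) := fun j => by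
    by_cases hj : 0 < c j
    · simp only [hνpos _ j hj, Measure.restrict_apply_univ]
      have h1 : Monotone fun i : ℕ => Metric.closedBall (0 : Fin (d j) → ℝ) (i : ℝ) :=
        fun a b hab => Metric.closedBall_subset_closedBall (Nat.cast_le.2 hab)
      have h2 := tendsto_measure_iUnion_atTop (μ := μ j) h1
      rwa [Metric.iUnion_closedBall_nat] at h2
    · simp only [hνneg _ j hj, Measure.add_apply, Measure.smul_apply, smul_eq_mul]
      have h1 := ENNReal.Tendsto.mul_const (b := γ j Set.univ) hslim
        (Or.inr (measure_ne_top _ _))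
      have h2 := h1.const_add (μ j Set.univ)
      rwa [zero_mul, add_zero] at h2
  have hμu : ∀ j, μ j Set.univ ≠ 0 := fun j => by simpa using hμ0 j
  have hκ0 := fun j => gaussianMass_ne_zero (hG j)
  have hκt := fun j => gaussianMass_ne_top (hG j)
  have hden : Tendsto (fun i => gaussianInverseConst B c Q G *
      ∏ j, (∫⁻ y, gaussianConv (G j) (ν i j) y) ^ c j) atTop
      (𝓝 (gaussianInverseConst B c Q G * ∏ j, (∫⁻ y, gaussianConv (G j) (μ j) y) ^ c j)) := by
    simp only [lintegral_gaussianConv]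
    have h0 : ∀ j, gaussianMass (G j) * μ j Set.univ ≠ 0 := fun j => mul_ne_zero (hκ0 j) (hμu j)
    have ht : ∀ j, gaussianMass (G j) * μ j Set.univ ≠ ∞ := fun j =>
      ENNReal.mul_ne_top (hκt j) (measure_ne_top _ _)
    -- The gaussian constant is not known to be finite here; the limit of the product being nonzero
    -- makes multiplication by it continuous.
    refine ENNReal.Tendsto.const_mul (tendsto_finsetProd_of_ne_zero _ (fun j _ => ?_) fun j _ =>
      (ENNReal.rpow_pos (pos_iff_ne_zero.2 (h0 j)) (ht j)).ne') (Or.inl (prod_rpow_ne_zero _ _ h0 ht))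
    exact (ENNReal.continuous_rpow_const.tendsto _).comp
      (ENNReal.Tendsto.const_mul (hνlim j) (Or.inr (hκt j)))
  -- A truncated measure may vanish for small radii, so the modified inputs are admissible only
  -- eventually.
  have hev : ∀ᶠ i in atTop, ∀ j, ν i j Set.univ ≠ 0 :=
    eventually_all.2 fun j => (hνlim j).eventually_ne (hμu j)
  refine le_of_tendsto hden (hev.mono fun i hi => ?_)
  have hmem : ∀ j, gaussianConv (G j) (ν i j) ∈ typeG (G j) := fun j =>
    gaussianConv_mem_typeG _ (by simpa using hi j)
  refine (gaussianInverseConst_mul_le h hmem hε (hfin _ fun j => ?_)).trans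
    (lintegral_mono fun x => mul_le_mul_right (Finset.prod_le_prod' fun j _ => ?_) _)
  · by_cases hj : 0 < c j
    · simp only [hνpos i j hj, if_pos hj]
      exact gaussianConv_restrict_rpow_le (hG j) hj hε _ (μ j)
    · simp only [hνneg i j hj, if_neg hj]
      exact gaussianConv_add_rpow_le (lt_of_le_of_ne (not_lt.1 hj) (h.exponent_ne_zero j)) (hK j) hε
        (hG j) (μ j) (γ j) (hr0 j) (hrt j) (hr j) (hs0 i) (hst i)
  · change gaussianConv (G j) (ν i j) (B j *ᵥ x) ^ c j ≤ gaussianConv (G j) (μ j) (B j *ᵥ x) ^ c j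
    by_cases hj : 0 < c j
    · rw [hνpos i j hj]
      exact ENNReal.rpow_le_rpow (lintegral_mono' Measure.restrict_le_self le_rfl) hj.le
    · rw [hνneg i j hj, gaussianConv_add]
      exact rpow_le_rpow_of_nonpos le_self_add (not_lt.1 hj)

end Approximation

end InverseBL

theorem theoremt {n m : ℕ} {d : Fin m → ℕ}
    (B : ∀ j, Matrix (Fin (d j)) (Fin n) ℝ) (c : Fin m → ℝ) (Q : Matrix (Fin n) (Fin n) ℝ)
    (G : ∀ j, Matrix (Fin (d j)) (Fin (d j)) ℝ)
    (h : InverseBL.IsNondegenerate B c Q G) :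
    InverseBL.inverseConst B c Q G = InverseBL.gaussianInverseConst B c Q G :=
  le_antisymm (InverseBL.inverseConst_le_gaussianInverseConst h.posDef)
    (le_iInf₂ fun _ hf => InverseBL.gaussianInverseConst_le_BL h hf)
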